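/- Let $V=\{f\in C(\mathbb R)\cap L^\infty(\mathbb R) : f_\xi\in L^2(\mathbb R)\}$ with $\|f\|_V=\|f\|_{L^\infty}+\|f_\xi\|_{L^2}$, and let $E=V\times H^1(\mathbb R)\times V$ with $\|(\zeta,U,H)\|=\|\zeta\|_V+\|U\|_{H^1}+\|H\|_V$. For $X=(\zeta,U,H)$ write $y(\xi)=\zeta(\xi)+\xi$. Let $\mathcal G$ be the set of all $X=(\zeta,U,H)\in E$ with $\zeta,U,H\in W^{1,\infty}(\mathbb R)$, with $y_\xi\ge0$, $H_\xi\ge 0$, $y_\xi+H_\xi>0$ and $y_\xi H_\xi=y_\xi^2U^2+U_\xi^2$ almost everywhere, and with $\lim_{\xi\to-\infty}H(\xi)=0$. For $X_0\in\mathcal G$ let $S_tX_0=X(t)$, where $X=(\zeta,U,H)$ is the solution in $C^1([0,\infty),E)$, with values in $\mathcal G$ and $X(0)=X_0$, of $$\zeta_t=U,\qquad U_t=-Q,\qquad H_t=U^3-2PU,$$ $$P(\xi)=\tfrac14\int_{\mathbb R}e^{-|y(\xi)-y(\eta)|}(U^2y_\xi+H_\xi)(\eta)\,d\eta,\qquad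 Q(\xi)=-\tfrac14\int_{\mathbb R}\operatorname{sign}(\xi-\eta)\,e^{-|y(\xi)-y(\eta)|}(U^2y_\xi+H_\xi)(\eta)\,d\eta .$$ Let $G$ be the group of homeomorphisms $f$ of $\mathbb R$ such that $f-\mathrm{id}$ and $f^{-1}-\mathrm{id}$ belong to $W^{1,\infty}(\mathbb R)$ and $f_\xi-1\in L^2(\mathbb R)$. It acts by relabeling, $X\circ f=(y\circ f,U\circ f,H\circ f)$ (so that the first component of $X\circ f$ in $E$ is $y\circ f-\mathrm{id}$). Put $\mathcal F=\{X\in\mathcal G: y+H\in G\}$, $\mathcal F_0=\{X\in\mathcal G: y+H=\mathrm{id}\}$, $\mathcal F_0^M=\{X\in\mathcal F_0:\|H\|_{L^\infty}\le M\}$, and, for $X\in\mathcal F$, $\Pi(X)=X\circ(y+H)^{-1}$. Let $\bar S_t=\Pi\circ S_t$. Finally put $$J(X_\alpha,X_\beta)=\inf_{f_1,f_2\in G}\bigl(\|X_\alpha\circ f_1-X_\beta\|+\|X_\alpha-X_\beta\circ f_2\|\bigr),\qquad d^M(X_\alpha,X_\beta)=\inf\sum_{n=1}^NJ(X_{n-1},X_n),$$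 where the second infimum is over all finite sequences $X_0,\dots,X_N$ in $\mathcal F_0^M$ with $X_0=X_\alpha$ and $X_N=X_\beta$. **Theorem.** Let $T>0$ and $M>0$. For every $X_0\in\mathcal F_0^M$ the above system has a unique global solution with initial data $X_0$, and $S_tX_0\in\mathcal F$ and $\bar S_tX_0\in\mathcal F_0^M$ for all $t\ge0$. Moreover, there is a constant $C_M$, depending only on $M$ and $T$, such that for all $X_\alpha,X_\beta\in\mathcal F_0^M$ and all $t\in[0,T]$, $$d^M(\bar S_tX_\alpha,\bar S_tX_\beta)\le C_M\,d^M(X_\alpha,X_\beta).$$ -/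

import Mathlib

open Set Filter Topology MeasureTheory
open scoped ENNReal ContDiff

noncomputable section

namespace CamassaHolm

/-! ## Weak derivatives and function spaces on the real line -/

/-- `g` is a weak (distributional) derivative of `f` on `ℝ`. -/
def HasWeakDeriv (f g : ℝ → ℝ) : Prop :=
  LocallyIntegrable f ∧ LocallyIntegrable g ∧
    ∀ φ : ℝ → ℝ, ContDiff ℝ ∞ φ → HasCompactSupport φ →
      ∫ x, f x * deriv φ x = -∫ x, g x * φ x

/-- Weak derivatives are unique up to a null set. -/
theorem HasWeakDeriv.ae_unique {f g h : ℝ → ℝ} (hg : HasWeakDeriv f g)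
    (hh : HasWeakDeriv f h) : g =ᵐ[volume] h := by
  refine ae_eq_of_integral_contDiff_smul_eq hg.2.1 hh.2.1 fun φ hφ hc => ?_
  have h1 := hg.2.2 φ hφ hc
  have h2 := hh.2.2 φ hφ hc
  simp only [smul_eq_mul, mul_comm (φ _)]
  linarith

open Classical in
/-- A representative `f_ξ` of the weak derivative of `f` (zero if `f` has no weak derivative). -/
def weakDeriv (f : ℝ → ℝ) : ℝ → ℝ :=
  if h : ∃ g, HasWeakDeriv f g then h.choose else 0

/-- `f` is weakly differentiable with `f_ξ ∈ L^p`. -/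
def WeakDerivMemLp (f : ℝ → ℝ) (p : ℝ≥0∞) : Prop :=
  ∃ g, HasWeakDeriv f g ∧ MemLp g p

/-- `V = {f ∈ C_b(ℝ) | f_ξ ∈ L²}`. -/
def MemV (f : ℝ → ℝ) : Prop :=
  Continuous f ∧ MemLp f ∞ ∧ WeakDerivMemLp f 2

/-- `H¹(ℝ)`; every class is represented by its continuous representative. -/
def MemH1 (f : ℝ → ℝ) : Prop :=
  Continuous f ∧ MemLp f 2 ∧ WeakDerivMemLp f 2

/-- `W^{1,∞}(ℝ)`. -/
def MemW1inf (f : ℝ → ℝ) : Prop :=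
  MemLp f ∞ ∧ WeakDerivMemLp f ∞

/-- `‖f‖_V = ‖f‖_{L^∞} + ‖f_ξ‖_{L²}`. -/
def normV (f : ℝ → ℝ) : ℝ :=
  lpNorm f ∞ volume + lpNorm (weakDeriv f) 2 volume

/-- `‖f‖_{H¹} = (‖f‖²_{L²} + ‖f_ξ‖²_{L²})^{1/2}`. -/
def normH1 (f : ℝ → ℝ) : ℝ :=
  Real.sqrt (lpNorm f 2 volume ^ 2 + lpNorm (weakDeriv f) 2 volume ^ 2)

/-! ## Lagrangian coordinates -/

/-- Triples `X = (ζ, U, H)` of functions, with their pointwise vector space structure. -/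
abbrev Triple : Type := (ℝ → ℝ) × (ℝ → ℝ) × (ℝ → ℝ)

namespace Triple

/-- The first component `ζ`. -/
def ζ (X : Triple) : ℝ → ℝ := X.1

/-- The Lagrangian velocity `U`. -/
def U (X : Triple) : ℝ → ℝ := X.2.1

/-- The Lagrangian cumulative energy `H`. -/
def H (X : Triple) : ℝ → ℝ := X.2.2

/-- The characteristic `y(ξ) = ζ(ξ) + ξ`. -/
def y (X : Triple) : ℝ → ℝ := fun ξ => X.ζ ξ + ξ

end Triple

/-- `E = V × H¹ × V`. -/
def MemE (X : Triple) : Prop :=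
  MemV X.ζ ∧ MemH1 X.U ∧ MemV X.H

/-- The norm `‖X‖ = ‖ζ‖_V + ‖U‖_{H¹} + ‖H‖_V` of `E`. -/
def normE (X : Triple) : ℝ :=
  normV X.ζ + normH1 X.U + normV X.H

/-- The set `𝒢` of Lagrangian data. -/
structure MemLagrangian (X : Triple) : Prop where
  memE : MemE X
  ζ_lip : MemW1inf X.ζ
  U_lip : MemW1inf X.U
  H_lip : MemW1inf X.H
  sign : ∀ᵐ ξ, 0 ≤ weakDeriv X.y ξ ∧ 0 ≤ weakDeriv X.H ξ ∧
    0 < weakDeriv X.y ξ + weakDeriv X.H ξ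
  H_atBot : Tendsto X.H atBot (𝓝 0)
  energy : ∀ᵐ ξ, weakDeriv X.y ξ * weakDeriv X.H ξ =
    weakDeriv X.y ξ ^ 2 * X.U ξ ^ 2 + weakDeriv X.U ξ ^ 2

/-! ## The evolution in Lagrangian coordinates -/

/-- `P(ξ) = 1/4 ∫ exp(-|y(ξ) - y(η)|) (U² y_ξ + H_ξ)(η) dη`. -/
def P (X : Triple) (ξ : ℝ) : ℝ :=
  1 / 4 * ∫ η, Real.exp (-|X.y ξ - X.y η|) *
    (X.U η ^ 2 * weakDeriv X.y η + weakDeriv X.H η)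

/-- `Q(ξ) = -1/4 ∫ sign(ξ - η) exp(-|y(ξ) - y(η)|) (U² y_ξ + H_ξ)(η) dη`. -/
def Q (X : Triple) (ξ : ℝ) : ℝ :=
  -(1 / 4) * ∫ η, Real.sign (ξ - η) * Real.exp (-|X.y ξ - X.y η|) *
    (X.U η ^ 2 * weakDeriv X.y η + weakDeriv X.H η)

/-- The right-hand side `(U, -Q, U³ - 2PU)` of the system for `(ζ, U, H)`. -/
def rhs (X : Triple) : Triple :=
  (X.U, fun ξ => -Q X ξ, fun ξ => X.U ξ ^ 3 - 2 * P X ξ * X.U ξ)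

/-- `X` (restricted to times `t ≥ 0`) is a global solution in `C¹(ℝ₊, E)`, with values in `𝒢`,
of `ζ_t = U`, `U_t = -Q`, `H_t = U³ - 2PU` with initial data `X₀`: the difference quotients
converge in `E` to the right-hand side (one-sidedly at `t = 0`), and the derivative is a
continuous curve in `E`. -/
structure IsGlobalSolution (X₀ : Triple) (X : ℝ → Triple) : Prop where
  init : X 0 = X₀
  mem : ∀ t, 0 ≤ t → MemLagrangian (X t)
  rhs_mem : ∀ t, 0 ≤ t → MemE (rhs (X t))
  hasDeriv : ∀ t, 0 ≤ t →
    Tendsto (fun s => normE ((s - t)⁻¹ • (X s - X t) - rhs (X t))) (𝓝[Ici 0 \ {t}] t) (𝓝 0)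
  deriv_cont : ∀ t, 0 ≤ t →
    Tendsto (fun s => normE (rhs (X s) - rhs (X t))) (𝓝[Ici 0] t) (𝓝 0)

open Classical in
/-- The semigroup `S_t`: the value at time `t` of the global solution with initial data `X₀`
(and `X₀` itself if there is no global solution). -/
def S (t : ℝ) (X₀ : Triple) : Triple :=
  if h : ∃ X, IsGlobalSolution X₀ X then h.choose t else X₀

/-! ## Relabeling -/

/-- The relabeling group `G`, as a set of homeomorphisms of `ℝ`: `f - id` and `f⁻¹ - id` belong
to `W^{1,∞}` and `f_ξ - 1` belongs to `L²`. -/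
def relabelingGroup : Set (ℝ ≃ₜ ℝ) :=
  {f | MemW1inf (fun ξ => f ξ - ξ) ∧ MemW1inf (fun ξ => f.symm ξ - ξ) ∧
    MemLp (fun ξ => weakDeriv f ξ - 1) 2}

/-- `X ∘ f = (y ∘ f, U ∘ f, H ∘ f)`, whose first component is `ζ = y ∘ f - id`. -/
def relabel (X : Triple) (f : ℝ → ℝ) : Triple :=
  (fun ξ => X.y (f ξ) - ξ, fun ξ => X.U (f ξ), fun ξ => X.H (f ξ))

/-- `ℱ = {X ∈ 𝒢 | y + H ∈ G}`. -/
def F : Set Triple :=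
  {X | MemLagrangian X ∧ ∃ f ∈ relabelingGroup, ∀ ξ, f ξ = X.y ξ + X.H ξ}

/-- `ℱ₀ = {X ∈ 𝒢 | y + H = id}`. -/
def F0 : Set Triple :=
  {X | MemLagrangian X ∧ ∀ ξ, X.y ξ + X.H ξ = ξ}

/-- `ℱ₀^M = {X ∈ ℱ₀ | ‖H‖_{L^∞} ≤ M}`. -/
def F0M (M : ℝ) : Set Triple :=
  {X | X ∈ F0 ∧ lpNorm X.H ∞ volume ≤ M}

/-- The projection `Π(X) = X ∘ (y + H)⁻¹` (for `X ∈ ℱ`, where `y + H` is bijective). -/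
def proj (X : Triple) : Triple :=
  relabel X (Function.invFun fun ξ => X.y ξ + X.H ξ)

/-- `S̄_t = Π ∘ S_t`. -/
def Sbar (t : ℝ) (X₀ : Triple) : Triple := proj (S t X₀)

/-! ## The metric -/

/-- `J(X, Y) = inf_{f₁, f₂ ∈ G} (‖X ∘ f₁ - Y‖ + ‖X - Y ∘ f₂‖)`. -/
def J (X Y : Triple) : ℝ :=
  ⨅ f : relabelingGroup × relabelingGroup,
    (normE (relabel X f.1.1 - Y) + normE (X - relabel Y f.2.1))

/-- `d^M(X, Y) = inf ∑_{n=1}^N J(X_{n-1}, X_n)` over all finite sequences in `ℱ₀^M` from `X`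
to `Y`. -/
def dM (M : ℝ) (X Y : Triple) : ℝ :=
  sInf {s | ∃ (N : ℕ) (Z : ℕ → Triple), (∀ n ≤ N, Z n ∈ F0M M) ∧ Z 0 = X ∧ Z N = Y ∧
    s = ∑ n ∈ Finset.range N, J (Z n) (Z (n + 1))}

end CamassaHolm

end

open Set Filter Topology MeasureTheory
open scoped ENNReal ContDiff

noncomputable section

namespace CamassaHolm

/-! ## Primitives of locally integrable functions -/

/-! The system is an ordinary differential equation in a Banach space. Splitting the integrals in P
and Q at η = ξ and replacing |y(ξ) - y(η)| by the signed difference on each half-line gives a field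
that makes sense on all of E, is Lipschitz on bounded sets (`locLip_field`), and agrees with the
given right-hand side as soon as y is nondecreasing (`rhs_toTriple`). The space E is realised as
`Lag`, a closed subspace of a product of spaces of bounded continuous and of square integrable
functions.

The constraints defining 𝒢 persist because a = y_ξ, w = U_ξ, b = H_ξ - U² y_ξ satisfy the linear
system a' = w, w' = b/2 + κa, b' = 2κw with κ = U² - P. This is the symmetric square of p' = q/2, q'
= κp, so the symmetric matrix with entries a, w, b evolves by congruence with matrices of
determinant one. Hence a, b ≥ 0, a + b > 0 and ab = w², which together encode the sign conditions
and the energy identity, are preserved, and a + b stays comparable to its initial value with a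
factor depending only on M and T (`Adm.transport`, `IsSol.adm_le`).

The time derivative U³ - 2PU of H vanishes at spatial infinity, so the limits of H at both ends do
not change and H stays in [0, M]. Then U² ≤ H and |P|, |Q| ≤ M. Under such sup bounds the field
grows at most linearly (`norm_field_le`), and Grönwall's inequality yields global existence and
Lipschitz dependence on initial data in bounded sets (`exists_norm_bound`,
`exists_lipschitz_bound`). Comparability of a + b makes y + H bi-Lipschitz with a constant depending
only on M and T, so y + H lies in G and Π is composition with an operator of controlled norm.

For stability, the field commutes with relabeling (`field_reparamLag`), so S_t(X ∘ f) = (S_t X) ∘ f.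
If ‖X ∘ f - Y‖ ≤ 1 with X, Y in ℱ₀^M, then X ∘ f lies in a ball whose radius depends only on M,
however large the Lipschitz constant of f is. The Lipschitz estimate for S_t, followed by
composition with the inverse of y + H for S_t Y, compares S̄_t Y with a relabeling of S̄_t X
(`exists_Sbar_relabel_le`). Larger distances are handled by the boundedness of ℱ₀^M (`exists_J_le`),
and the resulting estimate for J is summed along chains. -/

/-- `f` is a primitive of the locally integrable function `g`. -/
structure IsPrimitive (f g : ℝ → ℝ) : Prop where
  locInt : LocallyIntegrable g
  integral_eq : ∀ a b, ∫ x in a..b, g x = f b - f a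

theorem LocallyIntegrable.intervalIntegrable' {g : ℝ → ℝ} (hg : LocallyIntegrable g) (a b : ℝ) :
    IntervalIntegrable g volume a b :=
  (hg.integrableOn_isCompact isCompact_uIcc).intervalIntegrable

namespace IsPrimitive

variable {f g f₁ g₁ f₂ g₂ : ℝ → ℝ}

theorem intervalIntegrable (h : IsPrimitive f g) (a b : ℝ) : IntervalIntegrable g volume a b :=
  LocallyIntegrable.intervalIntegrable' h.locInt a b

theorem congr (h : IsPrimitive f g) (hg : g =ᵐ[volume] g₁) : IsPrimitive f g₁ := by
  refine ⟨h.locInt.congr hg, fun a b => ?_⟩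
  rw [← h.integral_eq a b]
  exact intervalIntegral.integral_congr_ae (hg.mono fun x hx _ => hx.symm)

theorem eq_add (h : IsPrimitive f g) (a b : ℝ) : f b = f a + ∫ x in a..b, g x := by
  rw [h.integral_eq]; ring

theorem absolutelyContinuous (h : IsPrimitive f g) (a b : ℝ) :
    AbsolutelyContinuousOnInterval f a b := by
  have h1 := (h.intervalIntegrable a b).absolutelyContinuousOnInterval_intervalIntegral
    (c := a) left_mem_uIcc
  have h2 : AbsolutelyContinuousOnInterval (fun _ : ℝ => f a) a b := by
    have : LipschitzOnWith 0 (fun _ : ℝ => f a) (uIcc a b) :=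
      (LipschitzWith.const (f a)).lipschitzOnWith
    exact this.absolutelyContinuousOnInterval
  have h3 : f = (fun _ => f a) + fun x => ∫ t in a..x, g t := funext fun x => h.eq_add a x
  rw [h3]
  exact h2.add h1

theorem continuous (h : IsPrimitive f g) : Continuous f := by
  have : f = fun x => f 0 + ∫ t in (0 : ℝ)..x, g t := funext fun x => h.eq_add 0 x
  rw [this]
  exact continuous_const.add
    (intervalIntegral.continuous_primitive (fun a b => h.intervalIntegrable a b) 0)

theorem ae_hasDerivAt (h : IsPrimitive f g) : ∀ᵐ x, HasDerivAt f (g x) x := by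
  have key : ∀ n : ℕ, ∀ᵐ x, x ∈ uIcc (-(n : ℝ)) n →
      HasDerivAt (fun x => ∫ t in (-(n : ℝ))..x, g t) (g x) x := fun n => by
    filter_upwards [(h.intervalIntegrable (-(n : ℝ)) n).ae_hasDerivAt_integral] with x hx hx'
    exact hx hx' _ left_mem_uIcc
  filter_upwards [ae_all_iff.2 key] with x hx
  obtain ⟨n, hn⟩ := exists_nat_ge |x|
  have h1 := hx n (by
    rw [uIcc_of_le (by linarith [abs_nonneg x])]
    exact abs_le.1 hn)
  have : f = fun x => f (-(n : ℝ)) + ∫ t in (-(n : ℝ))..x, g t := funext fun x => h.eq_add _ x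
  rw [this]
  exact h1.const_add _

theorem deriv_ae (h : IsPrimitive f g) : deriv f =ᵐ[volume] g :=
  h.ae_hasDerivAt.mono fun _ hx => hx.deriv

theorem of_absolutelyContinuous (h : ∀ a b, AbsolutelyContinuousOnInterval f a b)
    (hg : LocallyIntegrable g) (hd : ∀ᵐ x, HasDerivAt f (g x) x) : IsPrimitive f g := by
  refine ⟨hg, fun a b => ?_⟩
  rw [← (h a b).integral_deriv_eq_sub]
  exact intervalIntegral.integral_congr_ae (hd.mono fun x hx _ => hx.deriv.symm)

theorem const (c : ℝ) : IsPrimitive (fun _ => c) (fun _ => 0) :=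
  ⟨locallyIntegrable_const 0, fun a b => by simp⟩

theorem id : IsPrimitive (fun x => x) (fun _ => 1) :=
  ⟨locallyIntegrable_const 1, fun a b => by simp⟩

theorem add (h₁ : IsPrimitive f₁ g₁) (h₂ : IsPrimitive f₂ g₂) :
    IsPrimitive (fun x => f₁ x + f₂ x) (fun x => g₁ x + g₂ x) := by
  refine ⟨h₁.locInt.add h₂.locInt, fun a b => ?_⟩
  rw [intervalIntegral.integral_add (h₁.intervalIntegrable a b) (h₂.intervalIntegrable a b),
    h₁.integral_eq, h₂.integral_eq]
  ring

theorem const_mul (c : ℝ) (h : IsPrimitive f g) :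
    IsPrimitive (fun x => c * f x) (fun x => c * g x) := by
  refine ⟨h.locInt.smul c, fun a b => ?_⟩
  rw [intervalIntegral.integral_const_mul, h.integral_eq]
  ring

theorem neg (h : IsPrimitive f g) : IsPrimitive (fun x => -f x) (fun x => -g x) := by
  simpa using h.const_mul (-1)

theorem sub (h₁ : IsPrimitive f₁ g₁) (h₂ : IsPrimitive f₂ g₂) :
    IsPrimitive (fun x => f₁ x - f₂ x) (fun x => g₁ x - g₂ x) := by
  simpa [sub_eq_add_neg] using h₁.add h₂.neg

theorem mul (h₁ : IsPrimitive f₁ g₁) (h₂ : IsPrimitive f₂ g₂) :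
    IsPrimitive (fun x => f₁ x * f₂ x) (fun x => g₁ x * f₂ x + f₁ x * g₂ x) := by
  refine of_absolutelyContinuous
    (fun a b => (h₁.absolutelyContinuous a b).fun_mul (h₂.absolutelyContinuous a b)) ?_ ?_
  · exact (h₁.locInt.mul_continuous h₂.continuous).add (h₂.locInt.continuous_mul h₁.continuous)
  · filter_upwards [h₁.ae_hasDerivAt, h₂.ae_hasDerivAt] with x hx₁ hx₂
    exact hx₁.mul hx₂

end IsPrimitive

/-- The Lipschitz condition is only asked on a set containing the values of `f`, because the
intended outer function is the exponential. Dividing ε by `C + 1` instead of `C` covers `C = 0`. -/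
theorem _root_.AbsolutelyContinuousOnInterval.lipschitz_comp {φ f : ℝ → ℝ} {a b : ℝ} {s : Set ℝ}
    {C : NNReal} (hφ : LipschitzOnWith C φ s) (hf : AbsolutelyContinuousOnInterval f a b)
    (hs : MapsTo f (uIcc a b) s) : AbsolutelyContinuousOnInterval (fun x => φ (f x)) a b := by
  rw [absolutelyContinuousOnInterval_iff] at hf ⊢
  intro ε hε
  obtain ⟨δ, hδ, h⟩ := hf (ε / (C + 1)) (by positivity)
  refine ⟨δ, hδ, fun E hE hlt => ?_⟩
  have h1 := h E hE hlt
  calc ∑ i ∈ Finset.range E.1, dist (φ (f (E.2 i).1)) (φ (f (E.2 i).2))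
      ≤ ∑ i ∈ Finset.range E.1, (C + 1) * dist (f (E.2 i).1) (f (E.2 i).2) := by
        refine Finset.sum_le_sum fun i hi => ?_
        have h2 := hE.1 i hi
        refine (hφ.dist_le_mul _ (hs h2.1) _ (hs h2.2)).trans ?_
        gcongr
        linarith
    _ = (C + 1) * ∑ i ∈ Finset.range E.1, dist (f (E.2 i).1) (f (E.2 i).2) := by
        rw [Finset.mul_sum]
    _ < (C + 1) * (ε / (C + 1)) := by gcongr
    _ = ε := by field_simp

namespace IsPrimitive

variable {f g f₁ g₁ f₂ g₂ : ℝ → ℝ}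

theorem exp (h : IsPrimitive f g) :
    IsPrimitive (fun x => Real.exp (f x)) (fun x => Real.exp (f x) * g x) := by
  refine of_absolutelyContinuous (fun a b => ?_)
    (h.locInt.continuous_mul (Real.continuous_exp.comp h.continuous)) ?_
  · obtain ⟨R, hR⟩ := (isCompact_uIcc (a := a) (b := b)).exists_bound_of_continuousOn
      h.continuous.continuousOn
    obtain ⟨C, hC⟩ := (Real.contDiff_exp (n := 1)).contDiffOn.exists_lipschitzOnWith
      (s := Icc (-R) R) one_ne_zero (convex_Icc _ _) isCompact_Icc
    exact AbsolutelyContinuousOnInterval.lipschitz_comp hC (h.absolutelyContinuous a b)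
      fun x hx => abs_le.1 (hR x hx)
  · filter_upwards [h.ae_hasDerivAt] with x hx
    exact hx.exp

/-- Integration by parts for absolutely continuous functions, on an interval beyond whose endpoints
the test function vanishes. -/
theorem hasWeakDeriv (h : IsPrimitive f g) : HasWeakDeriv f g := by
  refine ⟨h.continuous.locallyIntegrable, h.locInt, fun φ hφ hc => ?_⟩
  have hd : Differentiable ℝ φ := hφ.differentiable (by simp)
  have hdc : HasCompactSupport (deriv φ) := hc.deriv
  obtain ⟨R, hR⟩ := (hc.isCompact.isBounded).subset_closedBall 0
  have hR' : ∀ x, x ∉ Ioc (-(|R| + 1)) (|R| + 1) → φ x = 0 ∧ deriv φ x = 0 := by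
    intro x hx
    have hx' : x ∉ tsupport φ := fun hx2 => hx (by
      have := hR hx2
      rw [mem_closedBall_zero_iff, Real.norm_eq_abs] at this
      have h2 := abs_le.1 (this.trans (le_abs_self R))
      constructor <;> linarith)
    exact ⟨image_eq_zero_of_notMem_tsupport hx', by
      have : x ∉ tsupport (deriv φ) := fun h3 => hx' (tsupport_deriv_subset h3)
      exact image_eq_zero_of_notMem_tsupport this⟩
  have hle : -(|R| + 1) ≤ |R| + 1 := by linarith [abs_nonneg R]
  have hφa : ∀ a b, AbsolutelyContinuousOnInterval φ a b := fun a b =>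
    (hφ.of_le (by simp)).contDiffOn.absolutelyContinuousOnInterval
  have key := (h.absolutelyContinuous (-(|R| + 1)) (|R| + 1)).integral_mul_deriv_eq_deriv_mul
    (hφa (-(|R| + 1)) (|R| + 1))
  have e1 : ∫ x, f x * deriv φ x = ∫ x in (-(|R| + 1))..(|R| + 1), f x * deriv φ x := by
    rw [intervalIntegral.integral_of_le hle, setIntegral_eq_integral_of_forall_compl_eq_zero]
    intro x hx
    rw [(hR' x hx).2, mul_zero]
  have e2 : ∫ x, g x * φ x = ∫ x in (-(|R| + 1))..(|R| + 1), g x * φ x := by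
    rw [intervalIntegral.integral_of_le hle, setIntegral_eq_integral_of_forall_compl_eq_zero]
    intro x hx
    rw [(hR' x hx).1, mul_zero]
  -- The right endpoint belongs to the half-open interval, so the vanishing there is obtained by
  -- continuity from the right.
  have z1 : φ (|R| + 1) = 0 := by
    have hc' := hφ.continuous
    by_contra hne
    have hev : ∀ᶠ x in 𝓝[>] (|R| + 1), φ x ≠ 0 :=
      (hc'.continuousAt.eventually_ne hne).filter_mono nhdsWithin_le_nhds
    obtain ⟨x, hx1, hx2⟩ := (hev.and self_mem_nhdsWithin).exists
    exact hx1 (hR' x fun h => absurd h.2 (not_le.2 hx2)).1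
  have z2 : φ (-(|R| + 1)) = 0 := (hR' _ fun h => lt_irrefl _ h.1).1
  rw [e1, e2, key, z1, z2, mul_zero, mul_zero, sub_zero, zero_sub, neg_inj]
  exact intervalIntegral.integral_congr_ae (h.deriv_ae.mono fun x hx _ => by simp only [hx])

theorem weakDeriv_ae (h : IsPrimitive f g) : weakDeriv f =ᵐ[volume] g := by
  have hex : ∃ g, HasWeakDeriv f g := ⟨g, h.hasWeakDeriv⟩
  rw [weakDeriv, dif_pos hex]
  exact hex.choose_spec.ae_unique h.hasWeakDeriv

theorem isPrimitive_weakDeriv (h : IsPrimitive f g) : IsPrimitive f (weakDeriv f) :=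
  h.congr h.weakDeriv_ae.symm

end IsPrimitive

/-- A locally integrable function with vanishing weak derivative is constant. -/
theorem HasWeakDeriv.ae_const {f : ℝ → ℝ} (h : HasWeakDeriv f 0) : ∃ c, f =ᵐ[volume] fun _ => c := by
  let b : ContDiffBump (0 : ℝ) := ⟨1, 2, one_pos, one_lt_two⟩
  let ρ : ℝ → ℝ := b.normed volume
  have hρ : ContDiff ℝ ∞ ρ := b.contDiff_normed
  have hρc : HasCompactSupport ρ := b.hasCompactSupport_normed
  have hρi : ∫ x, ρ x = 1 := b.integral_normed
  refine ⟨∫ x, f x * ρ x, ?_⟩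
  refine ae_eq_of_integral_contDiff_smul_eq h.1 (locallyIntegrable_const _) fun φ hφ hc => ?_
  have hfint : ∀ ψ : ℝ → ℝ, Continuous ψ → HasCompactSupport ψ →
      Integrable fun x => f x * ψ x := fun ψ h1 h2 => by
    simpa [smul_eq_mul, mul_comm] using h.1.integrable_smul_left_of_hasCompactSupport h1 h2
  set m := ∫ x, φ x with hm
  -- Subtracting a multiple of a bump of integral one leaves a test function of mean zero. Its
  -- primitive has compact support again, so it is admissible in the weak formulation.
  let ψ : ℝ → ℝ := fun x => φ x - m * ρ x
  have hψ : ContDiff ℝ ∞ ψ := hφ.sub (contDiff_const.mul hρ)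
  have hψc : HasCompactSupport ψ := hc.sub hρc.mul_left
  have hψint : Integrable ψ := hψ.continuous.integrable_of_hasCompactSupport hψc
  have hψ0 : ∫ x, ψ x = 0 := by
    have h1 : Integrable φ := hφ.continuous.integrable_of_hasCompactSupport hc
    have h2 : Integrable ρ := hρ.continuous.integrable_of_hasCompactSupport hρc
    simp only [ψ]
    rw [integral_sub h1 (h2.const_mul m), integral_const_mul, hρi, mul_one, sub_self]
  let Ψ : ℝ → ℝ := fun x => ∫ t in Iic x, ψ t
  have hder : ∀ x, HasDerivAt Ψ (ψ x) x := fun x => by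
    have e : Ψ = fun x => Ψ 0 + ∫ t in (0 : ℝ)..x, ψ t := funext fun x => by
      rw [← intervalIntegral.integral_Iic_sub_Iic hψint.integrableOn hψint.integrableOn]
      simp [Ψ]
    rw [e]
    exact (intervalIntegral.integral_hasDerivAt_right (hψ.continuous.intervalIntegrable _ _)
      (hψ.continuous.stronglyMeasurableAtFilter _ _) hψ.continuous.continuousAt).const_add _
  have hΨd : deriv Ψ = ψ := funext fun x => (hder x).deriv
  have hΨ : ContDiff ℝ ∞ Ψ := by
    rw [contDiff_infty_iff_deriv]
    exact ⟨fun x => (hder x).differentiableAt, hΨd ▸ hψ⟩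
  have hΨc : HasCompactSupport Ψ := by
    obtain ⟨R, hR⟩ := (hψc.isCompact.isBounded).subset_closedBall 0
    have hz : ∀ x, R < |x| → ψ x = 0 := fun x hx => by
      by_contra hne
      have := hR (subset_tsupport _ (Function.mem_support.2 hne))
      rw [mem_closedBall_zero_iff, Real.norm_eq_abs] at this
      linarith
    refine HasCompactSupport.intro (isCompact_closedBall (0 : ℝ) |R|) fun x hx => ?_
    rw [mem_closedBall_zero_iff, Real.norm_eq_abs, not_le] at hx
    rcases lt_abs.1 hx with h1 | h1
    · have : ∫ t in Ioi x, ψ t = 0 := by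
        rw [setIntegral_congr_fun (g := fun _ => 0) measurableSet_Ioi, integral_zero]
        intro t ht
        exact hz t ((le_abs_self R).trans_lt (h1.trans (ht.trans_le (le_abs_self t))))
      have h2 := intervalIntegral.integral_Iic_add_Ioi (b := x) hψint.integrableOn hψint.integrableOn
      rw [this, hψ0, add_zero] at h2
      exact h2
    · have : ∫ t in Iic x, ψ t = 0 := by
        rw [setIntegral_congr_fun (g := fun _ => 0) measurableSet_Iic, integral_zero]
        intro t ht
        have ht' : t ≤ x := ht
        exact hz t ((le_abs_self R).trans_lt (by linarith [neg_le_abs t]))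
      exact this
  have key := h.2.2 Ψ hΨ hΨc
  simp only [hΨd, Pi.zero_apply, zero_mul, integral_zero, neg_zero] at key
  have h3 : ∫ x, f x * ψ x = (∫ x, f x * φ x) - m * ∫ x, f x * ρ x := by
    rw [← integral_const_mul, ← integral_sub (hfint φ hφ.continuous hc)
      ((hfint ρ hρ.continuous hρc).const_mul m)]
    exact integral_congr_ae (ae_of_all _ fun x => by simp only [ψ]; ring)
  rw [h3] at key
  simp only [smul_eq_mul, mul_comm (φ _)]
  rw [integral_const_mul, ← hm]
  linarith

/-- Subtracting a primitive of `g` leaves a function with zero weak derivative, hence a.e. constant,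
and continuity removes the exceptional set. This trades distributional derivatives for the
fundamental theorem of calculus. -/
theorem HasWeakDeriv.isPrimitive {f g : ℝ → ℝ} (h : HasWeakDeriv f g) (hf : Continuous f) :
    IsPrimitive f g := by
  have h1 : IsPrimitive (fun x => ∫ t in (0 : ℝ)..x, g t) g := ⟨h.2.1, fun a b => by
    rw [← intervalIntegral.integral_interval_sub_left] <;>
      exact LocallyIntegrable.intervalIntegrable' h.2.1 _ _⟩
  have h2 := h1.hasWeakDeriv
  have h3 : HasWeakDeriv (fun x => f x - ∫ t in (0 : ℝ)..x, g t) 0 := by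
    refine ⟨h.1.sub h2.1, locallyIntegrable_const 0, fun φ hφ hc => ?_⟩
    have hi : ∀ f : ℝ → ℝ, LocallyIntegrable f → Integrable fun x => f x * deriv φ x :=
      fun f hf => by
        simpa [smul_eq_mul, mul_comm] using hf.integrable_smul_left_of_hasCompactSupport
          (hφ.continuous_deriv (by simp)) hc.deriv
    simp only [sub_mul, Pi.zero_apply, zero_mul, integral_zero, neg_zero]
    rw [integral_sub (hi _ h.1) (hi _ h2.1), h.2.2 φ hφ hc, h2.2.2 φ hφ hc, sub_self]
  obtain ⟨c, hc⟩ := h3.ae_const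
  have h4 : (fun x => f x - ∫ t in (0 : ℝ)..x, g t) = fun _ => c :=
    Continuous.ae_eq_iff_eq volume (hf.sub h1.continuous) continuous_const |>.1 hc
  have h5 : f = fun x => c + ∫ t in (0 : ℝ)..x, g t := funext fun x => by
    linarith [congrFun h4 x]
  rw [h5]
  simpa using (IsPrimitive.const c).add h1

/-! ## Bounded continuous functions acting on `L²` -/

/-- Bounded continuous functions on the line. -/
abbrev BF : Type := BoundedContinuousFunction ℝ ℝ

/-- Square integrable functions on the line. -/
abbrev L2 : Type := Lp ℝ 2 (volume : Measure ℝ)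

theorem memLp_two_bounded_mul {b f : ℝ → ℝ} {C : ℝ} (hb : AEStronglyMeasurable b)
    (hC : ∀ᵐ x, |b x| ≤ C) (hf : MemLp f 2) : MemLp (fun x => b x * f x) 2 := by
  refine MemLp.of_le_mul hf (hb.mul hf.1) (c := C) (hC.mono fun x hx => ?_)
  rw [norm_mul]
  gcongr
  exact hx

theorem BF.abs_le (b : BF) (x : ℝ) : |b x| ≤ ‖b‖ := b.norm_coe_le_norm x

theorem BF.memLp_mul (b : BF) (f : L2) : MemLp (fun x => b x * f x) 2 :=
  memLp_two_bounded_mul b.continuous.aestronglyMeasurable (ae_of_all _ b.abs_le) (Lp.memLp f)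

/-- Multiplication of a square integrable function by a bounded continuous function. -/
def BF.lmul (b : BF) (f : L2) : L2 := (b.memLp_mul f).toLp _

theorem BF.coeFn_lmul (b : BF) (f : L2) : (b.lmul f : L2) =ᵐ[volume] fun x => b x * f x :=
  MemLp.coeFn_toLp _

namespace BF

theorem one_lmul (f : L2) : (1 : BF).lmul f = f := by
  refine Lp.ext ?_
  filter_upwards [coeFn_lmul 1 f] with x hx
  simpa using hx

theorem mul_lmul (b c : BF) (f : L2) : (b * c).lmul f = b.lmul (c.lmul f) := by
  refine Lp.ext ?_
  filter_upwards [coeFn_lmul (b * c) f, coeFn_lmul b (c.lmul f), coeFn_lmul c f] with x h1 h2 h3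
  rw [h1, h2, h3, BoundedContinuousFunction.mul_apply, mul_assoc]

theorem lmul_zero (b : BF) : b.lmul 0 = 0 := by
  refine Lp.ext ?_
  filter_upwards [coeFn_lmul b 0, Lp.coeFn_zero ℝ 2 (volume : Measure ℝ)] with x h1 h2
  rw [h1, h2, Pi.zero_apply, mul_zero]

theorem lmul_add (b : BF) (f g : L2) : b.lmul (f + g) = b.lmul f + b.lmul g := by
  refine Lp.ext ?_
  filter_upwards [coeFn_lmul b (f + g), coeFn_lmul b f, coeFn_lmul b g, Lp.coeFn_add f g,
    Lp.coeFn_add (b.lmul f) (b.lmul g)] with x h1 h2 h3 h4 h5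
  rw [h1, h5, Pi.add_apply, h2, h3, h4, Pi.add_apply, mul_add]

theorem add_lmul (b c : BF) (f : L2) : (b + c).lmul f = b.lmul f + c.lmul f := by
  refine Lp.ext ?_
  filter_upwards [coeFn_lmul (b + c) f, coeFn_lmul b f, coeFn_lmul c f,
    Lp.coeFn_add (b.lmul f) (c.lmul f)] with x h1 h2 h3 h4
  rw [h1, h4, Pi.add_apply, h2, h3, BoundedContinuousFunction.add_apply, add_mul]

theorem zero_lmul (f : L2) : (0 : BF).lmul f = 0 := by
  refine Lp.ext ?_
  filter_upwards [coeFn_lmul 0 f, Lp.coeFn_zero ℝ 2 (volume : Measure ℝ)] with x h1 h2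
  rw [h1, h2, Pi.zero_apply]
  exact zero_mul _

end BF

/-- With bounded continuous functions as a commutative ring acting on L², the product rule for
scalar multiplication applies to curves, and identities between coefficients become linear algebra
for `module`. -/
instance : Module BF L2 where
  smul := BF.lmul
  one_smul := BF.one_lmul
  mul_smul := BF.mul_lmul
  smul_zero := BF.lmul_zero
  smul_add := BF.lmul_add
  add_smul := BF.add_lmul
  zero_smul := BF.zero_lmul

theorem coeFn_bsmul (b : BF) (f : L2) : (b • f : L2) =ᵐ[volume] fun x => b x * f x :=
  b.coeFn_lmul f

theorem norm_bsmul_le (b : BF) (f : L2) : ‖b • f‖ ≤ ‖b‖ * ‖f‖ := by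
  refine Lp.norm_le_mul_norm_of_ae_le_mul ?_
  filter_upwards [coeFn_bsmul b f] with x hx
  rw [hx, norm_mul]
  gcongr
  exact b.norm_coe_le_norm x

instance : IsBoundedSMul BF L2 := IsBoundedSMul.of_norm_smul_le norm_bsmul_le

instance : IsScalarTower ℝ BF L2 where
  smul_assoc r b f := by
    refine Lp.ext ?_
    filter_upwards [coeFn_bsmul (r • b) f, coeFn_bsmul b f, Lp.coeFn_smul r (b • f)] with x h1 h2 h3
    rw [h1, h3, Pi.smul_apply, h2, BoundedContinuousFunction.smul_apply, smul_eq_mul, smul_eq_mul,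
      mul_assoc]

/-! ### A weight turning bounded functions into square integrable ones -/

/-- The positive weight `x ↦ 1 / (1 + x²)`. -/
def wt : BF := BoundedContinuousFunction.ofNormedAddCommGroup (fun x : ℝ => (1 + x ^ 2)⁻¹)
  (Continuous.inv₀ (by fun_prop) fun x => by positivity) 1 fun x => by
    rw [Real.norm_of_nonneg (by positivity)]
    exact inv_le_one_of_one_le₀ (by nlinarith [sq_nonneg x])

theorem wt_pos (x : ℝ) : 0 < wt x := by
  change (0 : ℝ) < (1 + x ^ 2)⁻¹
  positivity

theorem wt_memLp : MemLp wt 2 := by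
  rw [memLp_two_iff_integrable_sq wt.continuous.aestronglyMeasurable]
  refine integrable_inv_one_add_sq.mono' (wt.continuous.pow 2).aestronglyMeasurable
    (ae_of_all _ fun x => ?_)
  change ‖((1 + x ^ 2)⁻¹ : ℝ) ^ 2‖ ≤ (1 + x ^ 2)⁻¹
  rw [Real.norm_of_nonneg (by positivity), sq]
  exact mul_le_of_le_one_left (by positivity) (inv_le_one_of_one_le₀ (by nlinarith [sq_nonneg x]))

/-- The weight as an element of `L²`. -/
def wtL : L2 := wt_memLp.toLp _

theorem coeFn_wtL : (wtL : ℝ → ℝ) =ᵐ[volume] wt := MemLp.coeFn_toLp _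

/-- The positive weight can be cancelled. The left-hand equation is linear and closed in `(b, f)`,
which is why it is used to state in `LagSpace` that two components represent the same function. -/
theorem bsmul_wtL_eq_iff {b : BF} {f : L2} : b • wtL = wt • f ↔ (f : ℝ → ℝ) =ᵐ[volume] b := by
  constructor
  · intro h
    have h0 : (b • wtL : L2) =ᵐ[volume] (wt • f : L2) := by rw [h]
    filter_upwards [h0, coeFn_bsmul b wtL, coeFn_bsmul wt f, coeFn_wtL] with x h1 h2 h3 h4
    rw [h2, h3, h4, mul_comm] at h1
    exact (mul_left_cancel₀ (wt_pos x).ne' h1).symm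
  · intro h
    refine Lp.ext ?_
    filter_upwards [h, coeFn_bsmul b wtL, coeFn_bsmul wt f, coeFn_wtL] with x h1 h2 h3 h4
    rw [h2, h3, h4, h1, mul_comm]

theorem L2.locallyIntegrable (f : L2) : LocallyIntegrable (f : ℝ → ℝ) :=
  (Lp.memLp f).locallyIntegrable one_le_two

theorem L2.continuous_intervalIntegral (a b : ℝ) :
    Continuous fun f : L2 => ∫ x in a..b, (f : ℝ → ℝ) x := by
  have key : ∀ a b : ℝ, Continuous fun f : L2 => ∫ x in Ioc a b, (f : ℝ → ℝ) x := fun a b => by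
    have : (fun f : L2 => ∫ x in Ioc a b, (f : ℝ → ℝ) x) = fun f : L2 =>
        inner ℝ (indicatorConstLp 2 (measurableSet_Ioc (a := a) (b := b))
          (measure_Ioc_lt_top).ne (1 : ℝ)) f :=
      funext fun f => (L2.inner_indicatorConstLp_one _ _ f).symm
    rw [this]
    exact continuous_const.inner continuous_id
  exact (key a b).sub (key b a)

/-! ## The Banach space of Lagrangian perturbations -/

/-- The ambient Banach space for `(ζ, U, H, ζ_ξ, U, U_ξ, H_ξ)`. -/
abbrev Amb : Type := BF × BF × BF × L2 × L2 × L2 × L2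

/-- The closed subspace of tuples coming from a triple in `E`. -/
def LagSpace : Submodule ℝ Amb where
  carrier := {x | (∀ a b, ∫ t in a..b, x.2.2.2.1 t = x.1 b - x.1 a) ∧
    (x.2.1 • wtL = wt • x.2.2.2.2.1) ∧
    (∀ a b, ∫ t in a..b, x.2.2.2.2.2.1 t = x.2.1 b - x.2.1 a) ∧
    (∀ a b, ∫ t in a..b, x.2.2.2.2.2.2 t = x.2.2.1 b - x.2.2.1 a)}
  zero_mem' := by
    have h : ∀ a b : ℝ, ∫ t in a..b, (0 : L2) t = 0 := fun a b => by
      rw [intervalIntegral.integral_congr_ae (g := fun _ => 0)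
        ((Lp.coeFn_zero ℝ 2 (volume : Measure ℝ)).mono fun x hx _ => hx),
        intervalIntegral.integral_zero]
    refine ⟨fun a b => ?_, ?_, fun a b => ?_, fun a b => ?_⟩
    · exact (h a b).trans (sub_self (0 : ℝ)).symm
    · exact (zero_smul BF wtL).trans (smul_zero wt).symm
    · exact (h a b).trans (sub_self (0 : ℝ)).symm
    · exact (h a b).trans (sub_self (0 : ℝ)).symm
  add_mem' := by
    have h : ∀ (f g : L2) (a b : ℝ), ∫ t in a..b, (f + g : L2) t =
        (∫ t in a..b, f t) + ∫ t in a..b, g t := fun f g a b => by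
      rw [← intervalIntegral.integral_add
        (LocallyIntegrable.intervalIntegrable' (L2.locallyIntegrable f) a b)
        (LocallyIntegrable.intervalIntegrable' (L2.locallyIntegrable g) a b)]
      exact intervalIntegral.integral_congr_ae ((Lp.coeFn_add f g).mono fun x hx _ => hx)
    rintro x y ⟨hx1, hx2, hx3, hx4⟩ ⟨hy1, hy2, hy3, hy4⟩
    refine ⟨fun a b => ?_, ?_, fun a b => ?_, fun a b => ?_⟩
    · simp only [Prod.snd_add, Prod.fst_add, h, hx1, hy1, BoundedContinuousFunction.add_apply]
      ring
    · simp only [Prod.snd_add, Prod.fst_add, add_smul, smul_add, hx2, hy2]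
    · simp only [Prod.snd_add, Prod.fst_add, h, hx3, hy3, BoundedContinuousFunction.add_apply]
      ring
    · simp only [Prod.snd_add, Prod.fst_add, h, hx4, hy4, BoundedContinuousFunction.add_apply]
      ring
  smul_mem' := by
    have h : ∀ (c : ℝ) (f : L2) (a b : ℝ), ∫ t in a..b, (c • f : L2) t =
        c * (∫ t in a..b, f t) := fun c f a b => by
      rw [← intervalIntegral.integral_const_mul]
      exact intervalIntegral.integral_congr_ae ((Lp.coeFn_smul c f).mono fun x hx _ => hx)
    rintro c x ⟨hx1, hx2, hx3, hx4⟩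
    refine ⟨fun a b => ?_, ?_, fun a b => ?_, fun a b => ?_⟩
    · simp only [Prod.smul_snd, Prod.smul_fst, h, hx1, BoundedContinuousFunction.smul_apply,
        smul_eq_mul]
      ring
    · simp only [Prod.smul_snd, Prod.smul_fst, smul_assoc, hx2]
      refine Lp.ext ?_
      filter_upwards [coeFn_bsmul wt (c • x.2.2.2.2.1), coeFn_bsmul wt x.2.2.2.2.1,
        Lp.coeFn_smul c x.2.2.2.2.1, Lp.coeFn_smul c (wt • x.2.2.2.2.1)] with t h1 h2 h3 h4
      rw [h1, h4, Pi.smul_apply, h2, h3, Pi.smul_apply, smul_eq_mul, smul_eq_mul]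
      ring
    · simp only [Prod.smul_snd, Prod.smul_fst, h, hx3, BoundedContinuousFunction.smul_apply,
        smul_eq_mul]
      ring
    · simp only [Prod.smul_snd, Prod.smul_fst, h, hx4, BoundedContinuousFunction.smul_apply,
        smul_eq_mul]
      ring

theorem isClosed_lagSpace : IsClosed (LagSpace : Set Amb) := by
  have hp : ∀ (p : Amb → BF) (q : Amb → L2), Continuous p → Continuous q →
      IsClosed {x : Amb | ∀ a b, ∫ t in a..b, q x t = p x b - p x a} := fun p q hp hq => by
    simp only [ofPred_forall]
    refine isClosed_iInter fun a => isClosed_iInter fun b => isClosed_eq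
      ((L2.continuous_intervalIntegral a b).comp hq) ?_
    exact ((BoundedContinuousFunction.lipschitz_eval_const b).continuous.comp hp).sub
      ((BoundedContinuousFunction.lipschitz_eval_const a).continuous.comp hp)
  refine (hp _ _ ?_ ?_).inter (IsClosed.inter (isClosed_eq ?_ ?_)
    ((hp _ _ ?_ ?_).inter (hp _ _ ?_ ?_))) <;> fun_prop

/-- The Banach space of tuples `(ζ, U, H, ζ_ξ, U, U_ξ, H_ξ)` coming from a triple in `E`. -/
def Lag : Type := LagSpace

instance : NormedAddCommGroup Lag := inferInstanceAs (NormedAddCommGroup LagSpace)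

instance : NormedSpace ℝ Lag := inferInstanceAs (NormedSpace ℝ LagSpace)

instance : CompleteSpace Lag := isClosed_lagSpace.completeSpace_coe

/-- The inclusion into the ambient space. -/
def Lag.incl : Lag →L[ℝ] Amb := LagSpace.subtypeL

theorem Lag.incl_mem (k : Lag) : Lag.incl k ∈ LagSpace := Subtype.property k

theorem continuous_le_of_ae {f g : ℝ → ℝ} (hf : Continuous f) (hg : Continuous g)
    (h : ∀ᵐ x, f x ≤ g x) (x : ℝ) : f x ≤ g x :=
  (isClosed_le hf hg).closure_subset_iff.2 Subset.rfl
    ((Measure.dense_of_ae h).closure_eq ▸ mem_univ x)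

theorem Continuous.abs_le_lpNorm {f : ℝ → ℝ} (hf : Continuous f) (h : MemLp f ∞) (x : ℝ) :
    |f x| ≤ lpNorm f ∞ volume :=
  continuous_le_of_ae hf.abs continuous_const (ae_le_lpNorm_exponent_top h) x

theorem memLp_top_of_abs_le {f : ℝ → ℝ} (hf : AEStronglyMeasurable f) {C : ℝ}
    (h : ∀ᵐ x, |f x| ≤ C) : MemLp f ∞ :=
  memLp_top_of_bound hf C h

theorem lpNorm_top_le {f : ℝ → ℝ} (hf : AEStronglyMeasurable f) {C : ℝ} (hC : 0 ≤ C)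
    (h : ∀ᵐ x, |f x| ≤ C) : lpNorm f ∞ volume ≤ C := by
  rw [← toReal_eLpNorm hf, eLpNorm_exponent_top]
  refine ENNReal.toReal_le_of_le_ofReal hC (eLpNormEssSup_le_of_ae_bound h)

theorem BF.memLp_top (b : BF) : MemLp b ∞ :=
  memLp_top_of_abs_le b.continuous.aestronglyMeasurable (ae_of_all _ b.abs_le)

theorem BF.lpNorm_eq (b : BF) : lpNorm b ∞ volume = ‖b‖ := by
  refine le_antisymm (lpNorm_top_le b.continuous.aestronglyMeasurable (norm_nonneg _)
    (ae_of_all _ b.abs_le)) ?_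
  exact (BoundedContinuousFunction.norm_le lpNorm_nonneg).2
    fun x => Continuous.abs_le_lpNorm b.continuous b.memLp_top x

theorem L2.norm_eq (f : L2) : ‖f‖ = lpNorm f 2 volume := by
  rw [Lp.norm_def, toReal_eLpNorm (Lp.aestronglyMeasurable f)]

theorem lpNorm_congr_ae {f g : ℝ → ℝ} {p : ℝ≥0∞} (h : f =ᵐ[volume] g) :
    lpNorm f p volume = lpNorm g p volume := by
  by_cases hf : AEStronglyMeasurable f
  · rw [← toReal_eLpNorm hf, ← toReal_eLpNorm (hf.congr h), eLpNorm_congr_ae h]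
  · rw [lpNorm_of_not_aestronglyMeasurable hf,
      lpNorm_of_not_aestronglyMeasurable fun hg => hf (hg.congr h.symm)]

theorem norm_toLp_eq_lpNorm {f : ℝ → ℝ} (hf : MemLp f 2) : ‖hf.toLp f‖ = lpNorm f 2 volume := by
  rw [L2.norm_eq, lpNorm_congr_ae hf.coeFn_toLp]

/-! ### Components -/

/-- `ζ` -/
def cζ : Lag →L[ℝ] BF := (ContinuousLinearMap.fst ℝ _ _).comp Lag.incl

/-- `U` -/
def cU : Lag →L[ℝ] BF := (ContinuousLinearMap.fst ℝ _ _).comp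
  ((ContinuousLinearMap.snd ℝ _ _).comp Lag.incl)

/-- `H` -/
def cH : Lag →L[ℝ] BF := (ContinuousLinearMap.fst ℝ _ _).comp
  ((ContinuousLinearMap.snd ℝ _ _).comp ((ContinuousLinearMap.snd ℝ _ _).comp Lag.incl))

/-- The four square integrable components. -/
def tailL : Lag →L[ℝ] L2 × L2 × L2 × L2 := (ContinuousLinearMap.snd ℝ _ _).comp
  ((ContinuousLinearMap.snd ℝ _ _).comp ((ContinuousLinearMap.snd ℝ _ _).comp Lag.incl))

/-- `ζ_ξ` -/
def dζ : Lag →L[ℝ] L2 := (ContinuousLinearMap.fst ℝ _ _).comp tailL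

/-- `U` as an element of `L²` -/
def lU : Lag →L[ℝ] L2 := (ContinuousLinearMap.fst ℝ _ _).comp
  ((ContinuousLinearMap.snd ℝ _ _).comp tailL)

/-- `U_ξ` -/
def dU : Lag →L[ℝ] L2 := (ContinuousLinearMap.fst ℝ _ _).comp
  ((ContinuousLinearMap.snd ℝ _ _).comp ((ContinuousLinearMap.snd ℝ _ _).comp tailL))

/-- `H_ξ` -/
def dH : Lag →L[ℝ] L2 := (ContinuousLinearMap.snd ℝ _ _).comp
  ((ContinuousLinearMap.snd ℝ _ _).comp ((ContinuousLinearMap.snd ℝ _ _).comp tailL))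

theorem isPrimitive_ζ (k : Lag) : IsPrimitive (cζ k) (dζ k) :=
  ⟨L2.locallyIntegrable _, (Lag.incl_mem k).1⟩

theorem isPrimitive_U (k : Lag) : IsPrimitive (cU k) (dU k) :=
  ⟨L2.locallyIntegrable _, (Lag.incl_mem k).2.2.1⟩

theorem isPrimitive_H (k : Lag) : IsPrimitive (cH k) (dH k) :=
  ⟨L2.locallyIntegrable _, (Lag.incl_mem k).2.2.2⟩

theorem lU_ae (k : Lag) : (lU k : ℝ → ℝ) =ᵐ[volume] cU k := bsmul_wtL_eq_iff.1 (Lag.incl_mem k).2.1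

/-- Build an element of the space from its components. -/
def Lag.mk (ζ U H : BF) (v u w h : L2) (hζ : IsPrimitive ζ v) (hu : (u : ℝ → ℝ) =ᵐ[volume] U)
    (hU : IsPrimitive U w) (hH : IsPrimitive H h) : Lag :=
  (⟨(ζ, U, H, v, u, w, h), hζ.2, bsmul_wtL_eq_iff.2 hu, hU.2, hH.2⟩ : LagSpace)

theorem Lag.norm_le_iff {k : Lag} {C : ℝ} : ‖k‖ ≤ C ↔ ‖cζ k‖ ≤ C ∧ ‖cU k‖ ≤ C ∧
    ‖cH k‖ ≤ C ∧ ‖dζ k‖ ≤ C ∧ ‖lU k‖ ≤ C ∧ ‖dU k‖ ≤ C ∧ ‖dH k‖ ≤ C := by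
  change ‖Lag.incl k‖ ≤ C ↔ _
  rw [norm_prod_le_iff, norm_prod_le_iff, norm_prod_le_iff, norm_prod_le_iff, norm_prod_le_iff,
    norm_prod_le_iff]
  rfl

theorem norm_comp_le (k : Lag) : ‖cζ k‖ ≤ ‖k‖ ∧ ‖cU k‖ ≤ ‖k‖ ∧
    ‖cH k‖ ≤ ‖k‖ ∧ ‖dζ k‖ ≤ ‖k‖ ∧ ‖lU k‖ ≤ ‖k‖ ∧ ‖dU k‖ ≤ ‖k‖ ∧ ‖dH k‖ ≤ ‖k‖ :=
  Lag.norm_le_iff.1 le_rfl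

/-- The triple of functions described by an element of the space. -/
def toTriple (k : Lag) : Triple := (cζ k, cU k, cH k)

theorem memV_of_isPrimitive {b : BF} {f : L2} (h : IsPrimitive b f) : MemV b :=
  ⟨b.continuous, b.memLp_top, f, h.hasWeakDeriv, Lp.memLp f⟩

theorem memE_toTriple (k : Lag) : MemE (toTriple k) :=
  ⟨memV_of_isPrimitive (isPrimitive_ζ k), ⟨(cU k).continuous,
    (memLp_congr_ae (lU_ae k)).1 (Lp.memLp (lU k)), _, (isPrimitive_U k).hasWeakDeriv,
    Lp.memLp (dU k)⟩, memV_of_isPrimitive (isPrimitive_H k)⟩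

theorem normV_of_isPrimitive {b : BF} {f : L2} (h : IsPrimitive b f) :
    normV b = ‖b‖ + ‖f‖ := by
  rw [normV, BF.lpNorm_eq, L2.norm_eq, lpNorm_congr_ae h.weakDeriv_ae]

theorem normE_toTriple (k : Lag) : normE (toTriple k) =
    (‖cζ k‖ + ‖dζ k‖) + Real.sqrt (‖lU k‖ ^ 2 + ‖dU k‖ ^ 2) + (‖cH k‖ + ‖dH k‖) := by
  rw [normE]
  refine congrArg₂ _ (congrArg₂ _ ?_ ?_) ?_
  · exact normV_of_isPrimitive (isPrimitive_ζ k)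
  · change normH1 (cU k) = _
    rw [normH1, lpNorm_congr_ae (lU_ae k).symm, lpNorm_congr_ae (isPrimitive_U k).weakDeriv_ae,
      L2.norm_eq, L2.norm_eq]
  · exact normV_of_isPrimitive (isPrimitive_H k)

theorem normE_toTriple_le (k : Lag) : normE (toTriple k) ≤ 6 * ‖k‖ := by
  obtain ⟨h1, h2, h3, h4, h5, h6, h7⟩ := norm_comp_le k
  rw [normE_toTriple]
  have : Real.sqrt (‖lU k‖ ^ 2 + ‖dU k‖ ^ 2) ≤ ‖lU k‖ + ‖dU k‖ := by
    rw [Real.sqrt_le_left (by positivity)]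
    nlinarith [norm_nonneg (lU k), norm_nonneg (dU k)]
  linarith

/-- Cauchy–Schwarz against the indicator of an interval of length one, whose L² norm is one. -/
theorem integral_abs_le_norm (f : L2) (x : ℝ) :
    ∫ t in x..x + 1, |(f : ℝ → ℝ) t| ≤ ‖f‖ := by
  have h0 : MemLp (fun t => |(f : ℝ → ℝ) t|) 2 := (Lp.memLp f).abs
  have h1 : ∫ t in Ioc x (x + 1), |(f : ℝ → ℝ) t| = inner ℝ (indicatorConstLp 2
      (measurableSet_Ioc (a := x) (b := x + 1)) (measure_Ioc_lt_top).ne (1 : ℝ)) (h0.toLp _) := by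
    rw [L2.inner_indicatorConstLp_one]
    exact integral_congr_ae (ae_restrict_of_ae h0.coeFn_toLp.symm)
  rw [intervalIntegral.integral_of_le (by linarith), h1]
  refine (real_inner_le_norm _ _).trans ?_
  rw [norm_indicatorConstLp (by simp) (by simp), norm_toLp_eq_lpNorm,
    lpNorm_fun_abs (Lp.aestronglyMeasurable f), ← L2.norm_eq]
  simp [Measure.real]

/-- Sobolev embedding in dimension one: on the unit interval to the right of x, f differs from f(x)
by at most the L¹ norm of its derivative there. Averaging |f| over that interval gives the claim. -/
theorem abs_le_of_isPrimitive {f : ℝ → ℝ} {u w : L2} (hu : (u : ℝ → ℝ) =ᵐ[volume] f)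
    (hf : IsPrimitive f w) (x : ℝ) : |f x| ≤ ‖u‖ + ‖w‖ := by
  have hle : x ≤ x + 1 := by linarith
  have h1 : ∀ y ∈ Icc x (x + 1), |f x| ≤ |f y| + ‖w‖ := fun y hy => by
    have h2 := hf.eq_add x y
    have h3 : |∫ t in x..y, (w : ℝ → ℝ) t| ≤ ‖w‖ := by
      refine (intervalIntegral.abs_integral_le_integral_abs hy.1).trans
        (le_trans ?_ (integral_abs_le_norm w x))
      have hi : IntegrableOn (fun t => |(w : ℝ → ℝ) t|) (Ioc x (x + 1)) :=
        ((intervalIntegrable_iff_integrableOn_Ioc_of_le hle).1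
          (hf.intervalIntegrable x (x + 1))).abs
      rw [intervalIntegral.integral_of_le hy.1, intervalIntegral.integral_of_le hle]
      exact setIntegral_mono_set hi (ae_of_all _ fun _ => abs_nonneg _)
        (Ioc_subset_Ioc_right hy.2).eventuallyLE
    have h4 : f x = f y - ∫ t in x..y, (w : ℝ → ℝ) t := by linarith
    rw [h4]
    exact (abs_sub _ _).trans (by linarith)
  have h2 : ∫ t in x..x + 1, |f x| ≤ ∫ t in x..x + 1, (|f t| + ‖w‖) :=
    intervalIntegral.integral_mono_on hle (by simp)
      ((hf.continuous.abs.add continuous_const).intervalIntegrable _ _) h1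
  have h3 : ∫ t in x..x + 1, (|f t| + ‖w‖) = (∫ t in x..x + 1, |f t|) + ‖w‖ := by
    rw [intervalIntegral.integral_add (hf.continuous.abs.intervalIntegrable _ _) (by simp)]
    simp
  have h4 : ∫ t in x..x + 1, |f t| = ∫ t in x..x + 1, |(u : ℝ → ℝ) t| :=
    intervalIntegral.integral_congr_ae (hu.mono fun t ht _ => by simp only [ht])
  rw [h3, h4] at h2
  have h5 := integral_abs_le_norm u x
  simp only [intervalIntegral.integral_const, add_sub_cancel_left, one_smul] at h2
  linarith

/-- The norm of E does not contain the sup norm of U, which is recovered from the Sobolev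
inequality. With `normE_toTriple_le` the two norms are equivalent. -/
theorem Lag.norm_le_normE (k : Lag) : ‖k‖ ≤ 2 * normE (toTriple k) := by
  have hU : ‖cU k‖ ≤ ‖lU k‖ + ‖dU k‖ := (BoundedContinuousFunction.norm_le (by positivity)).2
    fun x => abs_le_of_isPrimitive (lU_ae k) (isPrimitive_U k) x
  have h1 : ‖lU k‖ ≤ Real.sqrt (‖lU k‖ ^ 2 + ‖dU k‖ ^ 2) := Real.le_sqrt_of_sq_le (by
    nlinarith [sq_nonneg ‖dU k‖])
  have h2 : ‖dU k‖ ≤ Real.sqrt (‖lU k‖ ^ 2 + ‖dU k‖ ^ 2) := Real.le_sqrt_of_sq_le (by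
    nlinarith [sq_nonneg ‖lU k‖])
  have := norm_nonneg (cζ k)
  have := norm_nonneg (dζ k)
  have := norm_nonneg (cH k)
  have := norm_nonneg (dH k)
  have := norm_nonneg (lU k)
  have := norm_nonneg (dU k)
  rw [Lag.norm_le_iff, normE_toTriple]
  refine ⟨?_, ?_, ?_, ?_, ?_, ?_, ?_⟩ <;> linarith

/-! ### From triples to the Banach space -/

/-- A bounded continuous function from a continuous function in `L^∞`. -/
def bfOf (f : ℝ → ℝ) (hf : Continuous f) (h : MemLp f ∞) : BF :=
  BoundedContinuousFunction.ofNormedAddCommGroup f hf _ (Continuous.abs_le_lpNorm hf h)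

theorem MemV.isPrimitive {f : ℝ → ℝ} (h : MemV f) : IsPrimitive f (weakDeriv f) := by
  obtain ⟨g, hg, -⟩ := h.2.2
  exact (hg.isPrimitive h.1).isPrimitive_weakDeriv

theorem MemH1.isPrimitive {f : ℝ → ℝ} (h : MemH1 f) : IsPrimitive f (weakDeriv f) := by
  obtain ⟨g, hg, -⟩ := h.2.2
  exact (hg.isPrimitive h.1).isPrimitive_weakDeriv

theorem WeakDerivMemLp.memLp_weakDeriv {f : ℝ → ℝ} {p : ℝ≥0∞} (hf : Continuous f)
    (h : WeakDerivMemLp f p) : MemLp (weakDeriv f) p := by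
  obtain ⟨g, hg, hg2⟩ := h
  exact (memLp_congr_ae (hg.isPrimitive hf).weakDeriv_ae).2 hg2

theorem MemV.memLp_weakDeriv {f : ℝ → ℝ} (h : MemV f) : MemLp (weakDeriv f) 2 :=
  h.2.2.memLp_weakDeriv h.1

theorem MemH1.memLp_weakDeriv {f : ℝ → ℝ} (h : MemH1 f) : MemLp (weakDeriv f) 2 :=
  h.2.2.memLp_weakDeriv h.1

theorem MemH1.memLp_top {f : ℝ → ℝ} (h : MemH1 f) : MemLp f ∞ := by
  refine memLp_top_of_abs_le h.2.1.1 (C := ‖h.2.1.toLp f‖ + ‖h.memLp_weakDeriv.toLp _‖)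
    (ae_of_all _ fun x => ?_)
  exact abs_le_of_isPrimitive h.2.1.coeFn_toLp
    (h.isPrimitive.congr h.memLp_weakDeriv.coeFn_toLp.symm) x

/-- The element of the Banach space given by a triple in `E`. -/
def ofTriple (X : Triple) (h : MemE X) : Lag :=
  Lag.mk (bfOf X.ζ h.1.1 h.1.2.1) (bfOf X.U h.2.1.1 h.2.1.memLp_top)
    (bfOf X.H h.2.2.1 h.2.2.2.1)
    (h.1.memLp_weakDeriv.toLp _) (h.2.1.2.1.toLp _) (h.2.1.memLp_weakDeriv.toLp _)
    (h.2.2.memLp_weakDeriv.toLp _) (h.1.isPrimitive.congr (MemLp.coeFn_toLp _).symm)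
    (MemLp.coeFn_toLp _) (h.2.1.isPrimitive.congr (MemLp.coeFn_toLp _).symm)
    (h.2.2.isPrimitive.congr (MemLp.coeFn_toLp _).symm)

theorem toTriple_ofTriple (X : Triple) (h : MemE X) : toTriple (ofTriple X h) = X := rfl

theorem IsPrimitive.ae_unique {f g g' : ℝ → ℝ} (h : IsPrimitive f g) (h' : IsPrimitive f g') :
    g =ᵐ[volume] g' := h.deriv_ae.symm.trans h'.deriv_ae

theorem toTriple_sub (k l : Lag) : toTriple (k - l) = toTriple k - toTriple l := by
  rfl

theorem toTriple_smul (c : ℝ) (k : Lag) : toTriple (c • k) = c • toTriple k := by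
  rfl

/-- The L² components are determined a.e. by the continuous ones, either as derivatives or as the
same function. Identities in `Lag` can therefore be checked on three continuous functions. -/
theorem toTriple_injective : Function.Injective toTriple := fun k l h => by
  have h1 : toTriple (k - l) = (0 : Triple) := by rw [toTriple_sub, h, sub_self]
  have hp : ∀ (b : BF) (f : L2), IsPrimitive b f → (b : ℝ → ℝ) = 0 → f = 0 := fun b f hbf hb => by
    refine Lp.ext ?_
    have h2 : IsPrimitive (fun _ => (0 : ℝ)) f := by
      have := hbf
      rw [hb] at this
      exact this
    exact (h2.ae_unique (IsPrimitive.const 0)).trans (Lp.coeFn_zero ℝ 2 volume).symm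
  have hb : ∀ b : BF, (b : ℝ → ℝ) = 0 → b = 0 := fun b hb => BoundedContinuousFunction.ext
    fun x => congrFun hb x
  have e1 : (cζ (k - l) : ℝ → ℝ) = 0 := congrArg Prod.fst h1
  have e2 : (cU (k - l) : ℝ → ℝ) = 0 := congrArg (fun X : Triple => X.2.1) h1
  have e3 : (cH (k - l) : ℝ → ℝ) = 0 := congrArg (fun X : Triple => X.2.2) h1
  have e4 : lU (k - l) = 0 := Lp.ext ((lU_ae (k - l)).trans (by
    rw [e2]
    exact (Lp.coeFn_zero ℝ 2 volume).symm))
  have : ‖k - l‖ ≤ 0 := by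
    rw [Lag.norm_le_iff, hb _ e1, hb _ e2, hb _ e3, hp _ _ (isPrimitive_ζ _) e1, e4,
      hp _ _ (isPrimitive_U _) e2, hp _ _ (isPrimitive_H _) e3]
    simp
  exact sub_eq_zero.1 (norm_le_zero_iff.1 this)

theorem normV_nonneg (f : ℝ → ℝ) : 0 ≤ normV f := add_nonneg lpNorm_nonneg lpNorm_nonneg

theorem normE_nonneg (X : Triple) : 0 ≤ normE X :=
  add_nonneg (add_nonneg (normV_nonneg _) (Real.sqrt_nonneg _)) (normV_nonneg _)

/-! ## The exponential kernel -/

theorem integral_mul_sq_le {a b : ℝ → ℝ} (ha : MemLp a 2) (hb : MemLp b 2) :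
    (∫ x, a x * b x) ^ 2 ≤ (∫ x, a x ^ 2) * ∫ x, b x ^ 2 := by
  have key : ∀ {f g : ℝ → ℝ} (hf : MemLp f 2) (hg : MemLp g 2),
      inner ℝ (hg.toLp g) (hf.toLp f) = ∫ x, f x * g x := fun {f g} hf hg => by
    rw [L2.inner_def]
    refine integral_congr_ae ?_
    filter_upwards [hf.coeFn_toLp, hg.coeFn_toLp] with x h1 h2
    rw [h1, h2]
    rfl
  have h := real_inner_mul_inner_self_le (hb.toLp b) (ha.toLp a)
  rw [key ha hb, key hb hb, key ha ha] at h
  simp only [sq]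
  linarith

theorem lpNorm_two_sq {f : ℝ → ℝ} (hf : AEStronglyMeasurable f) :
    lpNorm f 2 volume ^ 2 = ∫ x, f x ^ 2 := by
  rw [lpNorm_eq_integral_norm_rpow_toReal two_ne_zero ENNReal.ofNat_ne_top hf]
  have h0 : 0 ≤ ∫ x, ‖f x‖ ^ (2 : ℝ≥0∞).toReal := integral_nonneg fun x => by positivity
  rw [← Real.rpow_natCast, ← Real.rpow_mul h0]
  simp

theorem integrable_exp_neg_abs : Integrable fun x : ℝ => Real.exp (-|x|) := by
  rw [← integrableOn_univ, ← Iic_union_Ioi (a := (0 : ℝ))]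
  refine IntegrableOn.union ?_ ?_
  · refine (integrableOn_exp_Iic 0).congr_fun (fun x hx => ?_) measurableSet_Iic
    rw [abs_of_nonpos hx, neg_neg]
  · refine (integrableOn_exp_neg_Ioi 0).congr_fun (fun x hx => ?_) measurableSet_Ioi
    simp only [abs_of_pos (mem_Ioi.1 hx)]

theorem integral_exp_neg_abs : ∫ x : ℝ, Real.exp (-|x|) = 2 := by
  rw [integral_comp_abs (f := fun x => Real.exp (-x)), integral_exp_neg_Ioi_zero, mul_one]

theorem memLp_exp_half (ξ : ℝ) : MemLp (fun η : ℝ => Real.exp (-|ξ - η| / 2)) 2 := by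
  rw [memLp_two_iff_integrable_sq (by fun_prop)]
  refine (integrable_exp_neg_abs.comp_sub_left ξ).congr (ae_of_all _ fun η => ?_)
  simp only [← Real.exp_nat_mul]
  congr 1
  push_cast
  ring

theorem memLp_exp_half_mul {g : ℝ → ℝ} (hg : MemLp g 2) (ξ : ℝ) :
    MemLp (fun η : ℝ => Real.exp (-|ξ - η| / 2) * |g η|) 2 :=
  memLp_two_bounded_mul (by fun_prop) (C := 1) (ae_of_all _ fun η => by
    rw [abs_of_pos (Real.exp_pos _), Real.exp_le_one_iff]
    linarith [abs_nonneg (ξ - η)]) hg.abs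

/-- The average of `|g|` against the kernel `exp (-|ξ - η|)`. -/
def expAvg (g : ℝ → ℝ) (ξ : ℝ) : ℝ := ∫ η, Real.exp (-|ξ - η|) * |g η|

theorem integrable_exp_mul_abs {g : ℝ → ℝ} (hg : MemLp g 2) (ξ : ℝ) :
    Integrable fun η => Real.exp (-|ξ - η|) * |g η| := by
  refine ((memLp_exp_half ξ).integrable_mul (memLp_exp_half_mul hg ξ)).congr
    (ae_of_all _ fun η => ?_)
  simp only [Pi.mul_apply]
  rw [← mul_assoc, ← Real.exp_add]
  congr 2
  ring

theorem expAvg_nonneg (g : ℝ → ℝ) (ξ : ℝ) : 0 ≤ expAvg g ξ :=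
  integral_nonneg fun _ => by positivity

/-- Cauchy–Schwarz after writing the kernel as the product of its two square roots; the factor 2 is
the integral of e^{-|x|}. -/
theorem expAvg_sq_le {g : ℝ → ℝ} (hg : MemLp g 2) (ξ : ℝ) :
    expAvg g ξ ^ 2 ≤ 2 * ∫ η, Real.exp (-|ξ - η|) * g η ^ 2 := by
  have h := integral_mul_sq_le (memLp_exp_half ξ) (memLp_exp_half_mul hg ξ)
  have e1 : ∀ η : ℝ, Real.exp (-|ξ - η| / 2) * Real.exp (-|ξ - η| / 2) = Real.exp (-|ξ - η|) :=
    fun η => by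
      rw [← Real.exp_add]
      congr 1
      ring
  simp only [mul_pow, sq_abs, ← mul_assoc, sq (Real.exp _), e1] at h
  rw [integral_sub_left_eq_self (fun x : ℝ => Real.exp (-|x|)) volume ξ,
    integral_exp_neg_abs] at h
  exact h

theorem integrable_expAvg_sq {g : ℝ → ℝ} (hg : MemLp g 2) :
    Integrable (fun ξ => ∫ η, Real.exp (-|ξ - η|) * g η ^ 2) ∧
      ∫ ξ, ∫ η, Real.exp (-|ξ - η|) * g η ^ 2 = 2 * ∫ η, g η ^ 2 := by
  have hsq := (memLp_two_iff_integrable_sq hg.1).1 hg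
  have e : (fun ξ => ∫ η, Real.exp (-|ξ - η|) * g η ^ 2) =
      convolution (fun η => g η ^ 2) (fun x => Real.exp (-|x|)) (ContinuousLinearMap.mul ℝ ℝ)
        volume := by
    funext ξ
    rw [convolution_def]
    exact integral_congr_ae (ae_of_all _ fun η => mul_comm _ _)
  rw [e]
  refine ⟨hsq.integrable_convolution _ integrable_exp_neg_abs, ?_⟩
  rw [integral_convolution _ hsq integrable_exp_neg_abs, integral_exp_neg_abs]
  exact mul_comm _ _

theorem expAvg_le {g : ℝ → ℝ} (hg : MemLp g 2) (ξ : ℝ) :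
    expAvg g ξ ≤ 2 * lpNorm g 2 volume := by
  have hsq := (memLp_two_iff_integrable_sq hg.1).1 hg
  have h1 : ∫ η, Real.exp (-|ξ - η|) * g η ^ 2 ≤ ∫ η, g η ^ 2 := by
    refine integral_mono_of_nonneg (ae_of_all _ fun η => by positivity) hsq
      (ae_of_all _ fun η => ?_)
    exact mul_le_of_le_one_left (sq_nonneg _)
      (Real.exp_le_one_iff.2 (neg_nonpos.2 (abs_nonneg _)))
  rw [← lpNorm_two_sq hg.1] at h1
  have h2 := expAvg_sq_le hg ξ
  refine abs_le_of_sq_le_sq' ?_ (mul_nonneg two_pos.le lpNorm_nonneg) |>.2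
  nlinarith [sq_nonneg (lpNorm g 2 volume)]

/-- An L² form of Young's inequality: squaring costs a factor 2 by `expAvg_sq_le`, integrating the
remaining kernel costs another 2, so the squared norm gains 4C². -/
theorem memLp_of_le_expAvg {F g : ℝ → ℝ} {C : ℝ} (hF : AEStronglyMeasurable F) (hg : MemLp g 2)
    (h : ∀ ξ, |F ξ| ≤ C * expAvg g ξ) :
    MemLp F 2 ∧ lpNorm F 2 volume ≤ 2 * |C| * lpNorm g 2 volume := by
  obtain ⟨hi, he⟩ := integrable_expAvg_sq hg
  have hb : ∀ ξ, F ξ ^ 2 ≤ C ^ 2 * (2 * ∫ η, Real.exp (-|ξ - η|) * g η ^ 2) := fun ξ => by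
    rw [← sq_abs]
    calc |F ξ| ^ 2 ≤ (C * expAvg g ξ) ^ 2 := pow_le_pow_left₀ (abs_nonneg _) (h ξ) 2
      _ = C ^ 2 * expAvg g ξ ^ 2 := mul_pow _ _ _
      _ ≤ _ := by gcongr; exact expAvg_sq_le hg ξ
  have hi2 : Integrable fun ξ => C ^ 2 * (2 * ∫ η, Real.exp (-|ξ - η|) * g η ^ 2) :=
    (hi.const_mul 2).const_mul _
  have hFs : Integrable fun ξ => F ξ ^ 2 := hi2.mono' (hF.pow 2) (ae_of_all _ fun ξ => by
    rw [Real.norm_of_nonneg (sq_nonneg _)]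
    exact hb ξ)
  refine ⟨(memLp_two_iff_integrable_sq hF).2 hFs, ?_⟩
  refine abs_le_of_sq_le_sq' ?_ (mul_nonneg (by positivity) lpNorm_nonneg) |>.2
  rw [lpNorm_two_sq hF]
  refine (integral_mono hFs hi2 hb).trans (le_of_eq ?_)
  rw [integral_const_mul, integral_const_mul, he, ← lpNorm_two_sq hg.1, mul_pow, mul_pow, sq_abs]
  ring

/-! ### One-sided kernels -/

/-- `∫_{η < ξ} exp (-(y ξ - y η)) g η dη` -/
def kerL (y g : ℝ → ℝ) (ξ : ℝ) : ℝ := ∫ η in Iic ξ, Real.exp (y η - y ξ) * g η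

/-- `∫_{η > ξ} exp (-(y η - y ξ)) g η dη` -/
def kerR (y g : ℝ → ℝ) (ξ : ℝ) : ℝ := ∫ η in Ioi ξ, Real.exp (y ξ - y η) * g η

section Kernel

variable {y y₁ y₂ g g₁ g₂ v : ℝ → ℝ} {A δ : ℝ}

/-- As y stays within A of the identity, the kernel built from y is comparable to e^{-|ξ-η|}.
Monotonicity of y is not needed, so the field can be estimated on the whole Banach space. -/
theorem exp_le_of_le (hA : ∀ x, |y x - x| ≤ A) {ξ η : ℝ} (h : η ≤ ξ) :
    Real.exp (y η - y ξ) ≤ Real.exp (2 * A) * Real.exp (-|ξ - η|) := by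
  rw [← Real.exp_add, Real.exp_le_exp, abs_of_nonneg (sub_nonneg.2 h)]
  linarith [abs_le.1 (hA ξ), abs_le.1 (hA η), (abs_le.1 (hA ξ)).1, (abs_le.1 (hA η)).2]

theorem abs_exp_sub_exp_le {a b c : ℝ} (ha : Real.exp a ≤ c) (hb : Real.exp b ≤ c) :
    |Real.exp a - Real.exp b| ≤ c * |a - b| := by
  wlog hab : b ≤ a generalizing a b
  · rw [abs_sub_comm, abs_sub_comm a]
    exact this hb ha (le_of_not_ge hab)
  rw [abs_of_nonneg (sub_nonneg.2 (Real.exp_le_exp.2 hab)), abs_of_nonneg (sub_nonneg.2 hab)]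
  have h1 : Real.exp a * (b - a + 1) ≤ Real.exp b := by
    have := mul_le_mul_of_nonneg_left (Real.add_one_le_exp (b - a)) (Real.exp_pos a).le
    rwa [← Real.exp_add, add_sub_cancel] at this
  nlinarith

theorem ae_kernel_bound {s : Set ℝ} {k : ℝ → ℝ} {ξ C : ℝ} (hs : MeasurableSet s)
    (hk : AEStronglyMeasurable k) (hg : MemLp g 2) (hC : 0 ≤ C)
    (h : ∀ η ∈ s, |k η| ≤ C * (Real.exp (-|ξ - η|) * |g η|)) :
    IntegrableOn k s ∧ |∫ η in s, k η| ≤ C * expAvg g ξ := by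
  have hi := (integrable_exp_mul_abs hg ξ).const_mul C
  have hb : ∀ᵐ η ∂(volume.restrict s), ‖k η‖ ≤ C * (Real.exp (-|ξ - η|) * |g η|) :=
    (ae_restrict_iff' hs).2 (ae_of_all _ h)
  have hki : IntegrableOn k s := hi.integrableOn.mono' hk.restrict hb
  refine ⟨hki, (norm_integral_le_of_norm_le hi.integrableOn hb).trans ?_⟩
  rw [expAvg, ← integral_const_mul]
  exact setIntegral_le_integral hi (ae_of_all _ fun η => by positivity)

theorem kerL_bound (hy : Continuous y) (hA : ∀ x, |y x - x| ≤ A) (hg : MemLp g 2) (ξ : ℝ) :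
    IntegrableOn (fun η => Real.exp (y η - y ξ) * g η) (Iic ξ) ∧
      |kerL y g ξ| ≤ Real.exp (2 * A) * expAvg g ξ := by
  refine ae_kernel_bound measurableSet_Iic
    ((by fun_prop : Continuous fun η => Real.exp (y η - y ξ)).aestronglyMeasurable.mul hg.1) hg
    (Real.exp_pos _).le fun η hη => ?_
  rw [abs_mul, abs_of_pos (Real.exp_pos _), ← mul_assoc]
  gcongr
  exact exp_le_of_le hA hη

theorem kerR_bound (hy : Continuous y) (hA : ∀ x, |y x - x| ≤ A) (hg : MemLp g 2) (ξ : ℝ) :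
    IntegrableOn (fun η => Real.exp (y ξ - y η) * g η) (Ioi ξ) ∧
      |kerR y g ξ| ≤ Real.exp (2 * A) * expAvg g ξ := by
  refine ae_kernel_bound measurableSet_Ioi
    ((by fun_prop : Continuous fun η => Real.exp (y ξ - y η)).aestronglyMeasurable.mul hg.1) hg
    (Real.exp_pos _).le fun η hη => ?_
  rw [abs_mul, abs_of_pos (Real.exp_pos _), ← mul_assoc]
  gcongr
  rw [abs_sub_comm]
  exact exp_le_of_le hA (mem_Ioi.1 hη).le

/-- First the source is changed with the kernel of `y₁`, then the kernel is changed with the source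
`g₂`. The exponents differ by at most 2δ, and both exponentials lie below the same multiple of
e^{-|ξ-η|}. -/
theorem kerL_sub_bound (hy₁ : Continuous y₁) (hy₂ : Continuous y₂) (hA₁ : ∀ x, |y₁ x - x| ≤ A)
    (hA₂ : ∀ x, |y₂ x - x| ≤ A) (hδ : ∀ x, |y₁ x - y₂ x| ≤ δ) (hg₁ : MemLp g₁ 2)
    (hg₂ : MemLp g₂ 2) (ξ : ℝ) :
    |kerL y₁ g₁ ξ - kerL y₂ g₂ ξ| ≤ Real.exp (2 * A) * expAvg (fun x => g₁ x - g₂ x) ξ +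
      2 * δ * Real.exp (2 * A) * expAvg g₂ ξ := by
  have hδ0 : 0 ≤ δ := (abs_nonneg _).trans (hδ 0)
  obtain ⟨i1, b1⟩ := kerL_bound hy₁ hA₁ (hg₁.sub hg₂) ξ
  obtain ⟨i2, b2⟩ := ae_kernel_bound (s := Iic ξ) (ξ := ξ) (C := 2 * δ * Real.exp (2 * A))
    (k := fun η => (Real.exp (y₁ η - y₁ ξ) - Real.exp (y₂ η - y₂ ξ)) * g₂ η)
    measurableSet_Iic ((by fun_prop : Continuous fun η => Real.exp (y₁ η - y₁ ξ) -
      Real.exp (y₂ η - y₂ ξ)).aestronglyMeasurable.mul hg₂.1) hg₂ (by positivity) fun η hη => by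
    rw [abs_mul, ← mul_assoc]
    gcongr
    refine (abs_exp_sub_exp_le (exp_le_of_le hA₁ hη) (exp_le_of_le hA₂ hη)).trans ?_
    rw [mul_comm, mul_assoc]
    gcongr
    rw [show y₁ η - y₁ ξ - (y₂ η - y₂ ξ) = (y₁ η - y₂ η) - (y₁ ξ - y₂ ξ) by ring]
    exact (abs_sub _ _).trans (by linarith [hδ η, hδ ξ])
  have e : kerL y₁ g₁ ξ - kerL y₂ g₂ ξ = kerL y₁ (fun x => g₁ x - g₂ x) ξ +
      ∫ η in Iic ξ, (Real.exp (y₁ η - y₁ ξ) - Real.exp (y₂ η - y₂ ξ)) * g₂ η := by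
    rw [kerL, kerL, kerL, ← integral_sub (kerL_bound hy₁ hA₁ hg₁ ξ).1
      (kerL_bound hy₂ hA₂ hg₂ ξ).1]
    refine Eq.trans (integral_congr_ae (ae_of_all _ fun η => ?_)) (integral_add i1 i2)
    simp only
    ring
  rw [e]
  exact (abs_add_le _ _).trans (add_le_add b1 b2)

theorem kerR_sub_bound (hy₁ : Continuous y₁) (hy₂ : Continuous y₂) (hA₁ : ∀ x, |y₁ x - x| ≤ A)
    (hA₂ : ∀ x, |y₂ x - x| ≤ A) (hδ : ∀ x, |y₁ x - y₂ x| ≤ δ) (hg₁ : MemLp g₁ 2)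
    (hg₂ : MemLp g₂ 2) (ξ : ℝ) :
    |kerR y₁ g₁ ξ - kerR y₂ g₂ ξ| ≤ Real.exp (2 * A) * expAvg (fun x => g₁ x - g₂ x) ξ +
      2 * δ * Real.exp (2 * A) * expAvg g₂ ξ := by
  have hδ0 : 0 ≤ δ := (abs_nonneg _).trans (hδ 0)
  obtain ⟨i1, b1⟩ := kerR_bound hy₁ hA₁ (hg₁.sub hg₂) ξ
  obtain ⟨i2, b2⟩ := ae_kernel_bound (s := Ioi ξ) (ξ := ξ) (C := 2 * δ * Real.exp (2 * A))
    (k := fun η => (Real.exp (y₁ ξ - y₁ η) - Real.exp (y₂ ξ - y₂ η)) * g₂ η)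
    measurableSet_Ioi ((by fun_prop : Continuous fun η => Real.exp (y₁ ξ - y₁ η) -
      Real.exp (y₂ ξ - y₂ η)).aestronglyMeasurable.mul hg₂.1) hg₂ (by positivity) fun η hη => by
    rw [abs_mul, ← mul_assoc]
    gcongr
    rw [abs_sub_comm ξ η]
    refine (abs_exp_sub_exp_le (exp_le_of_le hA₁ (mem_Ioi.1 hη).le)
      (exp_le_of_le hA₂ (mem_Ioi.1 hη).le)).trans ?_
    rw [mul_comm, mul_assoc]
    gcongr
    rw [show y₁ ξ - y₁ η - (y₂ ξ - y₂ η) = (y₁ ξ - y₂ ξ) - (y₁ η - y₂ η) by ring]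
    exact (abs_sub _ _).trans (by linarith [hδ η, hδ ξ])
  have e : kerR y₁ g₁ ξ - kerR y₂ g₂ ξ = kerR y₁ (fun x => g₁ x - g₂ x) ξ +
      ∫ η in Ioi ξ, (Real.exp (y₁ ξ - y₁ η) - Real.exp (y₂ ξ - y₂ η)) * g₂ η := by
    rw [kerR, kerR, kerR, ← integral_sub (kerR_bound hy₁ hA₁ hg₁ ξ).1
      (kerR_bound hy₂ hA₂ hg₂ ξ).1]
    refine Eq.trans (integral_congr_ae (ae_of_all _ fun η => ?_)) (integral_add i1 i2)
    simp only
    ring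
  rw [e]
  exact (abs_add_le _ _).trans (add_le_add b1 b2)

/-- Factoring e^{-y(ξ)} out of the integral leaves a function integrated up to ξ that no longer
depends on ξ, so the product rule applies. -/
theorem isPrimitive_kerL (hy : IsPrimitive y v) (hA : ∀ x, |y x - x| ≤ A) (hg : MemLp g 2) :
    IsPrimitive (kerL y g) (fun ξ => g ξ - v ξ * kerL y g ξ) := by
  have hloc : LocallyIntegrable fun η => Real.exp (y η) * g η :=
    (hg.locallyIntegrable one_le_two).continuous_mul (Real.continuous_exp.comp hy.continuous)
  have hmul : ∀ ξ η, Real.exp (y η) * g η = Real.exp (y ξ) * (Real.exp (y η - y ξ) * g η) :=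
    fun ξ η => by
      rw [← mul_assoc, ← Real.exp_add]
      congr 2
      ring
  have hint : ∀ ξ, IntegrableOn (fun η => Real.exp (y η) * g η) (Iic ξ) := fun ξ =>
    ((kerL_bound hy.continuous hA hg ξ).1.const_mul (Real.exp (y ξ))).congr
      (ae_of_all _ fun η => (hmul ξ η).symm)
  have h1 : IsPrimitive (fun ξ => ∫ η in Iic ξ, Real.exp (y η) * g η)
      (fun η => Real.exp (y η) * g η) :=
    ⟨hloc, fun a b => (intervalIntegral.integral_Iic_sub_Iic (hint a) (hint b)).symm⟩
  have e : kerL y g = fun ξ => Real.exp (-y ξ) * ∫ η in Iic ξ, Real.exp (y η) * g η := by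
    funext ξ
    rw [kerL, ← integral_const_mul]
    refine integral_congr_ae (ae_of_all _ fun η => ?_)
    simp only
    rw [← mul_assoc, ← Real.exp_add]
    congr 2
    ring
  rw [e]
  refine (hy.neg.exp.mul h1).congr (ae_of_all _ fun ξ => ?_)
  simp only
  rw [← mul_assoc (Real.exp (-y ξ)), ← Real.exp_add, neg_add_cancel, Real.exp_zero]
  ring

theorem isPrimitive_kerR (hy : IsPrimitive y v) (hA : ∀ x, |y x - x| ≤ A) (hg : MemLp g 2) :
    IsPrimitive (kerR y g) (fun ξ => -g ξ + v ξ * kerR y g ξ) := by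
  have hloc : LocallyIntegrable fun η => Real.exp (-y η) * g η :=
    (hg.locallyIntegrable one_le_two).continuous_mul
      (Real.continuous_exp.comp hy.continuous.neg)
  have hmul : ∀ ξ η, Real.exp (-y η) * g η = Real.exp (-y ξ) * (Real.exp (y ξ - y η) * g η) :=
    fun ξ η => by
      rw [← mul_assoc, ← Real.exp_add]
      congr 2
      ring
  have hint : ∀ ξ, IntegrableOn (fun η => Real.exp (-y η) * g η) (Ioi ξ) := fun ξ =>
    ((kerR_bound hy.continuous hA hg ξ).1.const_mul (Real.exp (-y ξ))).congr
      (ae_of_all _ fun η => (hmul ξ η).symm)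
  have h1 : IsPrimitive (fun ξ => ∫ η in Ioi ξ, Real.exp (-y η) * g η)
      (fun η => -(Real.exp (-y η) * g η)) :=
    ⟨hloc.neg, fun a b => by
      rw [intervalIntegral.integral_neg, ← intervalIntegral.integral_Ioi_sub_Ioi' (hint a) (hint b)]
      ring⟩
  have e : kerR y g = fun ξ => Real.exp (y ξ) * ∫ η in Ioi ξ, Real.exp (-y η) * g η := by
    funext ξ
    rw [kerR, ← integral_const_mul]
    refine integral_congr_ae (ae_of_all _ fun η => ?_)
    simp only
    rw [← mul_assoc, ← Real.exp_add]
    congr 2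
  rw [e]
  refine (hy.exp.mul h1).congr (ae_of_all _ fun ξ => ?_)
  simp only
  rw [mul_neg, ← mul_assoc (Real.exp (y ξ)) (Real.exp (-y ξ)), ← Real.exp_add, add_neg_cancel,
    Real.exp_zero]
  ring

end Kernel

/-! ## The vector field on the Banach space -/

/-- The characteristic `y = ζ + id` of an element of the space. -/
def yk (k : Lag) (ξ : ℝ) : ℝ := cζ k ξ + ξ

theorem isPrimitive_yk (k : Lag) : IsPrimitive (yk k) (fun ξ => dζ k ξ + 1) :=
  (isPrimitive_ζ k).add IsPrimitive.id

theorem abs_yk_sub_le (k : Lag) {A : ℝ} (hA : ‖cζ k‖ ≤ A) (x : ℝ) : |yk k x - x| ≤ A := by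
  rw [yk, add_sub_cancel_right]
  exact ((cζ k).abs_le x).trans hA

/-- The source `U² y_ξ + H_ξ`. -/
def src (k : Lag) : L2 := cU k • lU k + (cU k * cU k) • dζ k + dH k

theorem coeFn_src (k : Lag) :
    (src k : ℝ → ℝ) =ᵐ[volume] fun ξ => cU k ξ ^ 2 * (dζ k ξ + 1) + dH k ξ := by
  filter_upwards [Lp.coeFn_add (cU k • lU k + (cU k * cU k) • dζ k) (dH k),
    Lp.coeFn_add (cU k • lU k) ((cU k * cU k) • dζ k), coeFn_bsmul (cU k) (lU k),
    coeFn_bsmul (cU k * cU k) (dζ k), lU_ae k] with ξ h1 h2 h3 h4 h5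
  rw [src, h1, Pi.add_apply, h2, Pi.add_apply, h3, h4, h5, BoundedContinuousFunction.mul_apply]
  ring

/-- `P` -/
def pF (k : Lag) (ξ : ℝ) : ℝ := 1 / 4 * (kerL (yk k) (src k) ξ + kerR (yk k) (src k) ξ)

/-- `Q` -/
def qF (k : Lag) (ξ : ℝ) : ℝ := -(1 / 4) * (kerL (yk k) (src k) ξ - kerR (yk k) (src k) ξ)

/-- The boundary terms at η = ξ of the two one-sided kernels have opposite signs: they cancel in the
sum, giving P_ξ = y_ξ Q, and add up in the difference, giving the source term in Q_ξ. -/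
theorem isPrimitive_pF (k : Lag) : IsPrimitive (pF k) (fun ξ => (dζ k ξ + 1) * qF k ξ) := by
  have h1 := isPrimitive_kerL (isPrimitive_yk k) (abs_yk_sub_le k le_rfl) (Lp.memLp (src k))
  have h2 := isPrimitive_kerR (isPrimitive_yk k) (abs_yk_sub_le k le_rfl) (Lp.memLp (src k))
  refine ((h1.add h2).const_mul (1 / 4)).congr (ae_of_all _ fun ξ => ?_)
  simp only [qF]
  ring

theorem isPrimitive_qF (k : Lag) :
    IsPrimitive (qF k) (fun ξ => -(1 / 2) * src k ξ + (dζ k ξ + 1) * pF k ξ) := by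
  have h1 := isPrimitive_kerL (isPrimitive_yk k) (abs_yk_sub_le k le_rfl) (Lp.memLp (src k))
  have h2 := isPrimitive_kerR (isPrimitive_yk k) (abs_yk_sub_le k le_rfl) (Lp.memLp (src k))
  refine ((h1.sub h2).const_mul (-(1 / 4))).congr (ae_of_all _ fun ξ => ?_)
  simp only [pF]
  ring

theorem pF_qF_bound (k : Lag) {A : ℝ} (hA : ‖cζ k‖ ≤ A) (ξ : ℝ) :
    |pF k ξ| ≤ Real.exp (2 * A) * expAvg (src k) ξ ∧
      |qF k ξ| ≤ Real.exp (2 * A) * expAvg (src k) ξ := by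
  have hc := (isPrimitive_yk k).continuous
  have h1 := (kerL_bound hc (abs_yk_sub_le k hA) (Lp.memLp (src k)) ξ).2
  have h2 := (kerR_bound hc (abs_yk_sub_le k hA) (Lp.memLp (src k)) ξ).2
  have h0 := mul_nonneg (Real.exp_pos (2 * A)).le (expAvg_nonneg (src k) ξ)
  rw [abs_le] at h1 h2
  constructor
  · rw [pF, abs_le]
    constructor <;> linarith
  · rw [qF, abs_le]
    constructor <;> linarith

theorem pF_qF_sub_bound (k l : Lag) {A : ℝ} (hk : ‖cζ k‖ ≤ A) (hl : ‖cζ l‖ ≤ A) (ξ : ℝ) :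
    |pF k ξ - pF l ξ| ≤ Real.exp (2 * A) * expAvg (fun x => src k x - src l x) ξ +
      2 * ‖cζ k - cζ l‖ * Real.exp (2 * A) * expAvg (src l) ξ ∧
    |qF k ξ - qF l ξ| ≤ Real.exp (2 * A) * expAvg (fun x => src k x - src l x) ξ +
      2 * ‖cζ k - cζ l‖ * Real.exp (2 * A) * expAvg (src l) ξ := by
  have hδ : ∀ x, |yk k x - yk l x| ≤ ‖cζ k - cζ l‖ := fun x => by
    rw [yk, yk, add_sub_add_right_eq_sub]
    exact (cζ k - cζ l).abs_le x
  have h1 := kerL_sub_bound (isPrimitive_yk k).continuous (isPrimitive_yk l).continuous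
    (abs_yk_sub_le k hk) (abs_yk_sub_le l hl) hδ (Lp.memLp (src k)) (Lp.memLp (src l)) ξ
  have h2 := kerR_sub_bound (isPrimitive_yk k).continuous (isPrimitive_yk l).continuous
    (abs_yk_sub_le k hk) (abs_yk_sub_le l hl) hδ (Lp.memLp (src k)) (Lp.memLp (src l)) ξ
  have h0 := (abs_nonneg _).trans h1
  rw [abs_le] at h1 h2
  constructor
  · rw [pF, pF, abs_le]
    constructor <;> linarith
  · rw [qF, qF, abs_le]
    constructor <;> linarith

/-- Merges two averages into one, so that the L² estimate for a single average applies to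
differences of kernels. -/
theorem expAvg_combine {g₁ g₂ : ℝ → ℝ} {a b : ℝ} (hg₁ : MemLp g₁ 2) (hg₂ : MemLp g₂ 2)
    (ha : 0 ≤ a) (hb : 0 ≤ b) (ξ : ℝ) :
    a * expAvg g₁ ξ + b * expAvg g₂ ξ = expAvg (fun x => a * |g₁ x| + b * |g₂ x|) ξ := by
  rw [expAvg, expAvg, ← integral_const_mul, ← integral_const_mul,
    ← integral_add ((integrable_exp_mul_abs hg₁ ξ).const_mul a)
      ((integrable_exp_mul_abs hg₂ ξ).const_mul b)]
  refine integral_congr_ae (ae_of_all _ fun η => ?_)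
  simp only
  rw [abs_of_nonneg (by positivity : 0 ≤ a * |g₁ η| + b * |g₂ η|)]
  ring

theorem bound_of_le_expAvg {F : ℝ → ℝ} {g₁ g₂ : ℝ → ℝ} {a b : ℝ} (hF : Continuous F)
    (hg₁ : MemLp g₁ 2) (hg₂ : MemLp g₂ 2) (ha : 0 ≤ a) (hb : 0 ≤ b)
    (h : ∀ ξ, |F ξ| ≤ a * expAvg g₁ ξ + b * expAvg g₂ ξ) :
    (∀ ξ, |F ξ| ≤ 2 * (a * lpNorm g₁ 2 volume + b * lpNorm g₂ 2 volume)) ∧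
      lpNorm F 2 volume ≤ 2 * (a * lpNorm g₁ 2 volume + b * lpNorm g₂ 2 volume) := by
  constructor
  · intro ξ
    have h1 := mul_le_mul_of_nonneg_left (expAvg_le hg₁ ξ) ha
    have h2 := mul_le_mul_of_nonneg_left (expAvg_le hg₂ ξ) hb
    linarith [h ξ]
  · have m1 : MemLp (fun x => a * |g₁ x|) 2 := hg₁.abs.const_mul a
    have m2 : MemLp (fun x => b * |g₂ x|) 2 := hg₂.abs.const_mul b
    have h1 : ∀ ξ, |F ξ| ≤ 1 * expAvg (fun x => a * |g₁ x| + b * |g₂ x|) ξ := fun ξ => by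
      rw [one_mul, ← expAvg_combine hg₁ hg₂ ha hb]
      exact h ξ
    refine (memLp_of_le_expAvg hF.aestronglyMeasurable (m1.add m2) h1).2.trans ?_
    have h2 := lpNorm_add_le (g := fun x => b * |g₂ x|) m1 one_le_two
    have e : ∀ (c : ℝ) (g : ℝ → ℝ), 0 ≤ c → MemLp g 2 →
        lpNorm (fun x => c * |g x|) 2 volume = c * lpNorm g 2 volume := fun c g hc hg => by
      have := lpNorm_const_smul (p := 2) c (fun x => |g x|) (volume : Measure ℝ)
      rw [lpNorm_fun_abs hg.1] at this
      simpa [Pi.smul_def, abs_of_nonneg hc] using this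
    rw [e a g₁ ha hg₁, e b g₂ hb hg₂] at h2
    rw [abs_one, mul_one]
    exact mul_le_mul_of_nonneg_left h2 two_pos.le

theorem pF_qF_memLp (k : Lag) : MemLp (pF k) 2 ∧ MemLp (qF k) 2 :=
  ⟨(memLp_of_le_expAvg (isPrimitive_pF k).continuous.aestronglyMeasurable (Lp.memLp (src k))
    fun ξ => (pF_qF_bound k le_rfl ξ).1).1,
   (memLp_of_le_expAvg (isPrimitive_qF k).continuous.aestronglyMeasurable (Lp.memLp (src k))
    fun ξ => (pF_qF_bound k le_rfl ξ).2).1⟩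

theorem pF_qF_le (k : Lag) {A : ℝ} (hA : ‖cζ k‖ ≤ A) :
    ((∀ ξ, |pF k ξ| ≤ 2 * (Real.exp (2 * A) * ‖src k‖)) ∧
      lpNorm (pF k) 2 volume ≤ 2 * (Real.exp (2 * A) * ‖src k‖)) ∧
    ((∀ ξ, |qF k ξ| ≤ 2 * (Real.exp (2 * A) * ‖src k‖)) ∧
      lpNorm (qF k) 2 volume ≤ 2 * (Real.exp (2 * A) * ‖src k‖)) := by
  have h0 := (Lp.memLp (src k))
  have h1 := bound_of_le_expAvg (isPrimitive_pF k).continuous h0 h0 (Real.exp_pos (2 * A)).le le_rfl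
    fun ξ => by simpa using (pF_qF_bound k hA ξ).1
  have h2 := bound_of_le_expAvg (isPrimitive_qF k).continuous h0 h0 (Real.exp_pos (2 * A)).le le_rfl
    fun ξ => by simpa using (pF_qF_bound k hA ξ).2
  rw [zero_mul, add_zero, ← L2.norm_eq] at h1 h2
  exact ⟨h1, h2⟩

/-- `P` as a bounded continuous function. -/
def pB (k : Lag) : BF := BoundedContinuousFunction.ofNormedAddCommGroup (pF k)
  (isPrimitive_pF k).continuous _ (pF_qF_le k le_rfl).1.1

/-- `Q` as a bounded continuous function. -/
def qB (k : Lag) : BF := BoundedContinuousFunction.ofNormedAddCommGroup (qF k)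
  (isPrimitive_qF k).continuous _ (pF_qF_le k le_rfl).2.1

/-- `P` as an element of `L²`. -/
def pL (k : Lag) : L2 := (pF_qF_memLp k).1.toLp _

/-- `Q` as an element of `L²`. -/
def qL (k : Lag) : L2 := (pF_qF_memLp k).2.toLp _

theorem coeFn_pL (k : Lag) : (pL k : ℝ → ℝ) =ᵐ[volume] pB k := MemLp.coeFn_toLp _

theorem coeFn_qL (k : Lag) : (qL k : ℝ → ℝ) =ᵐ[volume] qB k := MemLp.coeFn_toLp _

theorem norm_pq_le (k : Lag) {A : ℝ} (hA : ‖cζ k‖ ≤ A) :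
    ‖qB k‖ ≤ 2 * (Real.exp (2 * A) * ‖src k‖) ∧ ‖pL k‖ ≤ 2 * (Real.exp (2 * A) * ‖src k‖) ∧
      ‖qL k‖ ≤ 2 * (Real.exp (2 * A) * ‖src k‖) := by
  obtain ⟨⟨-, h2⟩, h3, h4⟩ := pF_qF_le k hA
  refine ⟨(BoundedContinuousFunction.norm_le (by positivity)).2 h3, ?_, ?_⟩
  · rwa [pL, norm_toLp_eq_lpNorm]
  · rwa [qL, norm_toLp_eq_lpNorm]

theorem norm_pq_sub_le (k l : Lag) {A : ℝ} (hk : ‖cζ k‖ ≤ A) (hl : ‖cζ l‖ ≤ A) {C : ℝ}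
    (hC : 2 * (Real.exp (2 * A) * ‖src k - src l‖ +
      2 * ‖cζ k - cζ l‖ * Real.exp (2 * A) * ‖src l‖) ≤ C) :
    ‖pB k - pB l‖ ≤ C ∧ ‖qB k - qB l‖ ≤ C ∧ ‖pL k - pL l‖ ≤ C ∧ ‖qL k - qL l‖ ≤ C := by
  have m := (Lp.memLp (src k)).sub (Lp.memLp (src l))
  have e : lpNorm (fun x => src k x - src l x) 2 volume = ‖src k - src l‖ := by
    rw [L2.norm_eq]
    exact lpNorm_congr_ae (Lp.coeFn_sub (src k) (src l)).symm
  have h1 := bound_of_le_expAvg ((isPrimitive_pF k).continuous.sub (isPrimitive_pF l).continuous)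
    m (Lp.memLp (src l)) (Real.exp_pos (2 * A)).le (by positivity)
    fun ξ => (pF_qF_sub_bound k l hk hl ξ).1
  have h2 := bound_of_le_expAvg ((isPrimitive_qF k).continuous.sub (isPrimitive_qF l).continuous)
    m (Lp.memLp (src l)) (Real.exp_pos (2 * A)).le (by positivity)
    fun ξ => (pF_qF_sub_bound k l hk hl ξ).2
  have e' : lpNorm ((src k : ℝ → ℝ) - (src l : ℝ → ℝ)) 2 volume = ‖src k - src l‖ := e
  rw [e', ← L2.norm_eq] at h1 h2
  have hC0 : 0 ≤ C := le_trans (by positivity) hC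
  refine ⟨(BoundedContinuousFunction.norm_le hC0).2 fun ξ => (h1.1 ξ).trans hC,
    (BoundedContinuousFunction.norm_le hC0).2 fun ξ => (h2.1 ξ).trans hC, ?_, ?_⟩
  · rw [pL, pL, ← MemLp.toLp_sub, norm_toLp_eq_lpNorm]
    exact h1.2.trans hC
  · rw [qL, qL, ← MemLp.toLp_sub, norm_toLp_eq_lpNorm]
    exact h2.2.trans hC

/-! ### Maps that are Lipschitz on bounded sets -/

/-- `f` is Lipschitz on bounded sets. -/
def LocLip {E F : Type*} [NormedAddCommGroup E] [NormedAddCommGroup F] (f : E → F) : Prop :=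
  ∀ R : ℝ, ∃ L : ℝ, 0 ≤ L ∧ ∀ k l, ‖k‖ ≤ R → ‖l‖ ≤ R → ‖f k - f l‖ ≤ L * ‖k - l‖

namespace LocLip

variable {E F : Type*} [NormedAddCommGroup E] [NormedAddCommGroup F]

theorem bounded {f : E → F} (hf : LocLip f) (R : ℝ) :
    ∃ C : ℝ, 0 ≤ C ∧ ∀ k, ‖k‖ ≤ R → ‖f k‖ ≤ C := by
  obtain ⟨L, hL, h⟩ := hf (max R 0)
  refine ⟨‖f 0‖ + L * max R 0, by positivity, fun k hk => ?_⟩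
  have h1 := h k 0 (hk.trans (le_max_left _ _)) (by simp)
  rw [sub_zero] at h1
  have h2 : ‖f k‖ ≤ ‖f k - f 0‖ + ‖f 0‖ := by
    simpa using norm_add_le (f k - f 0) (f 0)
  have h3 : L * ‖k‖ ≤ L * max R 0 := by
    gcongr
    exact hk.trans (le_max_left _ _)
  linarith

theorem clm [NormedSpace ℝ E] [NormedSpace ℝ F] (A : E →L[ℝ] F) : LocLip A :=
  fun _ => ⟨‖A‖, norm_nonneg _, fun k l _ _ => by
  rw [← map_sub]
  exact A.le_opNorm _⟩

theorem add {f g : E → F} (hf : LocLip f) (hg : LocLip g) :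
    LocLip fun k => f k + g k := fun R => by
  obtain ⟨L, hL, h⟩ := hf R
  obtain ⟨L', hL', h'⟩ := hg R
  refine ⟨L + L', by positivity, fun k l hk hl => ?_⟩
  rw [add_sub_add_comm, add_mul]
  exact (norm_add_le _ _).trans (add_le_add (h k l hk hl) (h' k l hk hl))

theorem const_smul [NormedSpace ℝ F] {f : E → F} (c : ℝ) (hf : LocLip f) :
    LocLip fun k => c • f k := fun R => by
  obtain ⟨L, hL, h⟩ := hf R
  refine ⟨‖c‖ * L, by positivity, fun k l hk hl => ?_⟩
  rw [← _root_.smul_sub, norm_smul, mul_assoc]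
  exact mul_le_mul_of_nonneg_left (h k l hk hl) (norm_nonneg _)

theorem neg [NormedSpace ℝ F] {f : E → F} (hf : LocLip f) : LocLip fun k => -f k := by
  simpa using hf.const_smul (-1)

theorem sub [NormedSpace ℝ F] {f g : E → F} (hf : LocLip f) (hg : LocLip g) :
    LocLip fun k => f k - g k := by
  simpa [sub_eq_add_neg] using hf.add hg.neg

theorem smul {b : E → BF} {f : E → L2} (hb : LocLip b) (hf : LocLip f) :
    LocLip fun k => b k • f k := fun R => by
  obtain ⟨L, hL, h⟩ := hb R
  obtain ⟨L', hL', h'⟩ := hf R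
  obtain ⟨B, hB, hB'⟩ := hb.bounded R
  obtain ⟨C, hC, hC'⟩ := hf.bounded R
  refine ⟨B * L' + L * C, by positivity, fun k l hk hl => ?_⟩
  have e : b k • f k - b l • f l = b k • (f k - f l) + (b k - b l) • f l := by
    rw [_root_.smul_sub, sub_smul]
    abel
  rw [e]
  refine (norm_add_le _ _).trans ?_
  have h1 : ‖b k • (f k - f l)‖ ≤ B * (L' * ‖k - l‖) :=
    (norm_bsmul_le _ _).trans (mul_le_mul (hB' k hk) (h' k l hk hl) (norm_nonneg _) hB)
  have h2 : ‖(b k - b l) • f l‖ ≤ L * ‖k - l‖ * C :=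
    (norm_bsmul_le _ _).trans (mul_le_mul (h k l hk hl) (hC' l hl) (norm_nonneg _) (by positivity))
  linarith

theorem mul {b f : E → BF} (hb : LocLip b) (hf : LocLip f) :
    LocLip fun k => b k * f k := fun R => by
  obtain ⟨L, hL, h⟩ := hb R
  obtain ⟨L', hL', h'⟩ := hf R
  obtain ⟨B, hB, hB'⟩ := hb.bounded R
  obtain ⟨C, hC, hC'⟩ := hf.bounded R
  refine ⟨B * L' + L * C, by positivity, fun k l hk hl => ?_⟩
  have e : b k * f k - b l * f l = b k * (f k - f l) + (b k - b l) * f l := by ring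
  rw [e]
  refine (norm_add_le _ _).trans ?_
  have h1 : ‖b k * (f k - f l)‖ ≤ B * (L' * ‖k - l‖) :=
    (norm_mul_le _ _).trans (mul_le_mul (hB' k hk) (h' k l hk hl) (norm_nonneg _) hB)
  have h2 : ‖(b k - b l) * f l‖ ≤ L * ‖k - l‖ * C :=
    (norm_mul_le _ _).trans (mul_le_mul (h k l hk hl) (hC' l hl) (norm_nonneg _) (by positivity))
  linarith

theorem continuous {f : E → F} (hf : LocLip f) : Continuous f := by
  rw [continuous_iff_continuousAt]
  intro k
  obtain ⟨L, hL, h⟩ := hf (‖k‖ + 1)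
  rw [ContinuousAt, tendsto_iff_norm_sub_tendsto_zero]
  have h1 : Tendsto (fun l => L * ‖l - k‖) (𝓝 k) (𝓝 0) := by
    have : Continuous fun l => L * ‖l - k‖ := by fun_prop
    simpa using this.tendsto k
  refine squeeze_zero' (Eventually.of_forall fun _ => norm_nonneg _) ?_ h1
  filter_upwards [Metric.ball_mem_nhds k one_pos] with l hl
  refine h l k ?_ (by linarith)
  rw [mem_ball_iff_norm] at hl
  have := norm_add_le (l - k) k
  rw [sub_add_cancel] at this
  linarith

end LocLip

theorem locLip_src : LocLip src := by
  have h1 : LocLip fun k => cU k • lU k := (LocLip.clm cU).smul (LocLip.clm lU)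
  have h2 : LocLip fun k => cU k * cU k := (LocLip.clm cU).mul (LocLip.clm cU)
  have h3 : LocLip fun k => (cU k * cU k) • dζ k := h2.smul (LocLip.clm dζ)
  have h4 : LocLip fun k => cU k • lU k + (cU k * cU k) • dζ k := h1.add h3
  have h5 : LocLip fun k => dH k := LocLip.clm dH
  exact h4.add h5

theorem locLip_pq : LocLip pB ∧ LocLip qB ∧ LocLip pL ∧ LocLip qL := by
  have key : ∀ R : ℝ, ∃ L : ℝ, 0 ≤ L ∧ ∀ k l : Lag, ‖k‖ ≤ R → ‖l‖ ≤ R →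
      ‖pB k - pB l‖ ≤ L * ‖k - l‖ ∧ ‖qB k - qB l‖ ≤ L * ‖k - l‖ ∧
      ‖pL k - pL l‖ ≤ L * ‖k - l‖ ∧ ‖qL k - qL l‖ ≤ L * ‖k - l‖ := fun R => by
    obtain ⟨L, hL, h⟩ := locLip_src R
    obtain ⟨C, hC, hC'⟩ := locLip_src.bounded R
    refine ⟨2 * (Real.exp (2 * R) * L + 2 * Real.exp (2 * R) * C), by positivity,
      fun k l hk hl => norm_pq_sub_le k l ((norm_comp_le k).1.trans hk)
        ((norm_comp_le l).1.trans hl) ?_⟩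
    have h1 : ‖cζ k - cζ l‖ ≤ ‖k - l‖ := by
      rw [← map_sub]
      exact (norm_comp_le (k - l)).1
    calc 2 * (Real.exp (2 * R) * ‖src k - src l‖ +
          2 * ‖cζ k - cζ l‖ * Real.exp (2 * R) * ‖src l‖)
        ≤ 2 * (Real.exp (2 * R) * (L * ‖k - l‖) + 2 * ‖k - l‖ * Real.exp (2 * R) * C) := by
          gcongr
          · exact h k l hk hl
          · exact hC' l hl
      _ = _ := by ring
  refine ⟨fun R => ?_, fun R => ?_, fun R => ?_, fun R => ?_⟩ <;>
    obtain ⟨L, hL, h⟩ := key R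
  · exact ⟨L, hL, fun k l hk hl => (h k l hk hl).1⟩
  · exact ⟨L, hL, fun k l hk hl => (h k l hk hl).2.1⟩
  · exact ⟨L, hL, fun k l hk hl => (h k l hk hl).2.2.1⟩
  · exact ⟨L, hL, fun k l hk hl => (h k l hk hl).2.2.2⟩

/-! ### Assembling the vector field and its growth -/

/-- `-Q_ξ` as an element of `L²`. -/
def ndQ (k : Lag) : L2 := (1 / 2 : ℝ) • src k - pL k - pB k • dζ k

/-- The third component `U³ - 2PU` of the vector field. -/
def tB (k : Lag) : BF := cU k * (cU k * cU k) - (2 : ℝ) • (pB k * cU k)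

/-- The derivative of the third component of the vector field. -/
def tL (k : Lag) : L2 := (3 : ℝ) • (cU k * cU k) • dU k - (2 : ℝ) • cU k • qL k
  - (2 : ℝ) • (qB k * cU k) • dζ k - (2 : ℝ) • pB k • dU k

theorem coeFn_ndQ (k : Lag) : (ndQ k : ℝ → ℝ) =ᵐ[volume] fun ξ =>
    -(-(1 / 2) * src k ξ + (dζ k ξ + 1) * pF k ξ) := by
  filter_upwards [Lp.coeFn_sub ((1 / 2 : ℝ) • src k - pL k) (pB k • dζ k),
    Lp.coeFn_sub ((1 / 2 : ℝ) • src k) (pL k), Lp.coeFn_smul (1 / 2 : ℝ) (src k),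
    coeFn_bsmul (pB k) (dζ k), coeFn_pL k] with ξ h1 h2 h3 h4 h5
  rw [ndQ, h1, Pi.sub_apply, h2, Pi.sub_apply, h3, h4, h5, Pi.smul_apply, smul_eq_mul]
  change _ - pF k ξ - pF k ξ * _ = _
  ring

theorem coeFn_tL (k : Lag) : (tL k : ℝ → ℝ) =ᵐ[volume] fun ξ =>
    3 * cU k ξ ^ 2 * dU k ξ - 2 * cU k ξ * qF k ξ * (dζ k ξ + 1) - 2 * pF k ξ * dU k ξ := by
  filter_upwards [Lp.coeFn_sub ((3 : ℝ) • (cU k * cU k) • dU k - (2 : ℝ) • cU k • qL k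
    - (2 : ℝ) • (qB k * cU k) • dζ k) ((2 : ℝ) • pB k • dU k),
    Lp.coeFn_sub ((3 : ℝ) • (cU k * cU k) • dU k - (2 : ℝ) • cU k • qL k)
      ((2 : ℝ) • (qB k * cU k) • dζ k),
    Lp.coeFn_sub ((3 : ℝ) • (cU k * cU k) • dU k) ((2 : ℝ) • cU k • qL k),
    Lp.coeFn_smul (3 : ℝ) ((cU k * cU k) • dU k), Lp.coeFn_smul (2 : ℝ) (cU k • qL k),
    Lp.coeFn_smul (2 : ℝ) ((qB k * cU k) • dζ k), Lp.coeFn_smul (2 : ℝ) (pB k • dU k),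
    coeFn_bsmul (cU k * cU k) (dU k), coeFn_bsmul (cU k) (qL k), coeFn_bsmul (qB k * cU k) (dζ k),
    coeFn_bsmul (pB k) (dU k), coeFn_qL k] with ξ h1 h2 h3 h4 h5 h6 h7 h8 h9 h10 h11 h12
  rw [tL, h1, Pi.sub_apply, h2, Pi.sub_apply, h3, Pi.sub_apply, h4, h5, h6, h7, Pi.smul_apply,
    Pi.smul_apply, Pi.smul_apply, Pi.smul_apply, h8, h9, h10, h11, h12]
  simp only [smul_eq_mul, BoundedContinuousFunction.mul_apply]
  change _ - 2 * (_ * qF k ξ) - 2 * (qF k ξ * _ * _) - 2 * (pF k ξ * _) = _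
  ring

theorem isPrimitive_tB (k : Lag) : IsPrimitive (tB k) (tL k) := by
  have hU := isPrimitive_U k
  have h := (hU.mul (hU.mul hU)).sub (((isPrimitive_pF k).mul hU).const_mul 2)
  refine IsPrimitive.congr (f := tB k) h ?_
  filter_upwards [coeFn_tL k] with ξ h1
  rw [h1]
  ring

/-- The vector field `(U, -Q, U³ - 2PU)`. -/
def field (k : Lag) : Lag :=
  Lag.mk (cU k) (-qB k) (tB k) (dU k) (-qL k) (ndQ k) (tL k) (isPrimitive_U k)
    (by
      filter_upwards [Lp.coeFn_neg (qL k), coeFn_qL k] with ξ h1 h2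
      rw [h1, Pi.neg_apply, h2]
      rfl)
    (IsPrimitive.congr (f := (-qB k : BF)) (isPrimitive_qF k).neg (coeFn_ndQ k).symm)
    (isPrimitive_tB k)

theorem locLip_field : LocLip field := by
  obtain ⟨hp, hq, hpl, hql⟩ := locLip_pq
  have hs := locLip_src
  have cU' : LocLip fun k => cU k := LocLip.clm cU
  have dU' : LocLip fun k => dU k := LocLip.clm dU
  have dζ' : LocLip fun k => dζ k := LocLip.clm dζ
  have ht : LocLip tB := (cU'.mul (cU'.mul cU')).sub ((hp.mul cU').const_smul 2)
  have hn : LocLip ndQ := ((hs.const_smul (1 / 2)).sub hpl).sub (hp.smul dζ')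
  have h5a : LocLip fun k => (3 : ℝ) • (cU k * cU k) • dU k :=
    ((cU'.mul cU').smul dU').const_smul 3
  have h5b : LocLip fun k => (2 : ℝ) • cU k • qL k := (cU'.smul hql).const_smul 2
  have h5c : LocLip fun k => (2 : ℝ) • (qB k * cU k) • dζ k :=
    ((hq.mul cU').smul dζ').const_smul 2
  have h5d : LocLip fun k => (2 : ℝ) • pB k • dU k := (hp.smul dU').const_smul 2
  have htl : LocLip tL := ((h5a.sub h5b).sub h5c).sub h5d
  intro R
  obtain ⟨L1, p1, h1⟩ := cU' R
  obtain ⟨L2, p2, h2⟩ := hq R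
  obtain ⟨L3, p3, h3⟩ := ht R
  obtain ⟨L4, p4, h4⟩ := dU' R
  obtain ⟨L5, p5, h5⟩ := hql R
  obtain ⟨L6, p6, h6⟩ := hn R
  obtain ⟨L7, p7, h7⟩ := htl R
  refine ⟨L1 + L2 + L3 + L4 + L5 + L6 + L7, by positivity, fun k l hk hl => ?_⟩
  have key : ∀ {E : Type} [NormedAddCommGroup E] {f : E} {L : ℝ}, ‖f‖ ≤ L * ‖k - l‖ →
      L ≤ L1 + L2 + L3 + L4 + L5 + L6 + L7 →
      ‖f‖ ≤ (L1 + L2 + L3 + L4 + L5 + L6 + L7) * ‖k - l‖ := fun h hL =>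
    h.trans (mul_le_mul_of_nonneg_right hL (norm_nonneg _))
  rw [Lag.norm_le_iff]
  refine ⟨key (h1 k l hk hl) (by linarith), ?_, key (h3 k l hk hl) (by linarith),
    key (h4 k l hk hl) (by linarith), ?_, key (h6 k l hk hl) (by linarith),
    key (h7 k l hk hl) (by linarith)⟩
  · have := key (h2 k l hk hl) (by linarith)
    rw [norm_sub_rev] at this
    have e : cU (field k - field l) = qB l - qB k := by
      change -qB k - -qB l = _
      abel
    rwa [e]
  · have := key (h5 k l hk hl) (by linarith)
    rw [norm_sub_rev] at this
    have e : lU (field k - field l) = qL l - qL k := by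
      change -qL k - -qL l = _
      abel
    rwa [e]

/-- Although the nonlinearity is cubic, every term contains a component of `k` linearly, and the
remaining factors are controlled by the sup norms of ζ, U, P and Q. This linear growth is what rules
out blow-up. -/
theorem norm_field_le {A : ℝ} (hA : 0 ≤ A) : ∃ L : ℝ, 0 ≤ L ∧ ∀ k : Lag, ‖cζ k‖ ≤ A →
    ‖cU k‖ ≤ A → ‖pB k‖ ≤ A → ‖qB k‖ ≤ A → ‖field k‖ ≤ L * ‖k‖ := by
  -- `S` is the constant for the source: U·U, U² ζ_ξ and H_ξ contribute A, A² and 1. `E` is the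
  -- resulting constant for Q in sup norm and for P and Q in L².
  set S := A + A ^ 2 + 1 with hS
  set E := 2 * (Real.exp (2 * A) * S) with hE
  have hS0 : 0 ≤ S := by positivity
  have hE0 : 0 ≤ E := by positivity
  refine ⟨1 + E + (A ^ 2 + 2 * A) + (S + E + A) + (3 * A ^ 2 + 2 * A * E + 2 * A ^ 2 + 2 * A),
    by positivity, fun k h1 h2 h3 h4 => ?_⟩
  obtain ⟨n1, n2, n3, n4, n5, n6, n7⟩ := norm_comp_le k
  have hk := norm_nonneg k
  have smul_le : ∀ {b : BF} {f : L2} {B C : ℝ}, ‖b‖ ≤ B → ‖f‖ ≤ C * ‖k‖ → 0 ≤ B →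
      ‖b • f‖ ≤ B * C * ‖k‖ := fun hb hf hB => by
    rw [mul_assoc]
    exact (norm_bsmul_le _ _).trans (mul_le_mul hb hf (norm_nonneg _) hB)
  have two_le : ∀ {E : Type} [NormedAddCommGroup E] [NormedSpace ℝ E] {f : E} {c C : ℝ}, 0 ≤ c →
      ‖f‖ ≤ C * ‖k‖ → ‖c • f‖ ≤ c * C * ‖k‖ := fun hc hf => by
    rw [norm_smul, Real.norm_of_nonneg hc, mul_assoc]
    exact mul_le_mul_of_nonneg_left hf hc
  have one : ∀ {x : ℝ}, x ≤ ‖k‖ → x ≤ 1 * ‖k‖ := fun h => by rwa [one_mul]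
  have UU : ‖cU k * cU k‖ ≤ A ^ 2 := by
    rw [sq]
    exact (norm_mul_le _ _).trans (mul_le_mul h2 h2 (norm_nonneg _) hA)
  have QU : ‖qB k * cU k‖ ≤ A ^ 2 := by
    rw [sq]
    exact (norm_mul_le _ _).trans (mul_le_mul h4 h2 (norm_nonneg _) hA)
  have hsrc : ‖src k‖ ≤ S * ‖k‖ := by
    have a1 := smul_le h2 (one n5) hA
    have a2 := smul_le UU (one n4) (by positivity)
    refine (norm_add_le _ _).trans ((add_le_add (norm_add_le _ _) le_rfl).trans ?_)
    rw [hS]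
    linarith
  obtain ⟨q1, q2, q3⟩ := norm_pq_le k h1
  have hse : 2 * (Real.exp (2 * A) * ‖src k‖) ≤ E * ‖k‖ := by
    rw [hE, mul_assoc, mul_assoc]
    gcongr
  have q1' := q1.trans hse
  have q2' := q2.trans hse
  have q3' := q3.trans hse
  have t3 : ‖tB k‖ ≤ (A ^ 2 + 2 * A) * ‖k‖ := by
    refine (norm_sub_le _ _).trans ?_
    have b1 : ‖cU k * (cU k * cU k)‖ ≤ A ^ 2 * ‖k‖ := by
      rw [mul_comm (cU k)]
      exact (norm_mul_le _ _).trans (mul_le_mul UU n2 (norm_nonneg _) (by positivity))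
    have b2 : ‖pB k * cU k‖ ≤ A * ‖k‖ :=
      (norm_mul_le _ _).trans (mul_le_mul h3 n2 (norm_nonneg _) hA)
    have b3 := two_le (c := 2) zero_le_two b2
    linarith
  have t6 : ‖ndQ k‖ ≤ (S + E + A) * ‖k‖ := by
    refine (norm_sub_le _ _).trans ((add_le_add (norm_sub_le _ _) le_rfl).trans ?_)
    have b1 := two_le (c := 1 / 2) (by norm_num) hsrc
    have b2 := smul_le h3 (one n4) hA
    nlinarith [mul_nonneg hS0 hk]
  have t7 : ‖tL k‖ ≤ (3 * A ^ 2 + 2 * A * E + 2 * A ^ 2 + 2 * A) * ‖k‖ := by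
    refine (norm_sub_le _ _).trans ((add_le_add ((norm_sub_le _ _).trans
      (add_le_add (norm_sub_le _ _) le_rfl)) le_rfl).trans ?_)
    have b1 := two_le (c := 3) (by norm_num) (smul_le UU (one n6) (by positivity))
    have b2 := two_le (c := 2) (by norm_num) (smul_le h2 q3' hA)
    have b3 := two_le (c := 2) (by norm_num) (smul_le QU (one n4) (by positivity))
    have b4 := two_le (c := 2) (by norm_num) (smul_le h3 (one n6) hA)
    linarith
  have p1 := mul_nonneg hE0 hk
  have p2 : 0 ≤ (A ^ 2 + 2 * A) * ‖k‖ := by positivity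
  have p3 : 0 ≤ (S + E + A) * ‖k‖ := by positivity
  have p4 : 0 ≤ (3 * A ^ 2 + 2 * A * E + 2 * A ^ 2 + 2 * A) * ‖k‖ := by positivity
  rw [add_mul, add_mul, add_mul, add_mul, one_mul, Lag.norm_le_iff]
  refine ⟨?_, ?_, ?_, ?_, ?_, ?_, ?_⟩
  · change ‖cU k‖ ≤ _
    linarith
  · change ‖-qB k‖ ≤ _
    rw [norm_neg]
    linarith
  · change ‖tB k‖ ≤ _
    linarith
  · change ‖dU k‖ ≤ _
    linarith
  · change ‖-qL k‖ ≤ _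
    rw [norm_neg]
    linarith
  · change ‖ndQ k‖ ≤ _
    linarith
  · change ‖tL k‖ ≤ _
    linarith

/-! ### Comparison with the right-hand side of the system -/

theorem weakDeriv_y_ae (k : Lag) :
    weakDeriv (toTriple k).y =ᵐ[volume] fun ξ => dζ k ξ + 1 := (isPrimitive_yk k).weakDeriv_ae

theorem src_ae_weakDeriv (k : Lag) : (src k : ℝ → ℝ) =ᵐ[volume] fun η =>
    (toTriple k).U η ^ 2 * weakDeriv (toTriple k).y η + weakDeriv (toTriple k).H η := by
  filter_upwards [coeFn_src k, weakDeriv_y_ae k, (isPrimitive_H k).weakDeriv_ae] with η h1 h2 h3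
  rw [h1, h2]
  change _ = _ + weakDeriv (cH k) η
  rw [h3]
  rfl

/-- Monotonicity of y gives the sign of y(ξ) - y(η) on each side of η = ξ, so the absolute values in
P and Q turn into the one-sided kernels. -/
theorem rhs_toTriple {k : Lag} (hk : Monotone (yk k)) : rhs (toTriple k) = toTriple (field k) := by
  have hy := (isPrimitive_yk k).continuous
  have hs := Lp.memLp (src k)
  have hA := abs_yk_sub_le k le_rfl
  -- σ = 1 yields P and σ = sign yields Q. The value σ(0) is irrelevant because it only matters on
  -- the null set η = ξ.
  have key : ∀ σ : ℝ → ℝ, (∀ x, x < 0 → σ x = σ (-1)) → (∀ x, 0 < x → σ x = σ 1) →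
      ∀ ξ, ∫ η, σ (ξ - η) * Real.exp (-|(toTriple k).y ξ - (toTriple k).y η|) *
        ((toTriple k).U η ^ 2 * weakDeriv (toTriple k).y η + weakDeriv (toTriple k).H η) =
        σ 1 * kerL (yk k) (src k) ξ + σ (-1) * kerR (yk k) (src k) ξ := fun σ hneg hpos ξ => by
    have e : (fun η => σ (ξ - η) * Real.exp (-|(toTriple k).y ξ - (toTriple k).y η|) *
        ((toTriple k).U η ^ 2 * weakDeriv (toTriple k).y η + weakDeriv (toTriple k).H η)) =ᵐ[volume]
        fun η => σ (ξ - η) * Real.exp (-|yk k ξ - yk k η|) * src k η := by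
      filter_upwards [src_ae_weakDeriv k] with η h
      rw [h]
      rfl
    have e1 : ∀ᵐ η, η ∈ Iic ξ → σ (ξ - η) * Real.exp (-|yk k ξ - yk k η|) * src k η =
        σ 1 * (Real.exp (yk k η - yk k ξ) * src k η) := by
      filter_upwards [(measure_singleton (μ := volume) ξ : _) |> compl_mem_ae_iff.2] with η h1 h2
      have h3 : η < ξ := lt_of_le_of_ne h2 h1
      rw [hpos _ (sub_pos.2 h3), abs_of_nonneg (sub_nonneg.2 (hk h3.le)), neg_sub, mul_assoc]
    have e2 : ∀ᵐ η, η ∈ Ioi ξ → σ (ξ - η) * Real.exp (-|yk k ξ - yk k η|) * src k η =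
        σ (-1) * (Real.exp (yk k ξ - yk k η) * src k η) := ae_of_all _ fun η h => by
      have h3 : ξ < η := h
      rw [hneg _ (sub_neg.2 h3), abs_of_nonpos (sub_nonpos.2 (hk h3.le)), neg_neg, mul_assoc]
    have i1 : IntegrableOn (fun η => σ (ξ - η) * Real.exp (-|yk k ξ - yk k η|) * src k η)
        (Iic ξ) := ((kerL_bound hy hA hs ξ).1.const_mul (σ 1)).congr
      (((ae_restrict_iff' measurableSet_Iic).2 e1).mono fun _ h => h.symm)
    have i2 : IntegrableOn (fun η => σ (ξ - η) * Real.exp (-|yk k ξ - yk k η|) * src k η)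
        (Ioi ξ) := ((kerR_bound hy hA hs ξ).1.const_mul (σ (-1))).congr
      (((ae_restrict_iff' measurableSet_Ioi).2 e2).mono fun _ h => h.symm)
    rw [integral_congr_ae e, ← intervalIntegral.integral_Iic_add_Ioi i1 i2,
      setIntegral_congr_ae measurableSet_Iic e1, setIntegral_congr_ae measurableSet_Ioi e2,
      integral_const_mul, integral_const_mul]
    rfl
  have hP : ∀ ξ, P (toTriple k) ξ = pF k ξ := fun ξ => by
    have := key (fun _ => 1) (fun _ _ => rfl) (fun _ _ => rfl) ξ
    simp only [one_mul] at this
    rw [P, this, pF]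
  have hQ : ∀ ξ, Q (toTriple k) ξ = qF k ξ := fun ξ => by
    have := key Real.sign (fun x hx => by rw [Real.sign_of_neg hx, Real.sign_of_neg (by norm_num)])
      (fun x hx => by rw [Real.sign_of_pos hx, Real.sign_of_pos one_pos]) ξ
    rw [Q, this, qF, Real.sign_of_pos one_pos, Real.sign_of_neg (by norm_num)]
    ring
  refine Prod.ext rfl (Prod.ext ?_ ?_)
  · funext ξ
    change -Q (toTriple k) ξ = -qF k ξ
    rw [hQ]
  · funext ξ
    change cU k ξ ^ 3 - 2 * P (toTriple k) ξ * cU k ξ =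
      cU k ξ * (cU k ξ * cU k ξ) - 2 * (pF k ξ * cU k ξ)
    rw [hP]
    ring

/-! ## Ordinary differential equations with an a priori bound -/

section ODE

variable {E : Type*} [NormedAddCommGroup E] [NormedSpace ℝ E]

/-- The radial retraction onto the ball of radius `c`. -/
def radial (c : ℝ) (x : E) : E := (c / max c ‖x‖) • x

theorem norm_radial_le {c : ℝ} (hc : 0 < c) (x : E) : ‖radial c x‖ ≤ c := by
  have h : 0 < max c ‖x‖ := lt_max_of_lt_left hc
  rw [radial, norm_smul, Real.norm_of_nonneg (by positivity), div_mul_eq_mul_div, div_le_iff₀ h]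
  exact mul_le_mul_of_nonneg_left (le_max_right _ _) hc.le

theorem radial_of_norm_le {c : ℝ} (hc : 0 < c) {x : E} (hx : ‖x‖ ≤ c) : radial c x = x := by
  rw [radial, max_eq_left hx, div_self hc.ne', one_smul]

theorem norm_radial_sub_le {c : ℝ} (hc : 0 < c) (x y : E) :
    ‖radial c x - radial c y‖ ≤ 2 * ‖x - y‖ := by
  set s := max c ‖x‖ with hs
  set t := max c ‖y‖ with ht
  have h1 : 0 < s := lt_max_of_lt_left hc
  have h2 : 0 < t := lt_max_of_lt_left hc
  have e : radial c x - radial c y = (c / s) • (x - y) + (c / s * ((t - s) / t)) • y := by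
    rw [radial, radial, ← hs, ← ht, smul_sub, sub_add, ← sub_smul]
    congr 2
    field_simp
    ring
  have h3 : c / s ≤ 1 := (div_le_one h1).2 (le_max_left _ _)
  have h4 : ‖y‖ / t ≤ 1 := (div_le_one h2).2 (le_max_right _ _)
  have h5 : |t - s| ≤ ‖x - y‖ := by
    have := abs_max_sub_max_le_max c ‖y‖ c ‖x‖
    rw [sub_self, abs_zero, max_eq_right (abs_nonneg (‖y‖ - ‖x‖))] at this
    rw [norm_sub_rev]
    exact this.trans (abs_norm_sub_norm_le y x)
  rw [e]
  refine (norm_add_le _ _).trans ?_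
  rw [norm_smul, norm_smul, Real.norm_of_nonneg (by positivity), Real.norm_eq_abs, abs_mul,
    abs_of_nonneg (by positivity : 0 ≤ c / s), abs_div, abs_of_pos h2]
  have h6 : c / s * ‖x - y‖ ≤ ‖x - y‖ := mul_le_of_le_one_left (norm_nonneg _) h3
  have h7 : c / s * (|t - s| / t) * ‖y‖ ≤ ‖x - y‖ := by
    calc c / s * (|t - s| / t) * ‖y‖ = c / s * (‖y‖ / t) * |t - s| := by ring
      _ ≤ 1 * 1 * ‖x - y‖ := by gcongr
      _ = ‖x - y‖ := by ring
  linarith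

theorem HasDerivWithinAt.Ici_of_Icc {f : ℝ → E} {f' : E} {a b t : ℝ}
    (h : HasDerivWithinAt f f' (Icc a b) t) (ht : t ∈ Ico a b) :
    HasDerivWithinAt f f' (Ici t) t :=
  h.mono_of_mem_nhdsWithin (Icc_mem_nhdsGE_of_mem ht)

/-- Grönwall's inequality for curves with `‖x'‖ ≤ K ‖x‖`. -/
theorem norm_le_of_deriv_le {x f : ℝ → E} {τ K : ℝ}
    (hx : ∀ t ∈ Icc 0 τ, HasDerivWithinAt x (f t) (Icc 0 τ) t)
    (hK : ∀ t ∈ Icc 0 τ, ‖f t‖ ≤ K * ‖x t‖) {t : ℝ} (ht : t ∈ Icc 0 τ) :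
    ‖x t‖ ≤ ‖x 0‖ * Real.exp (K * t) := by
  have := norm_le_gronwallBound_of_norm_deriv_right_le (f := x) (f' := f) (δ := ‖x 0‖) (K := K)
    (ε := 0) (a := 0) (b := τ) (fun t ht => (hx t ht).continuousWithinAt)
    (fun t ht => HasDerivWithinAt.Ici_of_Icc (hx t (Ico_subset_Icc_self ht)) ht) le_rfl
    (fun t ht => by simpa using hK t (Ico_subset_Icc_self ht)) t ht
  rwa [gronwallBound_ε0, sub_zero] at this

/-- Existence on `[0, T]` for a vector field that is Lipschitz on bounded sets, given an a priori
bound for solutions. -/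
theorem exists_solution_of_apriori [CompleteSpace E] {F : ℝ → E → E} {T R : ℝ} (hT : 0 ≤ T)
    {x₀ : E} (hL : ∀ r : ℝ, ∃ L : ℝ, 0 ≤ L ∧ ∀ t ∈ Icc 0 T, ∀ x y, ‖x‖ ≤ r → ‖y‖ ≤ r →
      ‖F t x - F t y‖ ≤ L * ‖x - y‖)
    (hc : ∀ x, ContinuousOn (fun t => F t x) (Icc 0 T))
    (hap : ∀ τ ∈ Icc 0 T, ∀ x : ℝ → E, x 0 = x₀ →
      (∀ t ∈ Icc 0 τ, HasDerivWithinAt x (F t (x t)) (Icc 0 τ) t) → ‖x τ‖ ≤ R) :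
    ∃ x : ℝ → E, x 0 = x₀ ∧ ∀ t ∈ Icc 0 T, HasDerivWithinAt x (F t (x t)) (Icc 0 T) t := by
  -- On the degenerate interval [0, 0] a constant curve counts as a solution, so the a priori bound
  -- covers the initial value.
  have hx₀ : ‖x₀‖ ≤ R := hap 0 (left_mem_Icc.2 hT) (fun _ => x₀) rfl fun t _ => by
    rw [Icc_self]
    by_cases h : t = 0
    · subst h
      exact hasDerivWithinAt_iff_hasFDerivWithinAt.2 HasFDerivWithinAt.singleton
    · exact absurd (by simpa using ‹t ∈ Icc (0 : ℝ) 0›) h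
  have hR : 0 ≤ R := (norm_nonneg _).trans hx₀
  have hc0 : 0 < R + 1 := by linarith
  obtain ⟨L, hL0, hLip⟩ := hL (R + 1)
  obtain ⟨B₀, hB₀⟩ := isCompact_Icc.exists_bound_of_continuousOn (hc 0)
  have hB₀0 : 0 ≤ B₀ := (norm_nonneg _).trans (hB₀ 0 (left_mem_Icc.2 hT))
  set B : ℝ := B₀ + L * (R + 1) with hB
  have hB0 : 0 ≤ B := by positivity
  -- The retraction makes the field bounded by `B` and globally Lipschitz in space. Picard–Lindelöf
  -- on the ball of radius `B * T` then reaches time `T` in one step.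
  let G : ℝ → E → E := fun t x => F t (radial (R + 1) x)
  have hG : IsPicardLindelof G (⟨0, left_mem_Icc.2 hT⟩ : Icc (0 : ℝ) T) x₀
      ⟨B * T, by positivity⟩ 0 ⟨B, hB0⟩ ⟨L * 2, by positivity⟩ := by
    refine ⟨fun t ht => ?_, fun x _ => hc _, fun t ht x _ => ?_, ?_⟩
    · refine LipschitzOnWith.of_dist_le_mul fun x _ y _ => ?_
      rw [dist_eq_norm, dist_eq_norm]
      refine (hLip t ht _ _ (norm_radial_le hc0 _) (norm_radial_le hc0 _)).trans ?_
      change _ ≤ L * 2 * ‖x - y‖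
      rw [mul_assoc]
      exact mul_le_mul_of_nonneg_left (norm_radial_sub_le hc0 x y) hL0
    · change ‖F t (radial (R + 1) x)‖ ≤ B
      have h1 := hLip t ht (radial (R + 1) x) 0 (norm_radial_le hc0 _) (by simpa using hc0.le)
      rw [sub_zero] at h1
      have h2 : L * ‖radial (R + 1) x‖ ≤ L * (R + 1) :=
        mul_le_mul_of_nonneg_left (norm_radial_le hc0 _) hL0
      have h3 := norm_le_norm_add_norm_sub' (F t (radial (R + 1) x)) (F t 0)
      linarith [hB₀ t ht]
    · change B * max (T - 0) (0 - 0) ≤ B * T - 0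
      simp [hT]
  obtain ⟨α, hα0, hα⟩ := hG.exists_eq_forall_mem_Icc_hasDerivWithinAt₀
  have hα0' : α 0 = x₀ := hα0
  have hcont : ContinuousOn α (Icc 0 T) := fun t ht => (hα t ht).continuousWithinAt
  have hsol : ∀ τ ∈ Icc 0 T, (∀ u ∈ Icc 0 τ, ‖α u‖ ≤ R + 1) →
      ∀ t ∈ Icc 0 τ, HasDerivWithinAt α (F t (α t)) (Icc 0 τ) t := fun τ hτ hu t ht => by
    have h1 := (hα t ⟨ht.1, ht.2.trans hτ.2⟩).mono (Icc_subset_Icc_right hτ.2)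
    rwa [show G t (α t) = F t (α t) by
      change F t (radial (R + 1) (α t)) = _
      rw [radial_of_norm_le hc0 (hu t ht)]] at h1
  -- Up to the first time at which the norm reaches `R + 1`, the retraction acts trivially and the
  -- curve solves the original equation. The a priori bound `R` at that time is a contradiction.
  have hbd : ∀ t ∈ Icc 0 T, ‖α t‖ < R + 1 := by
    by_contra! hne
    have hK : IsCompact {t ∈ Icc 0 T | R + 1 ≤ ‖α t‖} := by
      refine isCompact_Icc.of_isClosed_subset ?_ (fun t ht => ht.1)
      exact hcont.norm.preimage_isClosed_of_isClosed isClosed_Icc isClosed_Ici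
    obtain ⟨t₁, ht₁, ht₁'⟩ := hne
    obtain ⟨τ, ⟨hτ, hτR⟩, hmin⟩ := hK.exists_isLeast ⟨t₁, ht₁, ht₁'⟩
    have hlt : ∀ u ∈ Ico 0 τ, ‖α u‖ ≤ R + 1 := fun u hu => by
      by_contra! h
      exact absurd (hmin ⟨⟨hu.1, hu.2.le.trans hτ.2⟩, h.le⟩) (not_le.2 hu.2)
    have hτ0 : 0 < τ := by
      rcases hτ.1.eq_or_lt with h | h
      · rw [← h, hα0'] at hτR
        linarith
      · exact h
    have hle : ‖α τ‖ ≤ R + 1 := by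
      have h1 : Tendsto (fun u => ‖α u‖) (𝓝[Ico 0 τ] τ) (𝓝 ‖α τ‖) :=
        ((hcont τ hτ).norm).mono (fun u hu => ⟨hu.1, hu.2.le.trans hτ.2⟩)
      have : (𝓝[Ico 0 τ] τ).NeBot := by
        rw [nhdsWithin_Ico_eq_nhdsLT hτ0]
        infer_instance
      exact le_of_tendsto h1 (eventually_mem_nhdsWithin.mono hlt)
    have := hap τ hτ α hα0' (hsol τ hτ fun u hu => by
      rcases hu.2.eq_or_lt with h | h
      · rwa [h]
      · exact hlt u ⟨hu.1, h⟩)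
    linarith
  exact ⟨α, hα0', hsol T (right_mem_Icc.2 hT) fun u hu => (hbd u hu).le⟩

/-- Solutions of `p' = q / 2`, `q' = κ p` in the bounded continuous functions. -/
theorem exists_linear_solution {κ : ℝ → BF} {T K : ℝ} (hT : 0 ≤ T)
    (hκ : ContinuousOn κ (Icc 0 T)) (hK : ∀ t ∈ Icc 0 T, ‖κ t‖ ≤ K)
    (p₀ q₀ : BF) : ∃ p q : ℝ → BF, p 0 = p₀ ∧ q 0 = q₀ ∧
      (∀ t ∈ Icc 0 T, HasDerivWithinAt p ((1 / 2 : ℝ) • q t) (Icc 0 T) t) ∧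
      (∀ t ∈ Icc 0 T, HasDerivWithinAt q (κ t * p t) (Icc 0 T) t) ∧
      ∀ t ∈ Icc 0 T, ‖p t‖ ≤ ‖(p₀, q₀)‖ * Real.exp ((1 + K) * T) ∧
        ‖q t‖ ≤ ‖(p₀, q₀)‖ * Real.exp ((1 + K) * T) := by
  have hK0 : 0 ≤ K := (norm_nonneg _).trans (hK 0 (left_mem_Icc.2 hT))
  have hb : ∀ t ∈ Icc 0 T, ∀ z : BF × BF, ‖(((1 / 2 : ℝ) • z.2, κ t * z.1) : BF × BF)‖ ≤
      (1 + K) * ‖z‖ := fun t ht z => by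
    have h1 := norm_fst_le z
    have h2 := norm_snd_le z
    refine norm_prod_le_iff.2 ⟨?_, ?_⟩
    · rw [norm_smul, Real.norm_of_nonneg (by norm_num)]
      nlinarith [norm_nonneg z, norm_nonneg z.2]
    · refine (norm_mul_le _ _).trans ?_
      have := mul_le_mul (hK t ht) h1 (norm_nonneg _) hK0
      linarith [norm_nonneg z]
  have hap : ∀ τ ∈ Icc 0 T, ∀ x : ℝ → BF × BF, x 0 = (p₀, q₀) →
      (∀ t ∈ Icc 0 τ, HasDerivWithinAt x ((1 / 2 : ℝ) • (x t).2, κ t * (x t).1) (Icc 0 τ) t) →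
      ∀ t ∈ Icc 0 τ, ‖x t‖ ≤ ‖(p₀, q₀)‖ * Real.exp ((1 + K) * T) :=
    fun τ hτ x hx0 hx t ht => by
      have := norm_le_of_deriv_le hx (fun t ht => hb t ⟨ht.1, ht.2.trans hτ.2⟩ (x t)) ht
      rw [hx0] at this
      refine this.trans (mul_le_mul_of_nonneg_left (Real.exp_le_exp.2 ?_) (norm_nonneg _))
      exact mul_le_mul_of_nonneg_left (ht.2.trans hτ.2) (by positivity)
  obtain ⟨x, hx0, hx⟩ := exists_solution_of_apriori (E := BF × BF)
    (F := fun t z => ((1 / 2 : ℝ) • z.2, κ t * z.1)) (T := T)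
    (R := ‖(p₀, q₀)‖ * Real.exp ((1 + K) * T)) hT (x₀ := (p₀, q₀))
    (fun r => ⟨1 + K, by positivity, fun t ht x y _ _ => by
      have := hb t ht (x - y)
      rw [Prod.fst_sub, Prod.snd_sub, smul_sub, mul_sub] at this
      exact this⟩)
    (fun x => continuousOn_const.prodMk (hκ.mul continuousOn_const))
    (fun τ hτ x hx0 hx => hap τ hτ x hx0 hx τ (right_mem_Icc.2 hτ.1))
  have hx' := hap T (right_mem_Icc.2 hT) x hx0 hx
  refine ⟨fun t => (x t).1, fun t => (x t).2, congrArg Prod.fst hx0, congrArg Prod.snd hx0,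
    fun t ht => ?_, fun t ht => ?_, fun t ht => ⟨(norm_fst_le _).trans (hx' t ht),
      (norm_snd_le _).trans (hx' t ht)⟩⟩
  · exact (ContinuousLinearMap.fst ℝ BF BF).hasFDerivAt.comp_hasDerivWithinAt t (hx t ht)
  · exact (ContinuousLinearMap.snd ℝ BF BF).hasFDerivAt.comp_hasDerivWithinAt t (hx t ht)

end ODE

/-! ## The invariant quadratic form -/

/-- `k` solves the system on `[0, τ]`. -/
def IsSol (τ : ℝ) (k : ℝ → Lag) : Prop :=
  ∀ t ∈ Icc 0 τ, HasDerivWithinAt k (field (k t)) (Icc 0 τ) t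

theorem IsSol.mono {τ σ : ℝ} {k : ℝ → Lag} (h : IsSol τ k) (hσ : σ ≤ τ) : IsSol σ k :=
  fun t ht => (h t ⟨ht.1, ht.2.trans hσ⟩).mono (Icc_subset_Icc_right hσ)

theorem IsSol.continuousOn {τ : ℝ} {k : ℝ → Lag} (h : IsSol τ k) : ContinuousOn k (Icc 0 τ) :=
  fun t ht => (h t ht).continuousWithinAt

theorem IsSol.clm {F : Type*} [NormedAddCommGroup F] [NormedSpace ℝ F] {τ : ℝ} {k : ℝ → Lag}
    (h : IsSol τ k) (A : Lag →L[ℝ] F) {t : ℝ} (ht : t ∈ Icc 0 τ) :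
    HasDerivWithinAt (fun s => A (k s)) (A (field (k t))) (Icc 0 τ) t :=
  A.hasFDerivAt.comp_hasDerivWithinAt t (h t ht)

/-- `U² - P` -/
def kap (k : Lag) : BF := cU k * cU k - pB k

/-- The weighted `y_ξ`. -/
def wα (k : Lag) : L2 := wtL + wt • dζ k

/-- The weighted `U_ξ`. -/
def wω (k : Lag) : L2 := wt • dU k

/-- The weighted `H_ξ - U² y_ξ`. -/
def wβ (k : Lag) : L2 := wt • dH k - (cU k * cU k) • wα k

theorem wt_pL (k : Lag) : wt • pL k = pB k • wtL :=
  (bsmul_wtL_eq_iff.2 (coeFn_pL k)).symm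

theorem wt_qL (k : Lag) : wt • qL k = qB k • wtL :=
  (bsmul_wtL_eq_iff.2 (coeFn_qL k)).symm

theorem wt_lU (k : Lag) : wt • lU k = cU k • wtL := (bsmul_wtL_eq_iff.2 (lU_ae k)).symm

/-- Turns the real scalar 1/2 into a constant function, so that all coefficients lie in `BF` and
`module` works over a single ring. -/
theorem half_bsmul : ∃ c : BF, (∀ y : L2, (1 / 2 : ℝ) • y = c • y) ∧
    (∀ b : BF, (1 / 2 : ℝ) • b = c * b) ∧ ∀ x : L2, c • x + c • x = x := by
  refine ⟨algebraMap ℝ BF (1 / 2), fun y => (algebraMap_smul BF _ y).symm,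
    fun b => BoundedContinuousFunction.ext fun x => rfl, fun x => ?_⟩
  rw [algebraMap_smul, ← add_smul]
  norm_num

theorem zero_bsmul (x : L2) : (0 : BF) • x = 0 := zero_smul BF x

/-- Here -Q_ξ = (U² y_ξ + H_ξ)/2 - P y_ξ, and substituting H_ξ = b + U² y_ξ gives b/2 + (U² - P)
y_ξ. The weight is present because y_ξ = 1 + ζ_ξ is not square integrable. -/
theorem wt_ndQ (k : Lag) : wt • ndQ k = (1 / 2 : ℝ) • wβ k + kap k • wα k := by
  have e : wt • ndQ k = (1 / 2 : ℝ) • (cU k • (wt • lU k) + (cU k * cU k) • wt • dζ k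
      + wt • dH k) - wt • pL k - pB k • wt • dζ k := by
    obtain ⟨c, hc, -, -⟩ := half_bsmul
    rw [ndQ, src, hc, hc]
    module
  obtain ⟨c, hc, -, hx⟩ := half_bsmul
  rw [e, wt_lU, wt_pL, wβ, wα, kap, hc, hc]
  linear_combination (norm := module) hx ((cU k * cU k) • (wtL + wt • dζ k))

theorem three_smul {M : Type*} [AddCommMonoid M] [Module ℝ M] (x : M) :
    (3 : ℝ) • x = x + x + x := by
  rw [show (3 : ℝ) = 2 + 1 by norm_num, add_smul, two_smul, one_smul]

theorem wt_tL (k : Lag) : wt • tL k = ((3 : ℝ) • (cU k * cU k) - (2 : ℝ) • pB k) • wω k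
    - (2 : ℝ) • (cU k * qB k) • wα k := by
  simp only [two_smul, three_smul]
  have e : wt • tL k = (3 : ℝ) • (cU k * cU k) • wt • dU k - (2 : ℝ) • cU k • wt • qL k
      - (2 : ℝ) • (qB k * cU k) • wt • dζ k - (2 : ℝ) • pB k • wt • dU k := by
    rw [tL]
    simp only [two_smul, three_smul]
    module
  rw [e, wt_qL, wα, wω]
  simp only [two_smul, three_smul]
  module

theorem HasDerivWithinAt.bsmul {b : ℝ → BF} {f : ℝ → L2} {b' : BF} {f' : L2} {s : Set ℝ} {t : ℝ}
    (hb : HasDerivWithinAt b b' s t) (hf : HasDerivWithinAt f f' s t) :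
    HasDerivWithinAt (fun t => b t • f t) (b t • f' + b' • f t) s t := hb.smul hf

variable {τ : ℝ} {k : ℝ → Lag}

theorem IsSol.hasDeriv_wα (h : IsSol τ k) {t : ℝ} (ht : t ∈ Icc 0 τ) :
    HasDerivWithinAt (fun s => wα (k s)) (wω (k t)) (Icc 0 τ) t := by
  have h1 := (HasDerivWithinAt.bsmul (hasDerivWithinAt_const t (Icc 0 τ) wt)
    (h.clm dζ ht)).const_add wtL
  exact h1.congr_deriv (by rw [zero_bsmul, add_zero]; rfl)

theorem IsSol.hasDeriv_wω (h : IsSol τ k) {t : ℝ} (ht : t ∈ Icc 0 τ) :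
    HasDerivWithinAt (fun s => wω (k s)) ((1 / 2 : ℝ) • wβ (k t) + kap (k t) • wα (k t))
      (Icc 0 τ) t := by
  have h1 := HasDerivWithinAt.bsmul (hasDerivWithinAt_const t (Icc 0 τ) wt) (h.clm dU ht)
  rw [← wt_ndQ]
  exact h1.congr_deriv (by rw [zero_bsmul, add_zero]; rfl)

/-- The terms with Q cancel: differentiating U² y_ξ with U_t = -Q compensates the term -2UQ y_ξ in
the time derivative of H_ξ. This is why H_ξ - U² y_ξ closes a linear system with y_ξ and U_ξ, with κ
as the only coefficient function. -/
theorem IsSol.hasDeriv_wβ (h : IsSol τ k) {t : ℝ} (ht : t ∈ Icc 0 τ) :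
    HasDerivWithinAt (fun s => wβ (k s)) ((2 : ℝ) • kap (k t) • wω (k t)) (Icc 0 τ) t := by
  have h1 := HasDerivWithinAt.bsmul (hasDerivWithinAt_const t (Icc 0 τ) wt) (h.clm dH ht)
  have h2 := (h.clm cU ht).mul (h.clm cU ht)
  refine (h1.sub (HasDerivWithinAt.bsmul h2 (h.hasDeriv_wα ht))).congr_deriv ?_
  change wt • tL (k t) + (0 : BF) • dH (k t) - ((cU (k t) * cU (k t)) • wω (k t) +
    (-qB (k t) * cU (k t) + cU (k t) * -qB (k t)) • wα (k t)) = _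
  rw [wt_tL, kap]
  simp only [two_smul, three_smul]
  module

/-- The polarisation of q²a - 2pqw + p²b. It is conserved because (a, w, b) solves the symmetric
square of the linear system satisfied by (p, q) and (r, s). -/
theorem IsSol.bilinear_const (h : IsSol τ k) {p q r s : ℝ → BF}
    (hp : ∀ t ∈ Icc 0 τ, HasDerivWithinAt p ((1 / 2 : ℝ) • q t) (Icc 0 τ) t)
    (hq : ∀ t ∈ Icc 0 τ, HasDerivWithinAt q (kap (k t) * p t) (Icc 0 τ) t)
    (hr : ∀ t ∈ Icc 0 τ, HasDerivWithinAt r ((1 / 2 : ℝ) • s t) (Icc 0 τ) t)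
    (hs : ∀ t ∈ Icc 0 τ, HasDerivWithinAt s (kap (k t) * r t) (Icc 0 τ) t)
    {t : ℝ} (ht : t ∈ Icc 0 τ) :
    (q t * s t) • wα (k t) - (p t * s t + q t * r t) • wω (k t) + (p t * r t) • wβ (k t) =
    (q 0 * s 0) • wα (k 0) - (p 0 * s 0 + q 0 * r 0) • wω (k 0) + (p 0 * r 0) • wβ (k 0) := by
  have hd : ∀ t ∈ Icc 0 τ, HasDerivWithinAt (fun t => (q t * s t) • wα (k t) -
      (p t * s t + q t * r t) • wω (k t) + (p t * r t) • wβ (k t)) (0 : L2) (Icc 0 τ) t :=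
    fun t ht => by
      refine (((HasDerivWithinAt.bsmul ((hq t ht).mul (hs t ht)) (h.hasDeriv_wα ht)).sub
        (HasDerivWithinAt.bsmul (((hp t ht).mul (hs t ht)).add ((hq t ht).mul (hr t ht)))
          (h.hasDeriv_wω ht))).add
        (HasDerivWithinAt.bsmul ((hp t ht).mul (hr t ht)) (h.hasDeriv_wβ ht))).congr_deriv ?_
      obtain ⟨c, hc, hc', hx⟩ := half_bsmul
      simp only [Pi.mul_apply, Pi.add_apply, hc, hc', two_smul]
      linear_combination (norm := module) -hx ((q t * s t) • wω (k t))
  exact constant_of_has_deriv_right_zero (fun t ht => (hd t ht).continuousWithinAt)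
    (fun t ht => HasDerivWithinAt.Ici_of_Icc (hd t (Ico_subset_Icc_self ht)) ht) t ht

theorem wronskian_const {κ p q r s : ℝ → BF}
    (hp : ∀ t ∈ Icc 0 τ, HasDerivWithinAt p ((1 / 2 : ℝ) • q t) (Icc 0 τ) t)
    (hq : ∀ t ∈ Icc 0 τ, HasDerivWithinAt q (κ t * p t) (Icc 0 τ) t)
    (hr : ∀ t ∈ Icc 0 τ, HasDerivWithinAt r ((1 / 2 : ℝ) • s t) (Icc 0 τ) t)
    (hs : ∀ t ∈ Icc 0 τ, HasDerivWithinAt s (κ t * r t) (Icc 0 τ) t)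
    {t : ℝ} (ht : t ∈ Icc 0 τ) : p t * s t - r t * q t = p 0 * s 0 - r 0 * q 0 := by
  have hd : ∀ t ∈ Icc 0 τ, HasDerivWithinAt (fun t => p t * s t - r t * q t) (0 : BF)
      (Icc 0 τ) t := fun t ht => by
    refine (((hp t ht).mul (hs t ht)).sub ((hr t ht).mul (hq t ht))).congr_deriv ?_
    rw [smul_mul_assoc, smul_mul_assoc, mul_comm (s t)]
    ring
  exact constant_of_has_deriv_right_zero (fun t ht => (hd t ht).continuousWithinAt)
    (fun t ht => HasDerivWithinAt.Ici_of_Icc (hd t (Ico_subset_Icc_self ht)) ht) t ht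

/-! ### Pointwise consequences -/

/-- `y_ξ` -/
def ya (k : Lag) (ξ : ℝ) : ℝ := dζ k ξ + 1

/-- `H_ξ - U² y_ξ` -/
def eb (k : Lag) (ξ : ℝ) : ℝ := dH k ξ - cU k ξ ^ 2 * ya k ξ

theorem coeFn_wα (k : Lag) : (wα k : ℝ → ℝ) =ᵐ[volume] fun ξ => wt ξ * ya k ξ := by
  filter_upwards [Lp.coeFn_add wtL (wt • dζ k), coeFn_bsmul wt (dζ k), coeFn_wtL] with ξ h1 h2 h3
  rw [wα, h1, Pi.add_apply, h2, h3, ya]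
  ring

theorem coeFn_wβ (k : Lag) : (wβ k : ℝ → ℝ) =ᵐ[volume] fun ξ => wt ξ * eb k ξ := by
  filter_upwards [Lp.coeFn_sub (wt • dH k) ((cU k * cU k) • wα k), coeFn_bsmul wt (dH k),
    coeFn_bsmul (cU k * cU k) (wα k), coeFn_wα k] with ξ h1 h2 h3 h4
  rw [wβ, h1, Pi.sub_apply, h2, h3, h4, eb, BoundedContinuousFunction.mul_apply]
  ring

theorem coeFn_form (k : Lag) (b₁ b₂ b₃ : BF) :
    (b₁ • wα k - b₂ • wω k + b₃ • wβ k : L2) =ᵐ[volume] fun ξ =>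
      wt ξ * (b₁ ξ * ya k ξ - b₂ ξ * dU k ξ + b₃ ξ * eb k ξ) := by
  filter_upwards [Lp.coeFn_add (b₁ • wα k - b₂ • wω k) (b₃ • wβ k),
    Lp.coeFn_sub (b₁ • wα k) (b₂ • wω k), coeFn_bsmul b₁ (wα k), coeFn_bsmul b₂ (wω k),
    coeFn_bsmul b₃ (wβ k), coeFn_wα k, coeFn_wβ k, coeFn_bsmul wt (dU k)]
    with ξ h1 h2 h3 h4 h5 h6 h7 h8
  rw [h1, Pi.add_apply, h2, Pi.sub_apply, h3, h4, h5, h6, h7, wω, h8]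
  ring

/-- The two solutions starting from (1, 0) and (0, 1) have Wronskian one. Evaluating the three
conserved forms at time 0 leaves exactly the initial entries b, a and -w, and the entries of the
matrix are bounded by Grönwall's inequality. -/
theorem IsSol.exists_matrix (h : IsSol τ k) {K : ℝ} (hK : ∀ t ∈ Icc 0 τ, ‖kap (k t)‖ ≤ K)
    {t : ℝ} (ht : t ∈ Icc 0 τ) : ∃ p q r s : BF, (∀ ξ, p ξ * s ξ - r ξ * q ξ = 1) ∧
      (∀ ξ, |p ξ| ≤ Real.exp ((1 + K) * τ) ∧ |q ξ| ≤ Real.exp ((1 + K) * τ) ∧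
        |r ξ| ≤ Real.exp ((1 + K) * τ) ∧ |s ξ| ≤ Real.exp ((1 + K) * τ)) ∧
      ∀ᵐ ξ, q ξ ^ 2 * ya (k t) ξ - 2 * p ξ * q ξ * dU (k t) ξ + p ξ ^ 2 * eb (k t) ξ =
          eb (k 0) ξ ∧
        s ξ ^ 2 * ya (k t) ξ - 2 * r ξ * s ξ * dU (k t) ξ + r ξ ^ 2 * eb (k t) ξ =
          ya (k 0) ξ ∧
        q ξ * s ξ * ya (k t) ξ - (p ξ * s ξ + q ξ * r ξ) * dU (k t) ξ +
          p ξ * r ξ * eb (k t) ξ = -dU (k 0) ξ := by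
  have hτ : 0 ≤ τ := ht.1.trans ht.2
  have hc : ContinuousOn (fun t => kap (k t)) (Icc 0 τ) := by
    have h1 : ContinuousOn (fun t => cU (k t)) (Icc 0 τ) :=
      cU.continuous.comp_continuousOn h.continuousOn
    exact (h1.mul h1).sub (locLip_pq.1.continuous.comp_continuousOn h.continuousOn)
  have n1 : ‖((1 : BF), (0 : BF))‖ = 1 := by rw [Prod.norm_mk]; simp
  have n2 : ‖((0 : BF), (1 : BF))‖ = 1 := by rw [Prod.norm_mk]; simp
  obtain ⟨p, q, hp0, hq0, hp, hq, hb⟩ := exists_linear_solution hτ hc hK 1 0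
  obtain ⟨r, s, hr0, hs0, hr, hs, hb'⟩ := exists_linear_solution hτ hc hK 0 1
  rw [n1, one_mul] at hb
  rw [n2, one_mul] at hb'
  refine ⟨p t, q t, r t, s t, fun ξ => ?_, fun ξ => ⟨((p t).abs_le ξ).trans (hb t ht).1,
    ((q t).abs_le ξ).trans (hb t ht).2, ((r t).abs_le ξ).trans (hb' t ht).1,
    ((s t).abs_le ξ).trans (hb' t ht).2⟩, ?_⟩
  · have := wronskian_const hp hq hr hs ht
    rw [hp0, hq0, hr0, hs0] at this
    have := congrArg (fun b : BF => b ξ) this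
    simpa using this
  · have e1 := h.bilinear_const hp hq hp hq ht
    have e2 := h.bilinear_const hr hs hr hs ht
    have e3 := h.bilinear_const hp hq hr hs ht
    have key : ∀ {b₁ b₂ b₃ c₁ c₂ c₃ : BF}, b₁ • wα (k t) - b₂ • wω (k t) + b₃ • wβ (k t) =
        c₁ • wα (k 0) - c₂ • wω (k 0) + c₃ • wβ (k 0) → ∀ᵐ ξ,
        b₁ ξ * ya (k t) ξ - b₂ ξ * dU (k t) ξ + b₃ ξ * eb (k t) ξ =
        c₁ ξ * ya (k 0) ξ - c₂ ξ * dU (k 0) ξ + c₃ ξ * eb (k 0) ξ := fun {b₁ b₂ b₃ c₁ c₂ c₃} e => by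
      have f1 := coeFn_form (k t) b₁ b₂ b₃
      rw [e] at f1
      filter_upwards [f1, coeFn_form (k 0) c₁ c₂ c₃] with ξ g1 g2
      rw [g2] at g1
      exact (mul_left_cancel₀ (wt_pos ξ).ne' g1).symm
    filter_upwards [key e1, key e2, key e3] with ξ g1 g2 g3
    simp only [hp0, hq0, hr0, hs0, BoundedContinuousFunction.mul_apply,
      BoundedContinuousFunction.add_apply, BoundedContinuousFunction.coe_one,
      BoundedContinuousFunction.coe_zero, Pi.one_apply, Pi.zero_apply] at g1 g2 g3
    refine ⟨by linarith, by linarith, by linarith⟩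

/-- The pointwise constraints on the derivatives of Lagrangian data. -/
def Adm (a w b : ℝ) : Prop := 0 ≤ a ∧ 0 ≤ b ∧ 0 < a + b ∧ a * b = w ^ 2

/-- Multiplied by a, the form is the square (xa - yw)²; when a = 0, the relation ab = w² forces w =
0. -/
theorem form_nonneg {a w b : ℝ} (ha : 0 ≤ a) (hb : 0 ≤ b) (hw : a * b = w ^ 2) (x y : ℝ) :
    0 ≤ x ^ 2 * a - 2 * x * y * w + y ^ 2 * b := by
  rcases ha.eq_or_lt with h | h
  · have : w = 0 := by
      rw [← h, zero_mul] at hw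
      exact pow_eq_zero_iff two_ne_zero |>.1 hw.symm
    rw [this, ← h]
    nlinarith [mul_nonneg (sq_nonneg y) hb]
  · refine (mul_nonneg_iff_of_pos_left h).1 ?_
    have : a * (x ^ 2 * a - 2 * x * y * w + y ^ 2 * b) = (x * a - y * w) ^ 2 := by
      linear_combination y ^ 2 * hw
    rw [this]
    exact sq_nonneg _

/-- Adding the value at (x, -y), which is also nonnegative, cancels the cross term. -/
theorem form_le {a w b : ℝ} (ha : 0 ≤ a) (hb : 0 ≤ b) (hw : a * b = w ^ 2) {x y C : ℝ}
    (hx : |x| ≤ C) (hy : |y| ≤ C) : x ^ 2 * a - 2 * x * y * w + y ^ 2 * b ≤ 2 * C ^ 2 * (a + b) := by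
  have h1 := form_nonneg ha hb hw x (-y)
  have h2 : x ^ 2 ≤ C ^ 2 := sq_le_sq' (by linarith [neg_abs_le x]) ((le_abs_self x).trans hx)
  have h3 : y ^ 2 ≤ C ^ 2 := sq_le_sq' (by linarith [neg_abs_le y]) ((le_abs_self y).trans hy)
  have h4 := mul_le_mul_of_nonneg_right h2 ha
  have h5 := mul_le_mul_of_nonneg_right h3 hb
  have h6 := mul_nonneg (sq_nonneg C) ha
  have h7 := mul_nonneg (sq_nonneg C) hb
  nlinarith

/-- The hypotheses say that the initial matrix is congruent, through a matrix of determinant one, to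
the one at time t. Inverting the congruence gives nonnegativity of a and b, the determinant is
invariant, and `form_le` in both directions bounds a + b, each of the two diagonal entries
contributing 2C². -/
theorem Adm.transport {a w b a₀ w₀ b₀ p q r s C : ℝ} (h₀ : Adm a₀ w₀ b₀)
    (hW : p * s - r * q = 1) (hp : |p| ≤ C) (hq : |q| ≤ C) (hr : |r| ≤ C) (hs : |s| ≤ C)
    (h1 : q ^ 2 * a - 2 * p * q * w + p ^ 2 * b = b₀)
    (h2 : s ^ 2 * a - 2 * r * s * w + r ^ 2 * b = a₀)
    (h3 : q * s * a - (p * s + q * r) * w + p * r * b = -w₀) :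
    Adm a w b ∧ a + b ≤ 4 * C ^ 2 * (a₀ + b₀) ∧ a₀ + b₀ ≤ 4 * C ^ 2 * (a + b) := by
  obtain ⟨ha, hb, hab, hw⟩ := h₀
  have ea : a = p ^ 2 * a₀ - 2 * p * (-r) * w₀ + (-r) ^ 2 * b₀ := by
    rw [← h1, ← h2, show w₀ = -(-w₀) by ring, ← h3]
    linear_combination (-(p * s - r * q) - 1) * a * hW
  have eb : b = q ^ 2 * a₀ - 2 * q * (-s) * w₀ + (-s) ^ 2 * b₀ := by
    rw [← h1, ← h2, show w₀ = -(-w₀) by ring, ← h3]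
    linear_combination (-(p * s - r * q) - 1) * b * hW
  have ew : a * b = w ^ 2 := by
    have : (a * b - w ^ 2) * (p * s - r * q) ^ 2 = a₀ * b₀ - w₀ ^ 2 := by
      rw [← h1, ← h2, show w₀ ^ 2 = (-w₀) ^ 2 by ring, ← h3]
      ring
    rw [hW, hw] at this
    linarith
  have ha' : 0 ≤ a := by
    rw [ea]
    exact form_nonneg ha hb hw _ _
  have hb' : 0 ≤ b := by
    rw [eb]
    exact form_nonneg ha hb hw _ _
  have l1 := form_le ha hb hw hp ((abs_neg r).trans_le hr)
  have l2 := form_le ha hb hw hq ((abs_neg s).trans_le hs)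
  have l3 := form_le ha' hb' ew hq hp
  have l4 := form_le ha' hb' ew hs hr
  have u : a₀ + b₀ ≤ 4 * C ^ 2 * (a + b) := by linarith
  refine ⟨⟨ha', hb', ?_, ew⟩, by linarith, u⟩
  by_contra! hn
  have h0 : a + b = 0 := le_antisymm hn (add_nonneg ha' hb')
  rw [h0, mul_zero] at u
  linarith

theorem IsSol.adm (h : IsSol τ k) {K : ℝ} (hK : ∀ t ∈ Icc 0 τ, ‖kap (k t)‖ ≤ K)
    (h₀ : ∀ᵐ ξ, Adm (ya (k 0) ξ) (dU (k 0) ξ) (eb (k 0) ξ)) {t : ℝ} (ht : t ∈ Icc 0 τ) :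
    ∀ᵐ ξ, Adm (ya (k t) ξ) (dU (k t) ξ) (eb (k t) ξ) ∧
      ya (k t) ξ + eb (k t) ξ ≤
        4 * Real.exp ((1 + K) * τ) ^ 2 * (ya (k 0) ξ + eb (k 0) ξ) ∧
      ya (k 0) ξ + eb (k 0) ξ ≤
        4 * Real.exp ((1 + K) * τ) ^ 2 * (ya (k t) ξ + eb (k t) ξ) := by
  obtain ⟨p, q, r, s, hW, hb, hae⟩ := h.exists_matrix hK ht
  filter_upwards [hae, h₀] with ξ h1 h2
  obtain ⟨b1, b2, b3, b4⟩ := hb ξ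
  exact h2.transport (hW ξ) b1 b2 b3 b4 h1.1 h1.2.1 h1.2.2

/-! ## Lagrangian data with bounded energy -/

theorem IsPrimitive.monotone {f g : ℝ → ℝ} (h : IsPrimitive f g) (hg : ∀ᵐ x, 0 ≤ g x) :
    Monotone f := fun a b hab => by
  rw [h.eq_add a b, le_add_iff_nonneg_right]
  exact intervalIntegral.integral_nonneg_of_ae hab hg

/-! ### Behaviour at spatial infinity -/

/-- An integrable function with integrable derivative vanishes at infinity. -/
theorem IsPrimitive.tendsto_cocompact {f g : ℝ → ℝ} (h : IsPrimitive f g) (hf : Integrable f)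
    (hg : Integrable g) : Tendsto f (cocompact ℝ) (𝓝 0) := by
  have key : ∀ l : Filter ℝ, (∀ s ∈ l, volume s = ⊤) → (∃ c, Tendsto f l (𝓝 c)) →
      Tendsto f l (𝓝 0) := fun l hl ⟨c, hc⟩ => by
    have := IntegrableAtFilter.eq_zero_of_tendsto (μ := volume)
      ⟨univ, univ_mem, hf.integrableOn⟩ hl hc
    rwa [this] at hc
  have e : f = fun x => f 0 + ∫ t in (0 : ℝ)..x, g t := funext fun x => h.eq_add 0 x
  have e' : f = fun x => f 0 - ∫ t in x..(0 : ℝ), g t := by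
    funext x
    rw [intervalIntegral.integral_symm, sub_neg_eq_add, ← h.eq_add]
  rw [cocompact_eq_atBot_atTop, tendsto_sup]
  constructor
  · refine key _ (fun s hs => ?_) ⟨f 0 - ∫ t in Iic (0 : ℝ), g t, ?_⟩
    · obtain ⟨b, hb⟩ := mem_atBot_sets.1 hs
      rw [← top_le_iff, ← Real.volume_Iic (a := b)]
      exact measure_mono hb
    · refine Tendsto.congr (fun x => (congrFun e' x).symm) ?_
      exact tendsto_const_nhds.sub
        (by simpa using intervalIntegral_tendsto_integral_Iic 0 hg.integrableOn tendsto_id)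
  · refine key _ (fun s hs => ?_) ⟨f 0 + ∫ t in Ioi (0 : ℝ), g t, ?_⟩
    · obtain ⟨b, hb⟩ := mem_atTop_sets.1 hs
      rw [← top_le_iff, ← Real.volume_Ici (a := b)]
      exact measure_mono hb
    · refine Tendsto.congr (fun x => (congrFun e x).symm) ?_
      exact tendsto_const_nhds.add
        (by simpa using intervalIntegral_tendsto_integral_Ioi 0 hg.integrableOn tendsto_id)

/-- Both U² and its derivative 2UU_ξ are integrable, so U² vanishes at infinity. -/
theorem tendsto_U (k : Lag) : Tendsto (cU k) (cocompact ℝ) (𝓝 0) := by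
  have h1 : MemLp (cU k) 2 := (memLp_congr_ae (lU_ae k)).1 (Lp.memLp (lU k))
  have h2 := h1.integrable_mul (Lp.memLp (dU k))
  have h := (isPrimitive_U k).mul (isPrimitive_U k)
  have := h.tendsto_cocompact (h1.integrable_mul h1)
    ((h2.congr (ae_of_all _ fun x => mul_comm _ _)).add h2)
  have h3 := this.sqrt
  rw [Real.sqrt_zero] at h3
  refine (tendsto_zero_iff_abs_tendsto_zero _).2 (h3.congr fun x => ?_)
  exact Real.sqrt_mul_self_eq_abs _

theorem tendsto_tB (k : Lag) : Tendsto (tB k) (cocompact ℝ) (𝓝 0) := by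
  have h := (tendsto_U k).norm.const_mul (‖cU k‖ * ‖cU k‖ + 2 * ‖pB k‖)
  rw [norm_zero, mul_zero] at h
  refine squeeze_zero_norm (fun x => ?_) h
  have e : tB k x = (cU k x * cU k x - 2 * pB k x) * cU k x := by
    change cU k x * (cU k x * cU k x) - 2 * (pB k x * cU k x) = _
    ring
  rw [e, norm_mul]
  refine mul_le_mul_of_nonneg_right ?_ (norm_nonneg _)
  refine (norm_sub_le _ _).trans (add_le_add ?_ ?_)
  · rw [norm_mul]
    exact mul_le_mul ((cU k).norm_coe_le_norm x) ((cU k).norm_coe_le_norm x) (norm_nonneg _)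
      (norm_nonneg _)
  · rw [norm_mul, Real.norm_ofNat]
    exact mul_le_mul_of_nonneg_left ((pB k).norm_coe_le_norm x) two_pos.le

/-- The bounded continuous functions vanishing at infinity. -/
def vanishing : Submodule ℝ BF where
  carrier := {b | Tendsto b (cocompact ℝ) (𝓝 0)}
  zero_mem' := tendsto_const_nhds
  add_mem' := fun {a b} ha hb => by
    have := Tendsto.add ha hb
    rwa [add_zero] at this
  smul_mem' := fun c b hb => by
    have := Tendsto.const_mul c hb
    rwa [mul_zero] at this

instance : IsClosed (vanishing : Set BF) := by
  convert ZeroAtInftyContinuousMap.isClosed_range_toBCF (α := ℝ) (β := ℝ) using 1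
  ext b
  constructor
  · intro h
    exact ⟨⟨b.toContinuousMap, h⟩, rfl⟩
  · rintro ⟨f, rfl⟩
    exact f.zero_at_infty'

/-- In the quotient by the closed subspace the curve has zero derivative, hence is constant. -/
theorem mem_of_hasDeriv {E : Type*} [NormedAddCommGroup E] [NormedSpace ℝ E] (Z : Submodule ℝ E)
    [IsClosed (Z : Set E)] {f f' : ℝ → E} {τ : ℝ}
    (hf : ∀ t ∈ Icc 0 τ, HasDerivWithinAt f (f' t) (Icc 0 τ) t) (hf' : ∀ t ∈ Icc 0 τ, f' t ∈ Z)
    {t : ℝ} (ht : t ∈ Icc 0 τ) : f t - f 0 ∈ Z := by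
  have hd : ∀ t ∈ Icc 0 τ, HasDerivWithinAt (fun t => Z.mkQL (f t)) 0 (Icc 0 τ) t :=
    fun t ht => by
      refine ((Z.mkQL : E →L[ℝ] E ⧸ Z).hasFDerivAt.comp_hasDerivWithinAt t
        (hf t ht)).congr_deriv ?_
      exact (Submodule.Quotient.mk_eq_zero Z).2 (hf' t ht)
  have := constant_of_has_deriv_right_zero (fun t ht => (hd t ht).continuousWithinAt)
    (fun t ht => HasDerivWithinAt.Ici_of_Icc (hd t (Ico_subset_Icc_self ht)) ht) t ht
  exact (Submodule.Quotient.eq Z).1 this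

theorem IsSol.tendsto_H {τ : ℝ} {k : ℝ → Lag} (h : IsSol τ k) {t : ℝ} (ht : t ∈ Icc 0 τ) :
    Tendsto (fun ξ => cH (k t) ξ - cH (k 0) ξ) (cocompact ℝ) (𝓝 0) :=
  mem_of_hasDeriv vanishing (fun _ ht => h.clm cH ht) (fun t _ => tendsto_tB (k t)) ht

/-- Elements of `𝒢` whose energy is at most `M`. -/
structure Data (M : ℝ) (k : Lag) : Prop where
  adm : ∀ᵐ ξ, Adm (ya k ξ) (dU k ξ) (eb k ξ)
  bdd : ∃ B, ∀ᵐ ξ, ya k ξ + eb k ξ ≤ B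
  bot : Tendsto (cH k) atBot (𝓝 0)
  le : ∀ ξ, cH k ξ ≤ M

namespace Data

variable {M : ℝ} {k : Lag}

theorem dH_eq (k : Lag) (ξ : ℝ) : dH k ξ = eb k ξ + cU k ξ ^ 2 * ya k ξ := by
  rw [eb]
  ring

/-- Everything follows from H_ξ = b + U² y_ξ; the last inequality is the nonnegativity of the
quadratic form at (U, 1) and (U, -1). -/
theorem ae_nonneg (h : Data M k) : ∀ᵐ ξ, 0 ≤ ya k ξ ∧ 0 ≤ dH k ξ ∧
    cU k ξ ^ 2 * ya k ξ ≤ dH k ξ ∧ 2 * |cU k ξ * dU k ξ| ≤ dH k ξ := by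
  filter_upwards [h.adm] with ξ ⟨ha, hb, _, hw⟩
  have h1 := mul_nonneg (sq_nonneg (cU k ξ)) ha
  refine ⟨ha, ?_, ?_, ?_⟩
  · rw [dH_eq]
    positivity
  · rw [dH_eq]
    linarith
  · rw [dH_eq, ← abs_two, ← abs_mul, abs_le]
    have h2 := form_nonneg ha hb hw (cU k ξ) 1
    have h3 := form_nonneg ha hb hw (cU k ξ) (-1)
    constructor <;> nlinarith

theorem mono_y (h : Data M k) : Monotone (yk k) :=
  (isPrimitive_yk k).monotone (h.ae_nonneg.mono fun _ h => h.1)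

theorem mono_H (h : Data M k) : Monotone (cH k) :=
  (isPrimitive_H k).monotone (h.ae_nonneg.mono fun _ h => h.2.1)

theorem H_nonneg (h : Data M k) (ξ : ℝ) : 0 ≤ cH k ξ :=
  h.mono_H.le_of_tendsto h.bot ξ

theorem nonneg (h : Data M k) : 0 ≤ M := (h.H_nonneg 0).trans (h.le 0)

/-- The function H - U² is nondecreasing, since 2|UU_ξ| ≤ H_ξ, and tends to 0 at -∞. -/
theorem sq_U_le (h : Data M k) (ξ : ℝ) : cU k ξ ^ 2 ≤ cH k ξ := by
  have h1 := (isPrimitive_H k).sub ((isPrimitive_U k).mul (isPrimitive_U k))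
  have h2 := h1.monotone (by
    filter_upwards [h.ae_nonneg] with ξ h
    have := (abs_le.1 (le_refl |cU k ξ * dU k ξ|)).2
    linarith [h.2.2.2])
  have h3 : Tendsto (cU k) atBot (𝓝 0) :=
    (tendsto_U k).mono_left (by rw [cocompact_eq_atBot_atTop]; exact le_sup_left)
  have h4 := h2.le_of_tendsto (h.bot.sub (h3.mul h3)) ξ
  simp only [mul_zero, sub_zero] at h4
  nlinarith

theorem norm_U_le (h : Data M k) : ‖cU k‖ ≤ Real.sqrt M := by
  refine (BoundedContinuousFunction.norm_le (Real.sqrt_nonneg _)).2 fun ξ => ?_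
  exact Real.abs_le_sqrt ((h.sq_U_le ξ).trans (h.le ξ))

theorem norm_H_le (h : Data M k) : ‖cH k‖ ≤ M := by
  refine (BoundedContinuousFunction.norm_le h.nonneg).2 fun ξ => ?_
  rw [Real.norm_of_nonneg (h.H_nonneg ξ)]
  exact h.le ξ

theorem src_ae (h : Data M k) : ∀ᵐ ξ, 0 ≤ src k ξ ∧ src k ξ ≤ 2 * dH k ξ := by
  filter_upwards [h.ae_nonneg, coeFn_src k] with ξ h1 h2
  rw [h2]
  change 0 ≤ cU k ξ ^ 2 * ya k ξ + dH k ξ ∧ cU k ξ ^ 2 * ya k ξ + dH k ξ ≤ _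
  constructor
  · have := mul_nonneg (sq_nonneg (cU k ξ)) h1.1
    linarith [h1.2.1]
  · linarith [h1.2.2.1]

/-- The total increase of H is at most M, so anything dominated by C·H_ξ integrates to at most CM on
every interval. This is the source of bounds depending on M alone. -/
theorem interval_le (h : Data M k) {f : ℝ → ℝ} {C a b : ℝ} (hab : a ≤ b) (hC : 0 ≤ C)
    (hf : IntervalIntegrable f volume a b) (hle : ∀ᵐ ξ, ξ ∈ Ioc a b → f ξ ≤ C * dH k ξ) :
    ∫ ξ in a..b, f ξ ≤ C * M := by
  have h1 : ∫ ξ in a..b, f ξ ≤ ∫ ξ in a..b, C * dH k ξ := by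
    rw [intervalIntegral.integral_of_le hab, intervalIntegral.integral_of_le hab]
    refine setIntegral_mono_on_ae hf.1 (((isPrimitive_H k).intervalIntegrable a b).const_mul C).1
      measurableSet_Ioc hle
  rw [intervalIntegral.integral_const_mul, (isPrimitive_H k).integral_eq] at h1
  refine h1.trans (mul_le_mul_of_nonneg_left ?_ hC)
  linarith [h.H_nonneg a, h.le b]

theorem kerL_mem (h : Data M k) (ξ : ℝ) : kerL (yk k) (src k) ξ ∈ Icc 0 (2 * M) := by
  constructor
  · refine integral_nonneg_of_ae (ae_restrict_of_ae (h.src_ae.mono fun η h => ?_))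
    exact mul_nonneg (Real.exp_pos _).le h.1
  · have hi := (kerL_bound (isPrimitive_yk k).continuous (abs_yk_sub_le k le_rfl)
      (Lp.memLp (src k)) ξ).1
    refine le_of_tendsto (intervalIntegral_tendsto_integral_Iic ξ hi tendsto_id) ?_
    filter_upwards [eventually_le_atBot ξ] with a ha
    refine h.interval_le ha two_pos.le ?_ ?_
    · rw [id, intervalIntegrable_iff_integrableOn_Ioc_of_le ha]
      exact hi.mono_set fun x hx => hx.2
    · filter_upwards [h.src_ae] with η h1 hη
      refine le_trans ?_ h1.2
      exact mul_le_of_le_one_left h1.1 (Real.exp_le_one_iff.2 (sub_nonpos.2 (h.mono_y hη.2)))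

theorem kerR_mem (h : Data M k) (ξ : ℝ) : kerR (yk k) (src k) ξ ∈ Icc 0 (2 * M) := by
  constructor
  · refine integral_nonneg_of_ae (ae_restrict_of_ae (h.src_ae.mono fun η h => ?_))
    exact mul_nonneg (Real.exp_pos _).le h.1
  · have hi := (kerR_bound (isPrimitive_yk k).continuous (abs_yk_sub_le k le_rfl)
      (Lp.memLp (src k)) ξ).1
    refine le_of_tendsto (intervalIntegral_tendsto_integral_Ioi ξ hi tendsto_id) ?_
    filter_upwards [eventually_ge_atTop ξ] with a ha
    refine h.interval_le ha two_pos.le ?_ ?_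
    · rw [id, intervalIntegrable_iff_integrableOn_Ioc_of_le ha]
      exact hi.mono_set fun x hx => hx.1
    · filter_upwards [h.src_ae] with η h1 hη
      refine le_trans ?_ h1.2
      exact mul_le_of_le_one_left h1.1 (Real.exp_le_one_iff.2 (sub_nonpos.2 (h.mono_y hη.1.le)))

theorem norm_p_le (h : Data M k) : ‖pB k‖ ≤ M := by
  refine (BoundedContinuousFunction.norm_le h.nonneg).2 fun ξ => ?_
  have h1 := h.kerL_mem ξ
  have h2 := h.kerR_mem ξ
  change |pF k ξ| ≤ M
  rw [pF, abs_le]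
  constructor <;> linarith [h1.1, h1.2, h2.1, h2.2, h.nonneg]

theorem norm_q_le (h : Data M k) : ‖qB k‖ ≤ M := by
  refine (BoundedContinuousFunction.norm_le h.nonneg).2 fun ξ => ?_
  have h1 := h.kerL_mem ξ
  have h2 := h.kerR_mem ξ
  change |qF k ξ| ≤ M
  rw [qF, abs_le]
  constructor <;> linarith [h1.1, h1.2, h2.1, h2.2, h.nonneg]

theorem norm_kap_le (h : Data M k) : ‖kap k‖ ≤ 2 * M := by
  refine (norm_sub_le _ _).trans ?_
  have h1 : ‖cU k * cU k‖ ≤ M := (norm_mul_le _ _).trans ((mul_le_mul h.norm_U_le h.norm_U_le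
    (norm_nonneg _) (Real.sqrt_nonneg _)).trans (Real.mul_self_sqrt h.nonneg).le)
  linarith [h.norm_p_le]

theorem sq_norm_le (h : Data M k) {f : L2} {C : ℝ} (hC : 0 ≤ C)
    (hf : ∀ᵐ ξ, f ξ ^ 2 ≤ C * dH k ξ) : ‖f‖ ^ 2 ≤ C * M := by
  have hi : Integrable fun ξ => (f : ℝ → ℝ) ξ ^ 2 := (Lp.memLp f).integrable_sq
  have e : ‖f‖ ^ 2 = ∫ ξ, (f : ℝ → ℝ) ξ ^ 2 := by
    rw [L2.norm_eq, lpNorm_two_sq (Lp.aestronglyMeasurable f)]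
  rw [e]
  refine le_of_tendsto (intervalIntegral_tendsto_integral hi tendsto_neg_atTop_atBot tendsto_id) ?_
  filter_upwards [eventually_ge_atTop 0] with a ha
  exact h.interval_le (neg_le_self ha |>.trans le_rfl) hC hi.intervalIntegrable
    (hf.mono fun ξ h _ => h)

end Data

/-! ### Propagation of the constraints, a priori bounds and global existence -/

variable {τ M : ℝ} {k : ℝ → Lag}

/-- The bound on H survives because H(t) is nondecreasing in ξ and H(t) - H(0) tends to 0 at +∞; the
limit at -∞ is kept for the same reason. -/
theorem IsSol.data (h : IsSol τ k) (h₀ : Data M (k 0)) {t : ℝ} (ht : t ∈ Icc 0 τ) :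
    Data M (k t) := by
  have hc : ContinuousOn (fun t => kap (k t)) (Icc 0 τ) := by
    have h1 : ContinuousOn (fun t => cU (k t)) (Icc 0 τ) :=
      cU.continuous.comp_continuousOn h.continuousOn
    exact (h1.mul h1).sub (locLip_pq.1.continuous.comp_continuousOn h.continuousOn)
  -- This bound on κ depends on the solution. Only after the constraints are known to persist can it
  -- be replaced by 2M, as in `IsSol.adm_le`.
  obtain ⟨K, hK⟩ := isCompact_Icc.exists_bound_of_continuousOn hc
  have had := h.adm hK h₀.adm ht
  have hH : Monotone (cH (k t)) := (isPrimitive_H (k t)).monotone (by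
    filter_upwards [had] with ξ ⟨⟨ha, hb, _, _⟩, _⟩
    rw [Data.dH_eq]
    positivity)
  have hT := h.tendsto_H ht
  rw [cocompact_eq_atBot_atTop, tendsto_sup] at hT
  refine ⟨had.mono fun _ h => h.1, ?_, ?_, fun ξ => ?_⟩
  · obtain ⟨B, hB⟩ := h₀.bdd
    refine ⟨4 * Real.exp ((1 + K) * τ) ^ 2 * B, ?_⟩
    filter_upwards [had, hB] with ξ h1 h2
    exact h1.2.1.trans (mul_le_mul_of_nonneg_left h2 (by positivity))
  · have := hT.1.add h₀.bot
    simpa using this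
  · have h1 := hT.2.add_const M
    rw [zero_add] at h1
    refine ge_of_tendsto h1 ?_
    filter_upwards [eventually_ge_atTop ξ] with η hη
    linarith [hH hη, h₀.le η]

theorem IsSol.adm_le (h : IsSol τ k) (h₀ : Data M (k 0)) {t : ℝ} (ht : t ∈ Icc 0 τ) :
    ∀ᵐ ξ, ya (k t) ξ + eb (k t) ξ ≤
        4 * Real.exp ((1 + 2 * M) * τ) ^ 2 * (ya (k 0) ξ + eb (k 0) ξ) ∧
      ya (k 0) ξ + eb (k 0) ξ ≤
        4 * Real.exp ((1 + 2 * M) * τ) ^ 2 * (ya (k t) ξ + eb (k t) ξ) :=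
  (h.adm (fun _ ht => (h.data h₀ ht).norm_kap_le) h₀.adm ht).mono fun _ h => h.2

theorem IsSol.norm_ζ_le (h : IsSol τ k) (h₀ : Data M (k 0)) {t : ℝ} (ht : t ∈ Icc 0 τ) :
    ‖cζ (k t)‖ ≤ ‖cζ (k 0)‖ + Real.sqrt M * t := by
  have := norm_image_sub_le_of_norm_deriv_right_le_segment (f := fun t => cζ (k t))
    (f' := fun t => cU (k t)) (C := Real.sqrt M) (a := 0) (b := τ)
    (cζ.continuous.comp_continuousOn h.continuousOn)
    (fun t ht => HasDerivWithinAt.Ici_of_Icc (h.clm cζ (Ico_subset_Icc_self ht)) ht)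
    (fun t ht => (h.data h₀ (Ico_subset_Icc_self ht)).norm_U_le) t ht
  rw [sub_zero] at this
  linarith [norm_le_norm_add_norm_sub' (cζ (k t)) (cζ (k 0))]

theorem exists_norm_bound (M R T : ℝ) (hM : 0 ≤ M) (hT : 0 ≤ T) : ∃ R', ∀ τ ≤ T, ∀ k : ℝ → Lag,
    IsSol τ k → Data M (k 0) → ‖k 0‖ ≤ R → ∀ t ∈ Icc 0 τ, ‖k t‖ ≤ R' := by
  -- A common bound for ζ, which moves at speed at most √M, for U, bounded by √M, and for P and Q,
  -- bounded by M.
  set A := |R| + Real.sqrt M * T + Real.sqrt M + M with hA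
  have hA0 : 0 ≤ A := by positivity
  have hs := Real.sqrt_nonneg M
  obtain ⟨L, hL0, hL⟩ := norm_field_le hA0
  refine ⟨|R| * Real.exp (L * T), fun τ hτ k h h₀ hR t ht => ?_⟩
  have h1 := norm_le_of_deriv_le (f := fun t => field (k t)) (K := L) h (fun t ht => ?_) ht
  · refine h1.trans (mul_le_mul (hR.trans (le_abs_self R)) (Real.exp_le_exp.2 ?_)
      (Real.exp_pos _).le (abs_nonneg _))
    exact mul_le_mul_of_nonneg_left (ht.2.trans hτ) hL0
  · have hd := h.data h₀ ht
    have h3 := mul_nonneg hs hT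
    refine hL _ ?_ ?_ ?_ ?_
    · have h2 := h.norm_ζ_le h₀ ht
      have h4 := (norm_comp_le (k 0)).1
      have h5 := mul_le_mul_of_nonneg_left (ht.2.trans hτ) hs
      linarith [le_abs_self R]
    · linarith [hd.norm_U_le, abs_nonneg R]
    · linarith [hd.norm_p_le, abs_nonneg R]
    · linarith [hd.norm_q_le, abs_nonneg R]

theorem exists_isSol {T : ℝ} (hT : 0 ≤ T) {k₀ : Lag} (h₀ : Data M k₀) :
    ∃ k : ℝ → Lag, k 0 = k₀ ∧ IsSol T k := by
  obtain ⟨R, hR⟩ := exists_norm_bound M ‖k₀‖ T h₀.nonneg hT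
  refine exists_solution_of_apriori (F := fun _ k => field k) (R := R) hT (fun r => ?_)
    (fun x => continuousOn_const) fun τ hτ k hk0 hk => ?_
  · obtain ⟨L, hL, h⟩ := locLip_field r
    exact ⟨L, hL, fun _ _ x y hx hy => h x y hx hy⟩
  · exact hR τ hτ.2 k hk (hk0 ▸ h₀) (by rw [hk0]) τ (right_mem_Icc.2 hτ.1)

/-- Both solutions remain in a common ball, where the field is Lipschitz, so Grönwall's inequality
applies to their difference. -/
theorem exists_lipschitz_bound (M R T : ℝ) (hM : 0 ≤ M) (hT : 0 ≤ T) : ∃ C, 0 ≤ C ∧ ∀ τ ≤ T,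
    ∀ k l : ℝ → Lag, IsSol τ k → IsSol τ l → Data M (k 0) → Data M (l 0) → ‖k 0‖ ≤ R →
    ‖l 0‖ ≤ R → ∀ t ∈ Icc 0 τ, ‖k t - l t‖ ≤ C * ‖k 0 - l 0‖ := by
  obtain ⟨R', hR'⟩ := exists_norm_bound M R T hM hT
  obtain ⟨L, hL, hLip⟩ := locLip_field R'
  refine ⟨Real.exp (L * T), (Real.exp_pos _).le, fun τ hτ k l hk hl hk0 hl0 hkR hlR t ht => ?_⟩
  have h1 := norm_le_of_deriv_le (x := fun t => k t - l t)
    (f := fun t => field (k t) - field (l t)) (fun t ht => (hk t ht).sub (hl t ht))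
    (fun t ht => hLip _ _ (hR' τ hτ k hk hk0 hkR t ht) (hR' τ hτ l hl hl0 hlR t ht)) ht
  refine h1.trans ?_
  rw [mul_comm]
  refine mul_le_mul_of_nonneg_right (Real.exp_le_exp.2 ?_) (norm_nonneg _)
  exact mul_le_mul_of_nonneg_left (ht.2.trans hτ) hL

theorem IsSol.unique {l : ℝ → Lag} (hk : IsSol τ k) (hl : IsSol τ l) (h₀ : Data M (k 0))
    (h : k 0 = l 0) {t : ℝ} (ht : t ∈ Icc 0 τ) : k t = l t := by
  obtain ⟨C, -, hC⟩ := exists_lipschitz_bound M ‖k 0‖ τ h₀.nonneg (ht.1.trans ht.2)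
  have := hC τ le_rfl k l hk hl h₀ (h ▸ h₀) le_rfl (h ▸ le_rfl) t ht
  rw [h, sub_self, norm_zero, mul_zero] at this
  exact sub_eq_zero.1 (norm_le_zero_iff.1 this)

/-- The solution exists for all times. -/
theorem exists_global {k₀ : Lag} (h₀ : Data M k₀) : ∃ k : ℝ → Lag, k 0 = k₀ ∧
    ∀ t, 0 ≤ t → HasDerivWithinAt k (field (k t)) (Ici 0) t := by
  choose l hl0 hl using fun n : ℕ => exists_isSol (T := n) n.cast_nonneg h₀
  have agree : ∀ (n m : ℕ) (t : ℝ), 0 ≤ t → t ≤ n → t ≤ m → l n t = l m t := fun n m t h0 hn hm =>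
    IsSol.unique ((hl n).mono hn) ((hl m).mono hm) (by rw [hl0]; exact h₀)
      ((hl0 n).trans (hl0 m).symm) (right_mem_Icc.2 h0)
  have eq : ∀ (n : ℕ) (t : ℝ), 0 ≤ t → t ≤ n → l ⌈t⌉₊ t = l n t := fun n t h0 hn =>
    agree _ _ t h0 (Nat.le_ceil t) hn
  refine ⟨fun t => l ⌈t⌉₊ t, hl0 _, fun t ht => ?_⟩
  -- With n strictly larger than t, the glued curve coincides with the single solution `l n` on a
  -- neighbourhood of t in [0, ∞).
  obtain ⟨n, hn⟩ := exists_nat_gt t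
  have h1 := hl n t ⟨ht, hn.le⟩
  have h2 : HasDerivWithinAt (fun t => l ⌈t⌉₊ t) (field (l n t)) (Icc 0 (n : ℝ)) t :=
    h1.congr (fun s hs => eq n s hs.1 hs.2) (eq n t ht hn.le)
  simp only
  rw [eq n t ht hn.le]
  refine h2.mono_of_mem_nhdsWithin ?_
  have : Iic (n : ℝ) ∈ 𝓝 t := Iic_mem_nhds hn
  exact inter_mem self_mem_nhdsWithin (mem_nhdsWithin_of_mem_nhds this)

/-! ## Global solutions -/

theorem weakDeriv_U_ae (k : Lag) : weakDeriv (toTriple k).U =ᵐ[volume] dU k :=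
  (isPrimitive_U k).weakDeriv_ae

theorem weakDeriv_H_ae (k : Lag) : weakDeriv (toTriple k).H =ᵐ[volume] dH k :=
  (isPrimitive_H k).weakDeriv_ae

/-- With b = h - u²a the energy identity becomes ab = w². Nonnegativity of b follows from it when a
> 0, and from h ≥ 0 when a = 0. -/
theorem adm_iff {a w u h : ℝ} : Adm a w (h - u ^ 2 * a) ↔
    (0 ≤ a ∧ 0 ≤ h ∧ 0 < a + h) ∧ a * h = a ^ 2 * u ^ 2 + w ^ 2 := by
  constructor
  · rintro ⟨h1, h2, h3, h4⟩
    have h5 := mul_nonneg (sq_nonneg u) h1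
    exact ⟨⟨h1, by linarith, by linarith⟩, by linarith⟩
  · rintro ⟨⟨h1, h2, h3⟩, h4⟩
    have h5 : a * (h - u ^ 2 * a) = w ^ 2 := by linarith
    rcases h1.eq_or_lt with h6 | h6
    · subst h6
      exact ⟨le_rfl, by linarith, by linarith, h5⟩
    · have h7 : 0 ≤ h - u ^ 2 * a := by
        refine (mul_nonneg_iff_of_pos_left h6).1 ?_
        rw [h5]
        exact sq_nonneg w
      exact ⟨h1, h7, by linarith, h5⟩

theorem memW1inf_of_isPrimitive {b : BF} {f : L2} (h : IsPrimitive b f) {B : ℝ}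
    (hB : ∀ᵐ ξ, |f ξ| ≤ B) : MemW1inf b :=
  ⟨b.memLp_top, f, h.hasWeakDeriv, memLp_top_of_abs_le (Lp.aestronglyMeasurable f) hB⟩

theorem MemW1inf.bound {b : BF} {f : L2} (h : IsPrimitive b f) (hb : MemW1inf b) :
    ∃ B, ∀ᵐ ξ, |f ξ| ≤ B := by
  obtain ⟨-, g, hg, hg'⟩ := hb
  have e := (hg.isPrimitive b.continuous).ae_unique h
  refine ⟨lpNorm g ∞ volume, ?_⟩
  filter_upwards [ae_le_lpNorm_exponent_top hg', e] with ξ h1 h2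
  rwa [← h2]

variable {M : ℝ}

theorem Data.memLagrangian {k : Lag} (h : Data M k) : MemLagrangian (toTriple k) := by
  obtain ⟨B, hB⟩ := h.bdd
  have hB' : ∀ᵐ ξ, 0 ≤ ya k ξ ∧ ya k ξ ≤ B ∧ 0 ≤ eb k ξ ∧ eb k ξ ≤ B := by
    filter_upwards [hB, h.adm] with ξ h1 h2
    exact ⟨h2.1, by linarith [h2.2.1], h2.2.1, by linarith [h2.1]⟩
  refine ⟨memE_toTriple k, memW1inf_of_isPrimitive (isPrimitive_ζ k) (B := B + 1) ?_,
    memW1inf_of_isPrimitive (isPrimitive_U k) (B := B) ?_,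
    memW1inf_of_isPrimitive (isPrimitive_H k) (B := B + M * B) ?_, ?_, h.bot, ?_⟩
  · filter_upwards [hB'] with ξ ⟨h1, h2, _, _⟩
    rw [ya] at h1 h2
    rw [abs_le]
    constructor <;> linarith
  · filter_upwards [hB', h.adm] with ξ ⟨h1, h2, h3, h4⟩ h5
    refine abs_le_of_sq_le_sq ?_ (h1.trans h2)
    rw [← h5.2.2.2, sq]
    exact mul_le_mul h2 h4 h3 (h1.trans h2)
  · filter_upwards [hB', h.ae_nonneg] with ξ ⟨h1, h2, h3, h4⟩ h5
    rw [abs_of_nonneg h5.2.1, Data.dH_eq]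
    have := mul_le_mul ((h.sq_U_le ξ).trans (h.le ξ)) h2 h1 h.nonneg
    linarith
  · filter_upwards [h.adm, weakDeriv_y_ae k, weakDeriv_H_ae k] with ξ h1 h2 h3
    rw [h2, h3]
    exact (adm_iff.1 h1).1
  · filter_upwards [h.adm, weakDeriv_y_ae k, weakDeriv_H_ae k, weakDeriv_U_ae k] with ξ h1 h2 h3 h4
    rw [h2, h3, h4]
    exact (adm_iff.1 h1).2

theorem MemLagrangian.data {k : Lag} (h : MemLagrangian (toTriple k)) (hM : ∀ ξ, cH k ξ ≤ M) :
    Data M k := by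
  have hadm : ∀ᵐ ξ, Adm (ya k ξ) (dU k ξ) (eb k ξ) := by
    filter_upwards [h.sign, h.energy, weakDeriv_y_ae k, weakDeriv_H_ae k, weakDeriv_U_ae k]
      with ξ h1 h2 h3 h4 h5
    rw [h3, h4] at h1 h2
    rw [h5] at h2
    exact adm_iff.2 ⟨h1, h2⟩
  refine ⟨hadm, ?_, h.H_atBot, hM⟩
  obtain ⟨B, hB⟩ := MemW1inf.bound (isPrimitive_ζ k) h.ζ_lip
  obtain ⟨B', hB'⟩ := MemW1inf.bound (isPrimitive_H k) h.H_lip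
  refine ⟨B + 1 + B', ?_⟩
  filter_upwards [hB, hB', hadm] with ξ h1 h2 h3
  have h4 := mul_nonneg (sq_nonneg (cU k ξ)) h3.1
  rw [abs_le] at h1 h2
  have e : ya k ξ = dζ k ξ + 1 := rfl
  rw [eb]
  linarith [h1.2, h2.2]

theorem MemLagrangian.rhs_eq {k : Lag} (h : MemLagrangian (toTriple k)) :
    rhs (toTriple k) = toTriple (field k) :=
  rhs_toTriple (h.data fun ξ => (le_abs_self _).trans ((cH k).abs_le ξ)).mono_y

theorem normE_congr_tendsto {α : Type*} {l : Filter α} {f : α → Lag} {a : Lag} :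
    Tendsto f l (𝓝 a) ↔ Tendsto (fun s => normE (toTriple (f s) - toTriple a)) l (𝓝 0) := by
  rw [tendsto_iff_norm_sub_tendsto_zero]
  constructor
  · intro h
    have h' := h.const_mul 6
    rw [mul_zero] at h'
    refine squeeze_zero (fun _ => normE_nonneg _) (fun s => ?_) h'
    rw [← toTriple_sub]
    exact normE_toTriple_le _
  · intro h
    have h' := h.const_mul 2
    rw [mul_zero] at h'
    refine squeeze_zero (fun _ => norm_nonneg _) (fun s => ?_) h'
    rw [← toTriple_sub]
    exact Lag.norm_le_normE _

theorem isGlobalSolution_of_lag {k : ℝ → Lag}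
    (hk : ∀ t, 0 ≤ t → HasDerivWithinAt k (field (k t)) (Ici 0) t) (h₀ : Data M (k 0)) :
    IsGlobalSolution (toTriple (k 0)) (fun t => toTriple (k t)) := by
  have hm : ∀ t, 0 ≤ t → MemLagrangian (toTriple (k t)) := fun t ht =>
    (IsSol.data (τ := t) (fun s hs => (hk s hs.1).mono Icc_subset_Ici_self) h₀
      (right_mem_Icc.2 ht)).memLagrangian
  refine ⟨rfl, hm, fun t ht => ?_, fun t ht => ?_, fun t ht => ?_⟩
  · rw [(hm t ht).rhs_eq]
    exact memE_toTriple _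
  · have := normE_congr_tendsto.1 (hasDerivWithinAt_iff_tendsto_slope.1 (hk t ht))
    rw [(hm t ht).rhs_eq]
    exact this
  · have h1 : Tendsto (fun s => field (k s)) (𝓝[Ici 0] t) (𝓝 (field (k t))) :=
      (locLip_field.continuous.tendsto _).comp (hk t ht).continuousWithinAt
    refine (normE_congr_tendsto.1 h1).congr' ?_
    filter_upwards [self_mem_nhdsWithin] with s hs
    rw [(hm t ht).rhs_eq, (hm s hs).rhs_eq]

theorem IsGlobalSolution.exists_lag {X₀ : Triple} {X : ℝ → Triple} (h : IsGlobalSolution X₀ X) :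
    ∃ k : ℝ → Lag, (∀ t, 0 ≤ t → X t = toTriple (k t)) ∧
      ∀ t, 0 ≤ t → HasDerivWithinAt k (field (k t)) (Ici 0) t := by
  classical
  have hX : ∀ t, 0 ≤ t → X t = toTriple (if ht : 0 ≤ t then ofTriple (X t) (h.mem t ht).memE
      else 0) := fun t ht => by
    rw [dif_pos ht, toTriple_ofTriple]
  refine ⟨fun t => if ht : 0 ≤ t then ofTriple (X t) (h.mem t ht).memE else 0, hX, fun t ht => ?_⟩
  rw [hasDerivWithinAt_iff_tendsto_slope, normE_congr_tendsto]
  refine (h.hasDeriv t ht).congr' ?_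
  filter_upwards [self_mem_nhdsWithin] with s hs
  have hs' : 0 ≤ s := hs.1
  have hm := h.mem t ht
  rw [slope_def_module, toTriple_smul, toTriple_sub, ← hX s hs', ← hX t ht,
    ← MemLagrangian.rhs_eq (by rw [← hX t ht]; exact hm), ← hX t ht]

theorem IsGlobalSolution.unique {X₀ : Triple} {X Y : ℝ → Triple} (hX : IsGlobalSolution X₀ X)
    (hY : IsGlobalSolution X₀ Y) {t : ℝ} (ht : 0 ≤ t) : X t = Y t := by
  obtain ⟨k, hk, hk'⟩ := hX.exists_lag
  obtain ⟨l, hl, hl'⟩ := hY.exists_lag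
  have h0 : MemLagrangian (toTriple (k 0)) := by
    rw [← hk 0 le_rfl]
    exact hX.mem 0 le_rfl
  have e : k 0 = l 0 := toTriple_injective (by
    rw [← hk 0 le_rfl, ← hl 0 le_rfl, hX.init, hY.init])
  rw [hk t ht, hl t ht, IsSol.unique (τ := t) (fun s hs => (hk' s hs.1).mono Icc_subset_Ici_self)
    (fun s hs => (hl' s hs.1).mono Icc_subset_Ici_self)
    (h0.data fun ξ => (le_abs_self _).trans ((cH (k 0)).abs_le ξ)) e (right_mem_Icc.2 ht)]

theorem S_eq {k : ℝ → Lag} (hk : ∀ t, 0 ≤ t → HasDerivWithinAt k (field (k t)) (Ici 0) t)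
    (h₀ : Data M (k 0)) {t : ℝ} (ht : 0 ≤ t) : S t (toTriple (k 0)) = toTriple (k t) := by
  have h := isGlobalSolution_of_lag hk h₀
  have hex : ∃ X, IsGlobalSolution (toTriple (k 0)) X := ⟨_, h⟩
  rw [S, dif_pos hex]
  exact hex.choose_spec.unique h ht

/-! ## Bi-Lipschitz changes of variables -/

theorem isPrimitive_of_lipschitz {f : ℝ → ℝ} {L : ℝ} (hL : 0 ≤ L)
    (h : ∀ x y, |f x - f y| ≤ L * |x - y|) : IsPrimitive f (deriv f) ∧ ∀ x, |deriv f x| ≤ L := by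
  have hl : LipschitzWith ⟨L, hL⟩ f := LipschitzWith.of_dist_le_mul fun x y => h x y
  have hb : ∀ x, |deriv f x| ≤ L := fun x => norm_deriv_le_of_lipschitz hl
  refine ⟨IsPrimitive.of_absolutelyContinuous
    (fun a b => (hl.lipschitzOnWith (s := uIcc a b)).absolutelyContinuousOnInterval) ?_ ?_, hb⟩
  · exact (locallyIntegrable_const L).mono (measurable_deriv f).aestronglyMeasurable
      (ae_of_all _ fun x => (hb x).trans (le_abs_self L))
  · exact hl.ae_differentiableAt_real.mono fun x hx => hx.hasDerivAt

/-- Increasing homeomorphisms that are `L`-Lipschitz together with their inverse. -/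
structure Reg (L : ℝ) (f : ℝ ≃ₜ ℝ) : Prop where
  mono : StrictMono f
  lip : ∀ x y, |f x - f y| ≤ L * |x - y|
  lip_symm : ∀ x y, |f.symm x - f.symm y| ≤ L * |x - y|

namespace Reg

variable {L : ℝ} {f : ℝ ≃ₜ ℝ}

theorem symm (h : Reg L f) : Reg L f.symm :=
  ⟨fun x y hxy => by
    rw [← h.mono.lt_iff_lt, f.apply_symm_apply, f.apply_symm_apply]
    exact hxy, h.lip_symm, h.lip⟩

theorem trans {L' : ℝ} {g : ℝ ≃ₜ ℝ} (h : Reg L f) (h' : Reg L' g) (hL : 0 ≤ L) (hL' : 0 ≤ L') :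
    Reg (L * L') (f.trans g) :=
  ⟨h'.mono.comp h.mono, fun x y => (h'.lip _ _).trans (by
    rw [mul_comm L, mul_assoc]
    exact mul_le_mul_of_nonneg_left (h.lip x y) hL'), fun x y => (h.lip_symm _ _).trans (by
    rw [mul_assoc]
    exact mul_le_mul_of_nonneg_left (h'.lip_symm x y) hL)⟩

theorem nonneg (h : Reg L f) : 0 ≤ L := by
  have := (abs_nonneg _).trans (h.lip 1 0)
  simpa using this

theorem isPrimitive (h : Reg L f) : IsPrimitive f (deriv f) :=
  (isPrimitive_of_lipschitz h.nonneg h.lip).1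

theorem abs_deriv_le (h : Reg L f) (x : ℝ) : |deriv f x| ≤ L :=
  (isPrimitive_of_lipschitz h.nonneg h.lip).2 x

theorem deriv_nonneg (h : Reg L f) (x : ℝ) : 0 ≤ deriv f x := h.mono.monotone.deriv_nonneg

theorem deriv_le (h : Reg L f) (x : ℝ) : deriv f x ≤ L :=
  (le_abs_self _).trans (h.abs_deriv_le x)

/-- The Lipschitz bound for the inverse says that L·f - id is nondecreasing. -/
theorem le_deriv (h : Reg L f) : ∀ᵐ x, 1 ≤ L * deriv f x := by
  have hm : Monotone fun x => L * f x - x := fun x y hxy => by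
    have h1 := h.lip_symm (f y) (f x)
    rw [f.symm_apply_apply, f.symm_apply_apply, abs_of_nonneg (sub_nonneg.2 hxy),
      abs_of_nonneg (sub_nonneg.2 (h.mono.monotone hxy))] at h1
    simp only
    linarith
  filter_upwards [h.isPrimitive.ae_hasDerivAt] with x hx
  have h1 := ((hx.const_mul L).sub (hasDerivAt_id x)).deriv
  have h2 : 0 ≤ deriv (fun x => L * f x - x) x := hm.deriv_nonneg
  have h3 : deriv (fun x => L * f x - x) x = L * deriv f x - 1 := h1
  linarith

theorem deriv_pos (h : Reg L f) : ∀ᵐ x, 0 < deriv f x := by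
  filter_upwards [h.le_deriv] with x hx
  refine (h.deriv_nonneg x).lt_of_ne fun h0 => ?_
  rw [← h0, mul_zero] at hx
  linarith

theorem measurableEmbedding (f : ℝ ≃ₜ ℝ) : MeasurableEmbedding f :=
  f.toMeasurableEquiv.measurableEmbedding

theorem preimage_Ioo (h : Reg L f) (a b : ℝ) : f ⁻¹' Ioo a b = Ioo (f.symm a) (f.symm b) := by
  ext x
  simp only [mem_preimage, mem_Ioo]
  rw [← h.mono.lt_iff_lt (a := f.symm a), ← h.mono.lt_iff_lt (b := f.symm b),
    f.apply_symm_apply, f.apply_symm_apply]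

/-- Change of variables: by the fundamental theorem of calculus both measures give (a, b) the length
b - a, and intervals with rational endpoints determine the measure. -/
theorem map_withDensity (h : Reg L f) :
    (volume.withDensity fun x => ENNReal.ofReal (deriv f x)).map f = volume := by
  refine (Real.measure_ext_Ioo_rat fun a b => ?_).symm
  rw [(measurableEmbedding f).map_apply, h.preimage_Ioo, withDensity_apply _ measurableSet_Ioo,
    Real.volume_Ioo]
  rcases le_total (a : ℝ) b with hab | hab
  · have hab' := h.symm.mono.monotone hab
    have hi := h.isPrimitive.intervalIntegrable (f.symm a) (f.symm b)
    rw [← ofReal_integral_eq_lintegral_ofReal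
      ((intervalIntegrable_iff_integrableOn_Ioo_of_le hab').1 hi)
      (ae_of_all _ h.deriv_nonneg), ← integral_Ioc_eq_integral_Ioo,
      ← intervalIntegral.integral_of_le hab', h.isPrimitive.integral_eq, f.apply_symm_apply,
      f.apply_symm_apply]
  · rw [Ioo_eq_empty (not_lt.2 (h.symm.mono.monotone hab)), Measure.restrict_empty,
      lintegral_zero_measure, ENNReal.ofReal_of_nonpos (sub_nonpos.2 hab)]

/-- Since L·f' ≥ 1 a.e., Lebesgue measure is at most L times the measure with density f', whose
image under f is Lebesgue measure. -/
theorem map_le (h : Reg L f) : volume.map f ≤ ENNReal.ofReal L • (volume : Measure ℝ) := by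
  have h1 : (volume : Measure ℝ) ≤ ENNReal.ofReal L •
      volume.withDensity fun x => ENNReal.ofReal (deriv f x) := by
    rw [← withDensity_smul _ (measurable_deriv f).ennreal_ofReal]
    conv_lhs => rw [← withDensity_one (μ := (volume : Measure ℝ))]
    refine withDensity_mono (h.le_deriv.mono fun x hx => ?_)
    simp only [Pi.one_apply, Pi.smul_apply, smul_eq_mul]
    rw [← ENNReal.ofReal_mul h.nonneg, ← ENNReal.ofReal_one]
    exact ENNReal.ofReal_le_ofReal hx
  refine (Measure.map_mono h1 f.measurable).trans (le_of_eq ?_)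
  rw [Measure.map_smul, h.map_withDensity]

theorem quasiMeasurePreserving (h : Reg L f) : Measure.QuasiMeasurePreserving f volume volume :=
  ⟨f.measurable, (Measure.absolutelyContinuous_of_le_smul h.map_le)⟩

theorem ae_comp (h : Reg L f) {p : ℝ → Prop} (hp : ∀ᵐ x, p x) : ∀ᵐ x, p (f x) :=
  h.quasiMeasurePreserving.ae hp

theorem memLp_comp (h : Reg L f) {g : ℝ → ℝ} (hg : MemLp g 2) : MemLp (fun x => g (f x)) 2 :=
  (MemLp.of_measure_le_smul ENNReal.ofReal_ne_top h.map_le hg).comp_of_map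
    f.measurable.aemeasurable

theorem lpNorm_comp_le (h : Reg L f) {g : ℝ → ℝ} (hg : MemLp g 2) :
    lpNorm (fun x => g (f x)) 2 volume ≤ Real.sqrt L * lpNorm g 2 volume := by
  have h1 : eLpNorm (fun x => g (f x)) 2 volume ≤ ENNReal.ofReal (Real.sqrt L) *
      eLpNorm g 2 volume := by
    change eLpNorm (g ∘ f) 2 volume ≤ _
    rw [← (measurableEmbedding f).eLpNorm_map_measure]
    refine (eLpNorm_mono_measure g h.map_le).trans (le_of_eq ?_)
    rw [eLpNorm_smul_measure_of_ne_top ENNReal.ofNat_ne_top, smul_eq_mul, Real.sqrt_eq_rpow,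
      ENNReal.ofReal_rpow_of_nonneg h.nonneg (by norm_num)]
    norm_num
  rw [← toReal_eLpNorm (h.memLp_comp hg).1, ← toReal_eLpNorm hg.1]
  have h2 := ENNReal.toReal_mono (ENNReal.mul_ne_top ENNReal.ofReal_ne_top hg.2.ne) h1
  rwa [ENNReal.toReal_mul, ENNReal.toReal_ofReal (Real.sqrt_nonneg _)] at h2

/-- Change of variables. -/
theorem setIntegral_comp (h : Reg L f) {s : Set ℝ} (hs : MeasurableSet s) (g : ℝ → ℝ) :
    ∫ x in f ⁻¹' s, g (f x) * deriv f x = ∫ x in s, g x := by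
  have h1 := (measurableEmbedding f).setIntegral_map
    (μ := volume.withDensity fun x => ENNReal.ofReal (deriv f x)) g s
  rw [h.map_withDensity] at h1
  rw [h1, setIntegral_withDensity_eq_setIntegral_toReal_smul (measurable_deriv f).ennreal_ofReal
    (ae_of_all _ fun x => ENNReal.ofReal_lt_top) _ (f.measurable hs)]
  refine integral_congr_ae (ae_of_all _ fun x => ?_)
  simp only [smul_eq_mul, ENNReal.toReal_ofReal (h.deriv_nonneg x)]
  ring

theorem memLp_comp_mul (h : Reg L f) {g : ℝ → ℝ} (hg : MemLp g 2) :
    MemLp (fun x => g (f x) * deriv f x) 2 := by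
  simp only [mul_comm (g _)]
  exact memLp_two_bounded_mul (measurable_deriv f).aestronglyMeasurable
    (ae_of_all _ h.abs_deriv_le) (h.memLp_comp hg)

theorem isPrimitive_comp (h : Reg L f) {F g : ℝ → ℝ} (hF : IsPrimitive F g) (hg : MemLp g 2) :
    IsPrimitive (fun x => F (f x)) (fun x => g (f x) * deriv f x) := by
  have key : ∀ a b, a ≤ b → ∫ x in a..b, g (f x) * deriv f x = F (f b) - F (f a) :=
    fun a b hab => by
      have e : Ioc a b = f ⁻¹' Ioc (f a) (f b) := by
        ext x
        simp only [mem_preimage, mem_Ioc, h.mono.lt_iff_lt, h.mono.le_iff_le]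
      rw [intervalIntegral.integral_of_le hab, e, h.setIntegral_comp measurableSet_Ioc,
        ← intervalIntegral.integral_of_le (h.mono.monotone hab), hF.integral_eq]
  refine ⟨(h.memLp_comp_mul hg).locallyIntegrable one_le_two, fun a b => ?_⟩
  rcases le_total a b with hab | hab
  · exact key a b hab
  · rw [intervalIntegral.integral_symm, key b a hab, neg_sub]

end Reg

/-! ### Composition as an operator -/

/-- Composition of a square integrable function with a bi-Lipschitz map. -/
def compL {L : ℝ} {f : ℝ ≃ₜ ℝ} (h : Reg L f) (g : L2) : L2 := (h.memLp_comp (Lp.memLp g)).toLp _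

/-- Composition of a square integrable derivative with a bi-Lipschitz map, by the chain rule. -/
def compD {L : ℝ} {f : ℝ ≃ₜ ℝ} (h : Reg L f) (g : L2) : L2 :=
  (h.memLp_comp_mul (Lp.memLp g)).toLp _

variable {L : ℝ} {f : ℝ ≃ₜ ℝ}

theorem coeFn_compL (h : Reg L f) (g : L2) : (compL h g : ℝ → ℝ) =ᵐ[volume] fun x => g (f x) :=
  MemLp.coeFn_toLp _

theorem coeFn_compD (h : Reg L f) (g : L2) :
    (compD h g : ℝ → ℝ) =ᵐ[volume] fun x => g (f x) * deriv f x := MemLp.coeFn_toLp _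

theorem norm_compL_le (h : Reg L f) (g : L2) : ‖compL h g‖ ≤ Real.sqrt L * ‖g‖ := by
  rw [compL, norm_toLp_eq_lpNorm, L2.norm_eq]
  exact h.lpNorm_comp_le (Lp.memLp g)

theorem norm_compD_le (h : Reg L f) (g : L2) : ‖compD h g‖ ≤ L * (Real.sqrt L * ‖g‖) := by
  refine (Lp.norm_le_mul_norm_of_ae_le_mul (g := compL h g) ?_).trans
    (mul_le_mul_of_nonneg_left (norm_compL_le h g) h.nonneg)
  filter_upwards [coeFn_compL h g, coeFn_compD h g] with x h1 h2
  rw [h1, h2, norm_mul, mul_comm]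
  exact mul_le_mul_of_nonneg_right (h.abs_deriv_le x) (norm_nonneg _)

/-- Composition with a continuous map. -/
def compB (f : ℝ ≃ₜ ℝ) (b : BF) : BF := b.compContinuous (f : C(ℝ, ℝ))

theorem norm_compB_le (f : ℝ ≃ₜ ℝ) (b : BF) : ‖compB f b‖ ≤ ‖b‖ :=
  (BoundedContinuousFunction.norm_le (norm_nonneg _)).2 fun x => b.norm_coe_le_norm (f x)

theorem isPrimitive_compB (h : Reg L f) {b : BF} {g : L2} (hb : IsPrimitive b g) :
    IsPrimitive (compB f b) (compD h g) :=
  IsPrimitive.congr (f := compB f b) (h.isPrimitive_comp hb (Lp.memLp g)) (coeFn_compD h g).symm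

/-- Composition of all components with a bi-Lipschitz map. -/
def compFun (h : Reg L f) (k : Lag) : Lag :=
  Lag.mk (compB f (cζ k)) (compB f (cU k)) (compB f (cH k)) (compD h (dζ k)) (compL h (lU k))
    (compD h (dU k)) (compD h (dH k)) (isPrimitive_compB h (isPrimitive_ζ k))
    ((coeFn_compL h _).trans (h.ae_comp (lU_ae k))) (isPrimitive_compB h (isPrimitive_U k))
    (isPrimitive_compB h (isPrimitive_H k))

theorem norm_compFun_le (h : Reg L f) (k : Lag) :
    ‖compFun h k‖ ≤ (1 + L) * (1 + Real.sqrt L) * ‖k‖ := by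
  obtain ⟨h1, h2, h3, h4, h5, h6, h7⟩ := norm_comp_le k
  have hk := norm_nonneg k
  have hL := h.nonneg
  have hs := Real.sqrt_nonneg L
  have key : ∀ x : ℝ, x ≤ ‖k‖ → x ≤ (1 + L) * (1 + Real.sqrt L) * ‖k‖ ∧
      Real.sqrt L * x ≤ (1 + L) * (1 + Real.sqrt L) * ‖k‖ ∧
      L * (Real.sqrt L * x) ≤ (1 + L) * (1 + Real.sqrt L) * ‖k‖ := fun x hx => by
    have e1 := mul_le_mul_of_nonneg_left hx hs
    have e2 := mul_le_mul_of_nonneg_left e1 hL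
    have e3 := mul_nonneg hs hk
    have e4 := mul_nonneg hL hk
    have e5 := mul_nonneg hL e3
    refine ⟨?_, ?_, ?_⟩ <;> linarith
  rw [Lag.norm_le_iff]
  exact ⟨(norm_compB_le f _).trans (key _ h1).1, (norm_compB_le f _).trans (key _ h2).1,
    (norm_compB_le f _).trans (key _ h3).1, (norm_compD_le h _).trans (key _ h4).2.2,
    (norm_compL_le h _).trans (key _ h5).2.1, (norm_compD_le h _).trans (key _ h6).2.2,
    (norm_compD_le h _).trans (key _ h7).2.2⟩

/-- Composition with a bi-Lipschitz map as a bounded operator. -/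
def compLag (h : Reg L f) : Lag →L[ℝ] Lag :=
  LinearMap.mkContinuous
    { toFun := compFun h
      map_add' := fun _ _ => toTriple_injective rfl
      map_smul' := fun _ _ => toTriple_injective rfl }
    ((1 + L) * (1 + Real.sqrt L)) (norm_compFun_le h)

theorem norm_compLag_le (h : Reg L f) (k : Lag) :
    ‖compLag h k‖ ≤ (1 + L) * (1 + Real.sqrt L) * ‖k‖ := norm_compFun_le h k

/-! ## The relabeling group -/

theorem IsPrimitive.abs_sub_le {f g : ℝ → ℝ} {B : ℝ} (h : IsPrimitive f g)
    (hB : ∀ᵐ x, |g x| ≤ B) (x y : ℝ) : |f x - f y| ≤ B * |x - y| := by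
  rw [← h.integral_eq]
  exact intervalIntegral.norm_integral_le_of_norm_le_const_ae (f := g) (hB.mono fun x hx _ => hx)

/-- Relabelings: bi-Lipschitz increasing homeomorphisms at bounded distance from the identity,
with `f' - 1` in `L²`. -/
structure Reparam (f : ℝ ≃ₜ ℝ) : Prop where
  reg : ∃ L, Reg L f
  bdd : ∃ A, ∀ x, |f x - x| ≤ A
  prim : ∃ g, IsPrimitive (fun x => f x - x) g ∧ MemLp g 2

theorem MemW1inf.bounds {φ : ℝ → ℝ} (hφ : Continuous fun x => φ x - x)
    (h : MemW1inf fun x => φ x - x) :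
    (∃ A, ∀ x, |φ x - x| ≤ A) ∧ ∃ L, 0 ≤ L ∧ ∀ x y, |φ x - φ y| ≤ L * |x - y| := by
  obtain ⟨h1, g, hg, hg'⟩ := h
  refine ⟨⟨_, Continuous.abs_le_lpNorm hφ h1⟩, lpNorm g ∞ volume + 1,
    add_nonneg lpNorm_nonneg zero_le_one, fun x y => ?_⟩
  have h2 := (hg.isPrimitive hφ).abs_sub_le (ae_le_lpNorm_exponent_top hg') x y
  have h3 : φ x - φ y = (φ x - x - (φ y - y)) + (x - y) := by ring
  rw [h3, add_mul, one_mul]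
  exact (abs_add_le _ _).trans (add_le_add h2 le_rfl)

/-- A homeomorphism of the line is strictly monotone, and a decreasing one cannot stay at bounded
distance from the identity. -/
theorem strictMono_of_bdd {f : ℝ ≃ₜ ℝ} {A : ℝ} (hA : ∀ x, |f x - x| ≤ A) : StrictMono f := by
  rcases f.continuous.strictMono_of_inj f.injective with h | h
  · exact h
  · have hA0 : 0 ≤ A := (abs_nonneg _).trans (hA 0)
    have h1 := abs_le.1 (hA 0)
    have h2 := abs_le.1 (hA (2 * A + 1))
    have h3 := h (show (0 : ℝ) < 2 * A + 1 by linarith)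
    linarith [h1.2, h2.1]

theorem mem_relabelingGroup_iff {f : ℝ ≃ₜ ℝ} : f ∈ relabelingGroup ↔ Reparam f := by
  constructor
  · rintro ⟨h1, h2, h3⟩
    obtain ⟨⟨A, hA⟩, L, hL, hlip⟩ := MemW1inf.bounds (by fun_prop) h1
    obtain ⟨-, L', hL', hlip'⟩ := MemW1inf.bounds (by fun_prop) h2
    have hreg : Reg (L + L') f := ⟨strictMono_of_bdd hA, fun x y => (hlip x y).trans
      (mul_le_mul_of_nonneg_right (by linarith) (abs_nonneg _)), fun x y => (hlip' x y).trans
      (mul_le_mul_of_nonneg_right (by linarith) (abs_nonneg _))⟩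
    exact ⟨⟨_, hreg⟩, ⟨A, hA⟩, _, hreg.isPrimitive.isPrimitive_weakDeriv.sub IsPrimitive.id, h3⟩
  · rintro ⟨⟨L, hL⟩, ⟨A, hA⟩, g, hg, hg2⟩
    have key : ∀ {φ : ℝ ≃ₜ ℝ}, Reg L φ → (∀ x, |φ x - x| ≤ A) → MemW1inf fun ξ => φ ξ - ξ :=
      fun {φ} hφ hA => by
        refine ⟨memLp_top_of_abs_le (by fun_prop) (ae_of_all _ hA), _,
          (hφ.isPrimitive.sub IsPrimitive.id).hasWeakDeriv, ?_⟩
        refine memLp_top_of_abs_le ((measurable_deriv φ).sub measurable_const).aestronglyMeasurable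
          (C := L + 1) (ae_of_all _ fun x => ?_)
        exact (abs_sub _ _).trans (by rw [abs_one]; linarith [hφ.abs_deriv_le x])
    refine ⟨key hL hA, key hL.symm fun x => ?_, ?_⟩
    · have := hA (f.symm x)
      rwa [f.apply_symm_apply, abs_sub_comm] at this
    · refine (memLp_congr_ae ?_).2 hg2
      filter_upwards [(hL.isPrimitive.sub IsPrimitive.id).ae_unique hg,
        hL.isPrimitive.weakDeriv_ae] with x h1 h2
      rw [h2, h1]

namespace Reparam

variable {f g : ℝ ≃ₜ ℝ}

theorem refl : Reparam (Homeomorph.refl ℝ) :=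
  ⟨⟨1, fun _ _ h => h, fun x y => by simp, fun x y => by simp⟩, ⟨0, fun x => by simp⟩,
    fun _ => 0, by simpa using IsPrimitive.const 0, MemLp.zero⟩

theorem symm (h : Reparam f) : Reparam f.symm := by
  obtain ⟨⟨L, hL⟩, ⟨A, hA⟩, u, hu, hu2⟩ := h
  refine ⟨⟨L, hL.symm⟩, ⟨A, fun x => ?_⟩, fun x => -(u (f.symm x) * deriv f.symm x), ?_,
    (hL.symm.memLp_comp_mul hu2).neg⟩
  · have := hA (f.symm x)
    rwa [f.apply_symm_apply, abs_sub_comm] at this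
  · have := (hL.symm.isPrimitive_comp hu hu2).neg
    simpa using this

theorem trans (hf : Reparam f) (hg : Reparam g) : Reparam (f.trans g) := by
  obtain ⟨⟨L, hL⟩, ⟨A, hA⟩, u, hu, hu2⟩ := hf
  obtain ⟨⟨L', hL'⟩, ⟨A', hA'⟩, v, hv, hv2⟩ := hg
  refine ⟨⟨_, hL.trans hL' hL.nonneg hL'.nonneg⟩, ⟨A' + A, fun x => ?_⟩,
    fun x => v (f x) * deriv f x + u x, ?_, (hL.memLp_comp_mul hv2).add hu2⟩
  · have e : (f.trans g) x - x = (g (f x) - f x) + (f x - x) := by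
      simp
    rw [e]
    exact (abs_add_le _ _).trans (add_le_add (hA' _) (hA x))
  · have := (hL.isPrimitive_comp hv hv2).add hu
    simpa using this

theorem memLp_deriv (h : Reparam f) : MemLp (fun x => deriv f x - 1) 2 := by
  obtain ⟨⟨L, hL⟩, -, u, hu, hu2⟩ := h
  exact (memLp_congr_ae ((hL.isPrimitive.sub IsPrimitive.id).ae_unique hu)).2 hu2

/-- The displacement `f - id` as a bounded continuous function. -/
def disp (h : Reparam f) : BF := BoundedContinuousFunction.ofNormedAddCommGroup (fun x => f x - x)
  (by fun_prop) _ h.bdd.choose_spec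

/-- The element `(f - id, 0, 0)`. -/
def shift (h : Reparam f) : Lag :=
  Lag.mk h.disp 0 0 (h.memLp_deriv.toLp _) 0 0 0
    (IsPrimitive.congr (f := h.disp)
      (h.reg.choose_spec.isPrimitive.sub IsPrimitive.id) (h.memLp_deriv.coeFn_toLp).symm)
    (Lp.coeFn_zero ℝ 2 volume)
    ((IsPrimitive.const 0).congr (Lp.coeFn_zero ℝ 2 volume).symm)
    ((IsPrimitive.const 0).congr (Lp.coeFn_zero ℝ 2 volume).symm)

end Reparam

variable {L : ℝ} {f : ℝ ≃ₜ ℝ}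

/-- `X ∘ f` in the Banach space. -/
def reparamLag (hL : Reg L f) (hf : Reparam f) (k : Lag) : Lag := compLag hL k + hf.shift

theorem toTriple_reparamLag (hL : Reg L f) (hf : Reparam f) (k : Lag) :
    toTriple (reparamLag hL hf k) = relabel (toTriple k) f := by
  refine Prod.ext ?_ (Prod.ext ?_ ?_)
  · funext ξ
    change cζ k (f ξ) + (f ξ - ξ) = cζ k (f ξ) + f ξ - ξ
    ring
  · funext ξ
    change cU k (f ξ) + 0 = cU k (f ξ)
    ring
  · funext ξ
    change cH k (f ξ) + 0 = cH k (f ξ)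
    ring

theorem cU_reparamLag (hL : Reg L f) (hf : Reparam f) (k : Lag) (ξ : ℝ) :
    cU (reparamLag hL hf k) ξ = cU k (f ξ) := congrArg (fun X : Triple => X.2.1 ξ)
  (toTriple_reparamLag hL hf k)

theorem cH_reparamLag (hL : Reg L f) (hf : Reparam f) (k : Lag) (ξ : ℝ) :
    cH (reparamLag hL hf k) ξ = cH k (f ξ) := congrArg (fun X : Triple => X.2.2 ξ)
  (toTriple_reparamLag hL hf k)

theorem yk_reparamLag (hL : Reg L f) (hf : Reparam f) (k : Lag) (ξ : ℝ) :
    yk (reparamLag hL hf k) ξ = yk k (f ξ) := by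
  change cζ k (f ξ) + (f ξ - ξ) + ξ = cζ k (f ξ) + f ξ
  ring

theorem ya_reparamLag (hL : Reg L f) (hf : Reparam f) (k : Lag) :
    ∀ᵐ ξ, ya (reparamLag hL hf k) ξ = ya k (f ξ) * deriv f ξ := by
  filter_upwards [Lp.coeFn_add (compD hL (dζ k)) (hf.memLp_deriv.toLp _),
    coeFn_compD hL (dζ k), hf.memLp_deriv.coeFn_toLp] with ξ h1 h2 h3
  change (compD hL (dζ k) + hf.memLp_deriv.toLp _ : L2) ξ + 1 = (dζ k (f ξ) + 1) * deriv f ξ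
  rw [h1, Pi.add_apply, h2, h3]
  ring

theorem dU_reparamLag (hL : Reg L f) (hf : Reparam f) (k : Lag) :
    ∀ᵐ ξ, dU (reparamLag hL hf k) ξ = dU k (f ξ) * deriv f ξ := by
  filter_upwards [coeFn_compD hL (dU k)] with ξ h1
  change (compD hL (dU k) + 0 : L2) ξ = _
  rw [add_zero, h1]

theorem dH_reparamLag (hL : Reg L f) (hf : Reparam f) (k : Lag) :
    ∀ᵐ ξ, dH (reparamLag hL hf k) ξ = dH k (f ξ) * deriv f ξ := by
  filter_upwards [coeFn_compD hL (dH k)] with ξ h1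
  change (compD hL (dH k) + 0 : L2) ξ = _
  rw [add_zero, h1]

theorem eb_reparamLag (hL : Reg L f) (hf : Reparam f) (k : Lag) :
    ∀ᵐ ξ, eb (reparamLag hL hf k) ξ = eb k (f ξ) * deriv f ξ := by
  filter_upwards [ya_reparamLag hL hf k, dH_reparamLag hL hf k] with ξ h1 h2
  rw [eb, h1, h2, cU_reparamLag, eb]
  ring

theorem src_reparamLag (hL : Reg L f) (hf : Reparam f) (k : Lag) :
    ∀ᵐ ξ, src (reparamLag hL hf k) ξ = src k (f ξ) * deriv f ξ := by
  filter_upwards [ya_reparamLag hL hf k, dH_reparamLag hL hf k, coeFn_src (reparamLag hL hf k),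
    hL.ae_comp (coeFn_src k)] with ξ h1 h2 h3 h4
  rw [h3, h4]
  change cU (reparamLag hL hf k) ξ ^ 2 * ya (reparamLag hL hf k) ξ + dH (reparamLag hL hf k) ξ =
    (cU k (f ξ) ^ 2 * ya k (f ξ) + dH k (f ξ)) * deriv f ξ
  rw [h1, h2, cU_reparamLag]
  ring

/-- Substitution in the integral: an increasing f carries half-lines to half-lines, and the factor
f' is supplied by the source, which transforms as a density. -/
theorem kerL_reparamLag (hL : Reg L f) (hf : Reparam f) (k : Lag) (ξ : ℝ) :
    kerL (yk (reparamLag hL hf k)) (src (reparamLag hL hf k)) ξ = kerL (yk k) (src k) (f ξ) := by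
  have e : Iic ξ = f ⁻¹' Iic (f ξ) := by
    ext x
    simp only [mem_preimage, mem_Iic, hL.mono.le_iff_le]
  rw [kerL, kerL, ← hL.setIntegral_comp (s := Iic (f ξ)) measurableSet_Iic, e]
  refine integral_congr_ae (ae_restrict_of_ae ?_)
  filter_upwards [src_reparamLag hL hf k] with η h
  rw [h, yk_reparamLag, yk_reparamLag]
  ring

theorem kerR_reparamLag (hL : Reg L f) (hf : Reparam f) (k : Lag) (ξ : ℝ) :
    kerR (yk (reparamLag hL hf k)) (src (reparamLag hL hf k)) ξ = kerR (yk k) (src k) (f ξ) := by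
  have e : Ioi ξ = f ⁻¹' Ioi (f ξ) := by
    ext x
    simp only [mem_preimage, mem_Ioi, hL.mono.lt_iff_lt]
  rw [kerR, kerR, ← hL.setIntegral_comp (s := Ioi (f ξ)) measurableSet_Ioi, e]
  refine integral_congr_ae (ae_restrict_of_ae ?_)
  filter_upwards [src_reparamLag hL hf k] with η h
  rw [h, yk_reparamLag, yk_reparamLag]
  ring

/-- The vector field is equivariant under relabeling. -/
theorem field_reparamLag (hL : Reg L f) (hf : Reparam f) (k : Lag) :
    field (reparamLag hL hf k) = compLag hL (field k) := by
  have hp : ∀ ξ, pF (reparamLag hL hf k) ξ = pF k (f ξ) := fun ξ => by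
    rw [pF, pF, kerL_reparamLag, kerR_reparamLag]
  have hq : ∀ ξ, qF (reparamLag hL hf k) ξ = qF k (f ξ) := fun ξ => by
    rw [qF, qF, kerL_reparamLag, kerR_reparamLag]
  have hU := cU_reparamLag hL hf k
  -- Only the three continuous components need comparison; equality of the derivative components is
  -- then automatic.
  refine toTriple_injective (Prod.ext (funext hU) (Prod.ext ?_ ?_))
  · funext ξ
    change -qF (reparamLag hL hf k) ξ = -qF k (f ξ)
    rw [hq]
  · funext ξ
    change cU (reparamLag hL hf k) ξ * (cU (reparamLag hL hf k) ξ * cU (reparamLag hL hf k) ξ) -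
      2 * (pF (reparamLag hL hf k) ξ * cU (reparamLag hL hf k) ξ) =
      cU k (f ξ) * (cU k (f ξ) * cU k (f ξ)) - 2 * (pF k (f ξ) * cU k (f ξ))
    rw [hU, hp]

theorem IsSol.reparamLag {τ : ℝ} {k : ℝ → Lag} (h : IsSol τ k) (hL : Reg L f) (hf : Reparam f) :
    IsSol τ fun t => reparamLag hL hf (k t) := fun t ht => by
  rw [field_reparamLag]
  exact (h.clm (compLag hL) ht).add_const _

theorem Data.reparamLag {M : ℝ} {k : Lag} (h : Data M k) (hL : Reg L f) (hf : Reparam f) :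
    Data M (reparamLag hL hf k) := by
  refine ⟨?_, ?_, ?_, fun ξ => ?_⟩
  · filter_upwards [hL.ae_comp h.adm, ya_reparamLag hL hf k, dU_reparamLag hL hf k,
      eb_reparamLag hL hf k, hL.deriv_pos] with ξ ⟨h1, h2, h3, h4⟩ e1 e2 e3 hd
    rw [e1, e2, e3]
    refine ⟨mul_nonneg h1 hd.le, mul_nonneg h2 hd.le, ?_, ?_⟩
    · rw [← add_mul]
      exact mul_pos h3 hd
    · rw [mul_pow, ← h4]
      ring
  · obtain ⟨B, hB⟩ := h.bdd
    refine ⟨B * L, ?_⟩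
    filter_upwards [hL.ae_comp h.adm, hL.ae_comp hB, ya_reparamLag hL hf k,
      eb_reparamLag hL hf k] with ξ h1 h2 e1 e2
    rw [e1, e2, ← add_mul]
    exact mul_le_mul h2 (hL.deriv_le ξ) (hL.deriv_nonneg ξ) (h1.2.2.1.le.trans h2)
  · obtain ⟨A, hA⟩ := hf.bdd
    have h1 : Tendsto f atBot atBot := by
      refine tendsto_atBot_mono (fun x => ?_) (tendsto_atBot_add_const_right atBot A tendsto_id)
      have := (abs_le.1 (hA x)).2
      simp only [id]
      linarith
    refine (h.bot.comp h1).congr fun ξ => ?_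
    exact (cH_reparamLag hL hf k ξ).symm
  · rw [cH_reparamLag]
    exact h.le _

/-! ## Normalized data -/

/-- Elements of `ℱ₀^M` in the Banach space. -/
structure NData (M : ℝ) (k : Lag) : Prop extends Data M k where
  normalized : ∀ ξ, yk k ξ + cH k ξ = ξ

theorem mem_F0M_iff {M : ℝ} {X : Triple} : X ∈ F0M M ↔ ∃ k, X = toTriple k ∧ NData M k := by
  constructor
  · rintro ⟨⟨h, hn⟩, hM⟩
    refine ⟨ofTriple X h.memE, rfl, ⟨MemLagrangian.data (k := ofTriple X h.memE) h fun ξ => ?_, hn⟩⟩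
    exact (le_abs_self _).trans
      ((Continuous.abs_le_lpNorm h.memE.2.2.1 h.memE.2.2.2.1 ξ).trans hM)
  · rintro ⟨k, rfl, h⟩
    refine ⟨⟨h.toData.memLagrangian, h.normalized⟩, ?_⟩
    change lpNorm (cH k) ∞ volume ≤ M
    rw [BF.lpNorm_eq]
    exact h.toData.norm_H_le

theorem isPrimitive_yH (k : Lag) : IsPrimitive (fun ξ => yk k ξ + cH k ξ)
    (fun ξ => ya k ξ + dH k ξ) := (isPrimitive_yk k).add (isPrimitive_H k)

namespace NData

variable {M : ℝ} {k : Lag}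

theorem ya_add_dH (h : NData M k) : ∀ᵐ ξ, ya k ξ + dH k ξ = 1 := by
  have h1 := isPrimitive_yH k
  rw [funext h.normalized] at h1
  exact h1.ae_unique IsPrimitive.id

/-- From y_ξ + H_ξ = 1 both derivatives lie in [0, 1], so each of ζ_ξ², U², U_ξ², H_ξ² is at most (1
+ M)·H_ξ. Since H increases by at most M, the squared norms are at most (1 + M)M. -/
theorem norm_le (h : NData M k) : ‖k‖ ≤ 1 + M := by
  have hd := h.toData
  have hM := hd.nonneg
  have key : ∀ f : L2, (∀ᵐ ξ, f ξ ^ 2 ≤ (1 + M) * dH k ξ) → ‖f‖ ≤ 1 + M := fun f hf => by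
    have := hd.sq_norm_le (by linarith) hf
    refine abs_le_of_sq_le_sq' ?_ (by linarith) |>.2
    nlinarith
  have hs : ∀ᵐ ξ, 0 ≤ dH k ξ ∧ dH k ξ ^ 2 ≤ dH k ξ := by
    filter_upwards [hd.ae_nonneg, h.ya_add_dH] with ξ h1 h2
    exact ⟨h1.2.1, by nlinarith [h1.1, h1.2.1]⟩
  rw [Lag.norm_le_iff]
  refine ⟨?_, ?_, ?_, key _ ?_, key _ ?_, key _ ?_, key _ ?_⟩
  · refine (BoundedContinuousFunction.norm_le (by linarith)).2 fun ξ => ?_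
    have h1 := h.normalized ξ
    rw [yk] at h1
    have h2 : cζ k ξ = -cH k ξ := by linarith
    rw [h2, norm_neg, Real.norm_of_nonneg (hd.H_nonneg ξ)]
    linarith [hd.le ξ]
  · refine hd.norm_U_le.trans (Real.sqrt_le_iff.2 ⟨by linarith, by nlinarith⟩)
  · linarith [hd.norm_H_le]
  · filter_upwards [hs, h.ya_add_dH] with ξ h1 h2
    have h3 : dζ k ξ = -dH k ξ := by
      rw [ya] at h2
      linarith
    rw [h3, neg_sq]
    nlinarith [mul_nonneg hM h1.1]
  · filter_upwards [hs, h.ya_add_dH, lU_ae k, hd.ae_nonneg] with ξ h1 h2 h3 h4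
    rw [h3]
    have h5 : cU k ξ ^ 2 = cU k ξ ^ 2 * ya k ξ + cU k ξ ^ 2 * dH k ξ := by
      rw [← mul_add, h2, mul_one]
    have h6 := mul_le_mul_of_nonneg_right ((hd.sq_U_le ξ).trans (hd.le ξ)) h1.1
    linarith [h4.2.2.1]
  · filter_upwards [hs, h.ya_add_dH, hd.adm] with ξ h1 h2 ⟨h3, h4, _, h5⟩
    rw [← h5]
    have h6 := mul_nonneg (sq_nonneg (cU k ξ)) h3
    have h7 : eb k ξ ≤ dH k ξ := by
      rw [eb]
      linarith
    have h8 : ya k ξ * eb k ξ ≤ 1 * dH k ξ := mul_le_mul (by linarith) h7 h4 zero_le_one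
    nlinarith [mul_nonneg hM h1.1]
  · filter_upwards [hs] with ξ h1
    nlinarith [mul_nonneg hM h1.1]

end NData

/-! ## The projected flow -/

/-- The derivative bounds make both L·x - g and L·g - x nondecreasing. These are the two Lipschitz
estimates, and the resulting linear growth gives surjectivity. -/
theorem exists_homeo {g g' : ℝ → ℝ} {L : ℝ} (hL : 0 < L) (h : IsPrimitive g g')
    (h1 : ∀ᵐ x, g' x ≤ L) (h2 : ∀ᵐ x, 1 ≤ L * g' x) :
    ∃ f : ℝ ≃ₜ ℝ, (∀ x, f x = g x) ∧ Reg L f := by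
  have m1 : Monotone fun x => L * x - g x := ((IsPrimitive.id.const_mul L).sub h).monotone
    (h1.mono fun x hx => by linarith)
  have m2 : Monotone fun x => L * g x - x := ((h.const_mul L).sub IsPrimitive.id).monotone
    (h2.mono fun x hx => by linarith)
  have hlow : ∀ x y, x ≤ y → y - x ≤ L * (g y - g x) := fun x y hxy => by
    have : L * g x - x ≤ L * g y - y := m2 hxy
    linarith
  have hupp : ∀ x y, x ≤ y → g y - g x ≤ L * (y - x) := fun x y hxy => by
    have : L * x - g x ≤ L * y - g y := m1 hxy
    linarith
  have hmono : StrictMono g := fun x y hxy => by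
    have h3 := hlow x y hxy.le
    by_contra! hle
    nlinarith
  have htop : Tendsto g atTop atTop := by
    refine tendsto_atTop_mono' _ ?_ (tendsto_atTop_add_const_right _ (g 0)
      (tendsto_id.atTop_div_const hL))
    filter_upwards [eventually_ge_atTop 0] with x hx
    have := hlow 0 x hx
    rw [id, ← le_sub_iff_add_le, div_le_iff₀ hL]
    linarith
  have hbot : Tendsto g atBot atBot := by
    refine tendsto_atBot_mono' _ ?_ (tendsto_atBot_add_const_right _ (g 0)
      (tendsto_id.atBot_div_const hL))
    filter_upwards [eventually_le_atBot 0] with x hx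
    have := hlow x 0 hx
    rw [id, ← sub_le_iff_le_add, le_div_iff₀ hL]
    linarith
  let f : ℝ ≃ₜ ℝ := (hmono.orderIsoOfSurjective g
    (h.continuous.surjective htop hbot)).toHomeomorph
  have hf : ∀ x, f x = g x := fun x => rfl
  have hlow' : ∀ x y, |x - y| ≤ L * |f x - f y| := fun x y => by
    rw [hf, hf]
    rcases le_total x y with hxy | hxy
    · rw [abs_sub_comm, abs_of_nonneg (sub_nonneg.2 hxy), abs_sub_comm,
        abs_of_nonneg (sub_nonneg.2 (hmono.monotone hxy))]
      exact hlow x y hxy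
    · rw [abs_of_nonneg (sub_nonneg.2 hxy), abs_of_nonneg (sub_nonneg.2 (hmono.monotone hxy))]
      exact hlow y x hxy
  refine ⟨f, hf, hmono, fun x y => ?_, fun x y => ?_⟩
  · rw [hf, hf]
    rcases le_total x y with hxy | hxy
    · rw [abs_sub_comm, abs_of_nonneg (sub_nonneg.2 (hmono.monotone hxy)), abs_sub_comm,
        abs_of_nonneg (sub_nonneg.2 hxy)]
      exact hupp x y hxy
    · rw [abs_of_nonneg (sub_nonneg.2 hxy), abs_of_nonneg (sub_nonneg.2 (hmono.monotone hxy))]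
      exact hupp y x hxy
  · have := hlow' (f.symm x) (f.symm y)
    rwa [f.apply_symm_apply, f.apply_symm_apply] at this

variable {M T : ℝ}

/-- The bi-Lipschitz constant of `y + H` along solutions. -/
def regConst (M T : ℝ) : ℝ := (1 + M) * (4 * Real.exp ((1 + 2 * M) * T) ^ 2)

/-- With u² ≤ M, the quantities a + b and a + (b + u²a) agree up to a factor 1 + M. The factor `D`
transports a + b between the two times, and the normalisation fixes the initial value. -/
theorem two_sided_bound {M D a₀ b₀ u₀ a b u : ℝ} (hM : 0 ≤ M) (hD : 0 ≤ D)
    (ha₀ : 0 ≤ a₀) (hb₀ : 0 ≤ b₀) (ha : 0 ≤ a) (hb : 0 ≤ b) (hu₀ : u₀ ^ 2 ≤ M) (hu : u ^ 2 ≤ M)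
    (h₀ : a₀ + (b₀ + u₀ ^ 2 * a₀) = 1) (h1 : a + b ≤ D * (a₀ + b₀)) (h2 : a₀ + b₀ ≤ D * (a + b)) :
    a + (b + u ^ 2 * a) ≤ (1 + M) * D ∧ 1 ≤ (1 + M) * D * (a + (b + u ^ 2 * a)) := by
  have u1 := mul_le_mul_of_nonneg_right hu₀ ha₀
  have u2 := mul_le_mul_of_nonneg_right hu ha
  have p1 := mul_nonneg (sq_nonneg u₀) ha₀
  have p2 := mul_nonneg (sq_nonneg u) ha
  have q1 := mul_nonneg hM hb₀
  have q2 := mul_nonneg hM hb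
  constructor
  · have e1 : a + (b + u ^ 2 * a) ≤ (1 + M) * (a + b) := by linarith
    refine e1.trans (mul_le_mul_of_nonneg_left (h1.trans ?_) (by linarith))
    exact mul_le_of_le_one_right hD (by linarith)
  · have e1 : 1 ≤ (1 + M) * (a₀ + b₀) := by linarith
    have e2 : a₀ + b₀ ≤ D * (a + (b + u ^ 2 * a)) :=
      h2.trans (mul_le_mul_of_nonneg_left (by linarith) hD)
    rw [mul_assoc]
    exact e1.trans (mul_le_mul_of_nonneg_left e2 (by linarith))

theorem IsSol.yH_deriv_bounds {k : ℝ → Lag} (h : IsSol T k) (h₀ : NData M (k 0)) {t : ℝ}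
    (ht : t ∈ Icc 0 T) : ∀ᵐ ξ, ya (k t) ξ + dH (k t) ξ ≤ regConst M T ∧
      1 ≤ regConst M T * (ya (k t) ξ + dH (k t) ξ) := by
  have hd := h.data h₀.toData ht
  filter_upwards [h.adm_le h₀.toData ht, h₀.ya_add_dH, h₀.adm, hd.adm] with ξ h1 h3 h4 h5
  rw [Data.dH_eq] at h3 ⊢
  exact two_sided_bound hd.nonneg (by positivity) h4.1 h4.2.1 h5.1 h5.2.1
    ((h₀.toData.sq_U_le ξ).trans (h₀.le ξ)) ((hd.sq_U_le ξ).trans (hd.le ξ)) h3 h1.1 h1.2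

theorem reparam_of_yH {k : Lag} {f : ℝ ≃ₜ ℝ} {L : ℝ} (hf : ∀ ξ, f ξ = yk k ξ + cH k ξ)
    (hreg : Reg L f) : Reparam f := by
  have e : ∀ ξ, f ξ - ξ = cζ k ξ + cH k ξ := fun ξ => by
    rw [hf, yk]
    ring
  refine ⟨⟨_, hreg⟩, ⟨‖cζ k‖ + ‖cH k‖, fun ξ => ?_⟩, fun ξ => dζ k ξ + dH k ξ, ?_,
    (Lp.memLp (dζ k)).add (Lp.memLp (dH k))⟩
  · rw [e]
    exact (abs_add_le _ _).trans (add_le_add ((cζ k).abs_le ξ) ((cH k).abs_le ξ))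
  · rw [funext e]
    exact (isPrimitive_ζ k).add (isPrimitive_H k)

theorem IsSol.exists_reparam {k : ℝ → Lag} (h : IsSol T k) (h₀ : NData M (k 0)) {t : ℝ}
    (ht : t ∈ Icc 0 T) : ∃ f : ℝ ≃ₜ ℝ, (∀ ξ, f ξ = yk (k t) ξ + cH (k t) ξ) ∧
      Reg (regConst M T) f ∧ Reparam f := by
  have hM := h₀.toData.nonneg
  have hb := h.yH_deriv_bounds h₀ ht
  have hpos : 0 < regConst M T := by
    rw [regConst]
    positivity
  obtain ⟨f, hf, hreg⟩ := exists_homeo hpos (isPrimitive_yH (k t))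
    (hb.mono fun _ h => h.1) (hb.mono fun _ h => h.2)
  exact ⟨f, hf, hreg, reparam_of_yH hf hreg⟩

theorem proj_eq {k : Lag} {f : ℝ ≃ₜ ℝ} (hf : ∀ ξ, f ξ = yk k ξ + cH k ξ) :
    proj (toTriple k) = relabel (toTriple k) f.symm := by
  have e : (fun ξ => (toTriple k).y ξ + (toTriple k).H ξ) = f := funext fun ξ => (hf ξ).symm
  rw [proj, e]
  congr 1
  funext ξ
  apply f.injective
  rw [f.apply_symm_apply]
  exact Function.invFun_eq (f.surjective ξ)

theorem Data.nData_reparamLag {k : Lag} {f : ℝ ≃ₜ ℝ} {L : ℝ} (h : Data M k) (hL : Reg L f)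
    (hr : Reparam f) (hf : ∀ ξ, f ξ = yk k ξ + cH k ξ) :
    NData M (CamassaHolm.reparamLag hL.symm hr.symm k) := by
  refine ⟨h.reparamLag hL.symm hr.symm, fun ξ => ?_⟩
  rw [yk_reparamLag, cH_reparamLag, ← hf, f.apply_symm_apply]

/-- A description of the projected flow on `ℱ₀^M`. -/
theorem exists_flow {X : Triple} (hX : X ∈ F0M M) : ∃ k : ℝ → Lag, X = toTriple (k 0) ∧
    NData M (k 0) ∧ (∀ τ, IsSol τ k) ∧ IsGlobalSolution X (fun t => toTriple (k t)) ∧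
    (∀ t, 0 ≤ t → S t X = toTriple (k t)) ∧ ∀ T, ∀ t ∈ Icc 0 T, ∃ f : ℝ ≃ₜ ℝ,
      (∀ ξ, f ξ = yk (k t) ξ + cH (k t) ξ) ∧ Reg (regConst M T) f ∧ Reparam f ∧
      Sbar t X = relabel (toTriple (k t)) f.symm := by
  obtain ⟨k₀, rfl, h₀⟩ := mem_F0M_iff.1 hX
  obtain ⟨k, rfl, hk⟩ := exists_global h₀.toData
  have hs : ∀ τ, IsSol τ k := fun τ s hs => (hk s hs.1).mono Icc_subset_Ici_self
  refine ⟨k, rfl, h₀, hs, isGlobalSolution_of_lag hk h₀.toData,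
    fun t ht => S_eq hk h₀.toData ht, fun T t ht => ?_⟩
  obtain ⟨f, hf, hL, hr⟩ := (hs T).exists_reparam h₀ ht
  refine ⟨f, hf, hL, hr, ?_⟩
  rw [Sbar, S_eq hk h₀.toData ht.1, proj_eq hf]

theorem S_mem_F {X : Triple} (hX : X ∈ F0M M) {t : ℝ} (ht : 0 ≤ t) : S t X ∈ F := by
  obtain ⟨k, -, h₀, hs, -, hS, hf⟩ := exists_flow hX
  obtain ⟨f, hf, -, hr, -⟩ := hf t t (right_mem_Icc.2 ht)
  rw [hS t ht]
  exact ⟨((hs t).data h₀.toData (right_mem_Icc.2 ht)).memLagrangian, f,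
    mem_relabelingGroup_iff.2 hr, hf⟩

theorem Sbar_mem_F0M {X : Triple} (hX : X ∈ F0M M) {t : ℝ} (ht : 0 ≤ t) : Sbar t X ∈ F0M M := by
  obtain ⟨k, -, h₀, hs, -, hS, hf⟩ := exists_flow hX
  obtain ⟨f, hf, hL, hr, e⟩ := hf t t (right_mem_Icc.2 ht)
  rw [e, ← toTriple_reparamLag hL.symm hr.symm]
  exact mem_F0M_iff.2 ⟨_, rfl,
    ((hs t).data h₀.toData (right_mem_Icc.2 ht)).nData_reparamLag hL hr hf⟩

/-! ## The metric -/

theorem relabel_relabel (X : Triple) (p q : ℝ → ℝ) :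
    relabel (relabel X p) q = relabel X (fun ξ => p (q ξ)) := by
  refine Prod.ext (funext fun ξ => ?_) rfl
  change X.y (p (q ξ)) - q ξ + q ξ - ξ = X.y (p (q ξ)) - ξ
  ring

theorem relabel_id (X : Triple) : relabel X (Homeomorph.refl ℝ) = X := by
  refine Prod.ext (funext fun ξ => ?_) rfl
  change X.1 ξ + ξ - ξ = X.1 ξ
  ring

theorem normE_sub_comm (k l : Lag) :
    normE (toTriple k - toTriple l) = normE (toTriple l - toTriple k) := by
  rw [← toTriple_sub, ← toTriple_sub, normE_toTriple, normE_toTriple]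
  simp only [map_sub, norm_sub_rev]

theorem relabelingGroup_nonempty : Nonempty relabelingGroup :=
  ⟨⟨_, mem_relabelingGroup_iff.2 Reparam.refl⟩⟩

theorem J_le (X Y : Triple) {f g : ℝ ≃ₜ ℝ} (hf : Reparam f) (hg : Reparam g) :
    J X Y ≤ normE (relabel X f - Y) + normE (X - relabel Y g) :=
  ciInf_le (f := fun f : relabelingGroup × relabelingGroup =>
    normE (relabel X f.1.1 - Y) + normE (X - relabel Y f.2.1))
    ⟨0, by
      rintro _ ⟨p, rfl⟩
      exact add_nonneg (normE_nonneg _) (normE_nonneg _)⟩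
    (⟨f, mem_relabelingGroup_iff.2 hf⟩, ⟨g, mem_relabelingGroup_iff.2 hg⟩)

/-- One-sided stability of the projected flow under relabeling. -/
theorem exists_Sbar_relabel_le (hM : 0 ≤ M) (hT : 0 ≤ T) : ∃ C, 0 ≤ C ∧ ∀ X ∈ F0M M, ∀ Y ∈ F0M M,
    ∀ t ∈ Icc 0 T, ∀ f, Reparam f → normE (relabel X f - Y) ≤ 1 → ∃ g, Reparam g ∧
      normE (relabel (Sbar t X) g - Sbar t Y) ≤ C * normE (relabel X f - Y) := by
  -- The radius is the bound 1 + M for Y plus 2, from distance at most 1 in the norm of E and the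
  -- factor 2 between the two norms. It does not depend on the relabeling f.
  obtain ⟨C, hC, hlip⟩ := exists_lipschitz_bound M (3 + M) T hM hT
  have hL0 : 0 ≤ regConst M T := by
    rw [regConst]
    positivity
  -- The 6 and the 2 convert between the two norms, C comes from the flow, and the remaining factor
  -- bounds the composition with the inverse of y + H for S_t Y.
  refine ⟨6 * ((1 + regConst M T) * (1 + Real.sqrt (regConst M T)) * (C * 2)), by positivity,
    fun X hX Y hY t ht f hf hle => ?_⟩
  obtain ⟨k, rfl, hk₀, hk, -, -, hk'⟩ := exists_flow hX
  obtain ⟨l, rfl, hl₀, hl, -, -, hl'⟩ := exists_flow hY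
  obtain ⟨p, hp, hpL, hpr, ep⟩ := hk' T t ht
  obtain ⟨q, hq, hqL, hqr, eq⟩ := hl' T t ht
  obtain ⟨L, hL⟩ := hf.reg
  set δ := normE (relabel (toTriple (k 0)) f - toTriple (l 0)) with hδ
  have h1 : ‖reparamLag hL hf (k 0) - l 0‖ ≤ 2 * δ := by
    have := Lag.norm_le_normE (reparamLag hL hf (k 0) - l 0)
    rwa [toTriple_sub, toTriple_reparamLag] at this
  have h2 : ‖reparamLag hL hf (k 0)‖ ≤ 3 + M := by
    have := norm_le_norm_add_norm_sub' (reparamLag hL hf (k 0)) (l 0)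
    linarith [hl₀.norm_le]
  have h3 := hlip T le_rfl _ l ((hk T).reparamLag hL hf) (hl T) (hk₀.toData.reparamLag hL hf)
    hl₀.toData h2 (hl₀.norm_le.trans (by linarith)) t ht
  -- With p and q the functions y + H of S_t X and S_t Y, relabeling S̄_t X = S_t X ∘ p⁻¹ by p ∘ f ∘
  -- q⁻¹ gives (S_t X ∘ f) ∘ q⁻¹, directly comparable with S̄_t Y = S_t Y ∘ q⁻¹.
  refine ⟨q.symm.trans (f.trans p), hqr.symm.trans (hf.trans hpr), ?_⟩
  have e : relabel (Sbar t (toTriple (k 0))) (q.symm.trans (f.trans p)) -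
      Sbar t (toTriple (l 0)) =
      toTriple (compLag hqL.symm (reparamLag hL hf (k t) - l t)) := by
    have e1 : compLag hqL.symm (reparamLag hL hf (k t) - l t) =
        reparamLag hqL.symm hqr.symm (reparamLag hL hf (k t)) - reparamLag hqL.symm hqr.symm (l t) := by
      rw [map_sub]
      -- Relabeling is affine, and both elements receive the same translation (q⁻¹ - id, 0, 0), so
      -- it drops out of the difference.
      exact (add_sub_add_right_eq_sub _ _ _).symm
    rw [e1, toTriple_sub, toTriple_reparamLag, toTriple_reparamLag, toTriple_reparamLag, ep, eq,
      relabel_relabel, relabel_relabel]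
    congr 2
    funext ξ
    simp
  rw [e]
  refine (normE_toTriple_le _).trans ?_
  rw [mul_assoc]
  refine mul_le_mul_of_nonneg_left ((norm_compLag_le _ _).trans ?_) (by norm_num)
  rw [mul_assoc ((1 + _) * _)]
  refine mul_le_mul_of_nonneg_left (h3.trans ?_) (by positivity)
  rw [mul_assoc]
  exact mul_le_mul_of_nonneg_left h1 hC

theorem normE_F0M_sub {X Y : Triple} (hX : X ∈ F0M M) (hY : Y ∈ F0M M) :
    normE (X - Y) ≤ 12 * (1 + M) ∧ ∀ f, Reparam f →
      normE (X - relabel Y f) = normE (relabel Y f - X) := by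
  obtain ⟨k, rfl, hk⟩ := mem_F0M_iff.1 hX
  obtain ⟨l, rfl, hl⟩ := mem_F0M_iff.1 hY
  constructor
  · rw [← toTriple_sub]
    refine (normE_toTriple_le _).trans ?_
    linarith [norm_sub_le k l, hk.norm_le, hl.norm_le]
  · intro f hf
    obtain ⟨L, hL⟩ := hf.reg
    rw [← toTriple_reparamLag hL hf]
    exact normE_sub_comm _ _

/-- When the two terms of J sum to at most 1, the one-sided estimate applies to each, the second
with X and Y exchanged. Otherwise the identity relabelings suffice: the diameter of ℱ₀^M is at most
12(1 + M), hence J is at most 24(1 + M). -/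
theorem exists_J_le (hM : 0 ≤ M) (hT : 0 ≤ T) : ∃ C, 0 ≤ C ∧ ∀ X ∈ F0M M, ∀ Y ∈ F0M M,
    ∀ t ∈ Icc 0 T, J (Sbar t X) (Sbar t Y) ≤ C * J X Y := by
  obtain ⟨C, hC, hS⟩ := exists_Sbar_relabel_le hM hT
  have hC' : 0 ≤ C + 24 * (1 + M) := by positivity
  refine ⟨C + 24 * (1 + M), hC', fun X hX Y hY t ht => ?_⟩
  have := relabelingGroup_nonempty
  have hX' := Sbar_mem_F0M hX ht.1
  have hY' := Sbar_mem_F0M hY ht.1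
  rw [J.eq_1 X Y, Real.mul_iInf_of_nonneg hC']
  refine le_ciInf fun ⟨⟨f, hf⟩, ⟨g, hg⟩⟩ => ?_
  rw [mem_relabelingGroup_iff] at hf hg
  simp only
  set a := normE (relabel X f - Y) with ha
  set b := normE (X - relabel Y g) with hb
  have ha0 : 0 ≤ a := normE_nonneg _
  have hb0 : 0 ≤ b := normE_nonneg _
  have hsum := add_nonneg ha0 hb0
  rcases le_total 1 (a + b) with h1 | h1
  · have h2 := J_le (Sbar t X) (Sbar t Y) Reparam.refl Reparam.refl
    rw [relabel_id, relabel_id] at h2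
    have h3 := (normE_F0M_sub hX' hY').1
    have h4 := mul_le_mul_of_nonneg_left h1 (by linarith : 0 ≤ 24 * (1 + M))
    have h5 := mul_nonneg hC hsum
    rw [add_mul]
    linarith
  · obtain ⟨p, hp, hpl⟩ := hS X hX Y hY t ht f hf (by rw [← ha]; linarith)
    have hb' : b = normE (relabel Y g - X) := (normE_F0M_sub hX hY).2 g hg
    obtain ⟨q, hq, hql⟩ := hS Y hY X hX t ht g hg (by rw [← hb']; linarith)
    rw [← ha] at hpl
    rw [← hb', ← (normE_F0M_sub hX' hY').2 q hq] at hql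
    have h2 := J_le (Sbar t X) (Sbar t Y) hp hq
    have h5 := mul_nonneg (by linarith : 0 ≤ 24 * (1 + M)) hsum
    rw [add_mul]
    linarith

theorem dM_bddBelow (M : ℝ) (X Y : Triple) :
    BddBelow {s | ∃ (N : ℕ) (Z : ℕ → Triple), (∀ n ≤ N, Z n ∈ F0M M) ∧ Z 0 = X ∧ Z N = Y ∧
      s = ∑ n ∈ Finset.range N, J (Z n) (Z (n + 1))} := by
  refine ⟨0, ?_⟩
  rintro _ ⟨N, Z, -, -, -, rfl⟩
  refine Finset.sum_nonneg fun n _ => Real.iInf_nonneg fun p => ?_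
  exact add_nonneg (normE_nonneg _) (normE_nonneg _)

/-- S̄_t maps a chain in ℱ₀^M to a chain in ℱ₀^M between the images of the endpoints, so a bound on
each link passes to the infimum. -/
theorem dM_Sbar_le {C : ℝ} {t : ℝ} (hC : 0 ≤ C) (ht : 0 ≤ t)
    (h : ∀ X ∈ F0M M, ∀ Y ∈ F0M M, J (Sbar t X) (Sbar t Y) ≤ C * J X Y) {X Y : Triple}
    (hX : X ∈ F0M M) (hY : Y ∈ F0M M) : dM M (Sbar t X) (Sbar t Y) ≤ C * dM M X Y := by
  rw [dM.eq_1 M X Y, ← smul_eq_mul C, ← Real.sInf_smul_of_nonneg hC]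
  -- The one-step chain from X to Y shows that the set of chain lengths is nonempty, as a lower
  -- bound for a real infimum requires.
  refine le_csInf (Set.Nonempty.smul_set ⟨_, 1, fun n => if n = 0 then X else Y, fun n _ => ?_,
    rfl, rfl, rfl⟩) ?_
  · simp only
    split_ifs
    · exact hX
    · exact hY
  · rintro _ ⟨_, ⟨N, Z, hZ, rfl, rfl, rfl⟩, rfl⟩
    refine (csInf_le (dM_bddBelow M _ _) ⟨N, fun n => Sbar t (Z n),
      fun n hn => Sbar_mem_F0M (hZ n hn) ht, rfl, rfl, rfl⟩).trans ?_
    simp only [smul_eq_mul]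
    rw [Finset.mul_sum]
    refine Finset.sum_le_sum fun n hn => ?_
    have hn := Finset.mem_range.1 hn
    exact h _ (hZ n hn.le) _ (hZ (n + 1) hn)

end CamassaHolm

end

theorem mainTheorem2 (T M : ℝ) (hT : 0 < T) (hM : 0 < M) :
    -- the semigroups `S_t` and `S̄_t` are well defined on `ℱ₀^M`
    (∀ X₀ ∈ CamassaHolm.F0M M,
      (∃ X, CamassaHolm.IsGlobalSolution X₀ X ∧
        ∀ Y, CamassaHolm.IsGlobalSolution X₀ Y → ∀ t, 0 ≤ t → Y t = X t) ∧
      ∀ t, 0 ≤ t → CamassaHolm.S t X₀ ∈ CamassaHolm.F ∧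
        CamassaHolm.Sbar t X₀ ∈ CamassaHolm.F0M M) ∧
    -- Lipschitz stability
    ∃ C : ℝ, ∀ Xα ∈ CamassaHolm.F0M M, ∀ Xβ ∈ CamassaHolm.F0M M, ∀ t ∈ Set.Icc 0 T,
      CamassaHolm.dM M (CamassaHolm.Sbar t Xα) (CamassaHolm.Sbar t Xβ) ≤
        C * CamassaHolm.dM M Xα Xβ := by
  refine ⟨fun X₀ hX => ⟨?_, fun t ht => ⟨CamassaHolm.S_mem_F hX ht,
    CamassaHolm.Sbar_mem_F0M hX ht⟩⟩, ?_⟩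
  · obtain ⟨k, -, -, -, hk, -, -⟩ := CamassaHolm.exists_flow hX
    exact ⟨_, hk, fun Y hY t ht => hY.unique hk ht⟩
  · obtain ⟨C, hC, h⟩ := CamassaHolm.exists_J_le hM.le hT.le
    exact ⟨C, fun Xα hα Xβ hβ t ht => CamassaHolm.dM_Sbar_le hC ht.1
      (fun X hX Y hY => h X hX Y hY t ht) hα hβ⟩
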